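/- **Setting.** Let $(\mathcal X,d)$ be a locally compact separable metric space and $m$ a Radon measure on $\mathcal X$ with full support; write $B(x,r)=\{y:d(x,y)<r\}$, $V(x,r)=m(B(x,r))$. Let $J:\mathcal X\times\mathcal X\to[0,\infty]$ be a symmetric measurable kernel, $J(dx,dy)=J(x,y)\,m(dx)\,m(dy)$, $$\mathcal F=\Big\{u\in L^2(\mathcal X;m):\int_{\mathcal X\times\mathcal X}(u(x)-u(y))^2J(dx,dy)<\infty\Big\},\qquad \mathcal E(u,u)=\tfrac12\int_{\mathcal X\times\mathcal X}(u(x)-u(y))^2J(dx,dy),$$ and assume that $(\mathcal E,\mathcal F)$ is a regular Dirichlet form on $L^2(\mathcal X;m)$. Let $\phi:[0,\infty)\to[0,\infty)$ be strictly increasing with $\phi(0)=0$, $\phi(1)=1$ and $c_1(R/r)^{\beta_1}\le\phi(R)/\phi(r)\le c_2(R/r)^{\beta_2}$ for $0<r\le R$, where $c_1,c_2>0$ and $0<\beta_1\le\beta_2$. Assume: * (VD): $V(x,2r)\le C_{V}V(x,r)$ for all $x\in\mathcal X$, $r>0$, where $C_V>1$; * Cap$(\phi)_\le$: $\inf\{\mathcal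 E(f,f):f\in\mathcal F,\ f=1\text{ on }B(x,r),\ f=0\text{ off }B(x,2r)\}\le C_{\rm Cap}\,V(x,r)/\phi(r)$ for all $x\in\mathcal X$ and $0<r<\operatorname{diam}(\mathcal X)/3$, where $C_{\rm Cap}>0$; * ${\bf J}_\phi$: $\dfrac{C_{J,1}}{V(x,d(x,y))\phi(d(x,y))}\le J(x,y)\le\dfrac{C_{J,2}}{V(x,d(x,y))\phi(d(x,y))}$ for all $x\ne y$, where $C_{J,1},C_{J,2}>0$. Let $D\subset\mathcal X$ be a non-empty open set with $\overline D\ne\mathcal X$ that is Ahlfors regular: $m(B(x,r)\cap D)\ge c_D\,V(x,r)$ for all $x\in D$, $0<r<\operatorname{diam}(D)/2$, where $c_D\in(0,1]$. Put $m_0=m(\cdot\cap D)$, $B_D(x,r)=D\cap B(x,r)$, $$\bar{\mathcal F}=\Big\{u\in L^2(\overline D;m_0):\int_{D\times D}(u(x)-u(y))^2J(dx,dy)<\infty\Big\},\qquad \bar{\mathcal E}(u,u)=\tfrac12\int_{D\times D}(u(x)-u(y))^2J(dx,dy),$$ $\mathcal E_1(u,u)=\mathcal E(u,u)+\|u\|^2_{L^2(\mathcal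 X;m)}$ and $\bar{\mathcal E}_1(u,u)=\bar{\mathcal E}(u,u)+\|u\|^2_{L^2(\overline D;m_0)}$. **The extension operator.** A $\frac14$-Whitney cover of $\mathcal X\setminus\overline D$ is a family of pairwise disjoint balls $B_i=B(x_i,r_i)\subset\mathcal X\setminus\overline D$, $i\in I$, with $r_i=\frac15d(x_i,\overline D)>0$ and $\bigcup_iB(x_i,\frac52r_i)=\mathcal X\setminus\overline D$. Write $\lambda B_i=B(x_i,\lambda r_i)$ and $\Lambda=\{i\in I:r_i<\operatorname{diam}(D)/2\}$. Given such a cover and a number $A>1$, call $(f_i)_{i\in\Lambda}\subset L^2(\mathcal X;m)$, $(\eta_i)_{i\in I}\subset\mathcal F$ *admissible with constant $A$* if * $0\le f_i\le1$ and $\sum_{i\in\Lambda}f_i\le\mathbb 1_D$ $m$-a.e.; $\operatorname{diam}(\operatorname{supp}[f_i])\le2r_i$; $d(x_i,\operatorname{supp}[f_i])\le7r_i$; $A^{-1}m(B_i)\le\int_Df_i\,dm\le A\,m(B_i)$ for $i\in\Lambda$ (here $\operatorname{supp}[f]$ is the smallest closed set off which $f=0$ $m$-a.e.); * $0\le\eta_i\le1$,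 $\eta_i=1$ on $\frac52B_i$, $\eta_i=0$ off $3B_i$ ($m$-a.e.), and $\mathcal E(\eta_i,\eta_i)\le A\,m(B_i)/\phi(r_i)$ for $i\in I$. With $\psi_i=\eta_i/\sum_{j\in I}\eta_j$ and $[u]_i=\int_Df_iu\,dm\big/\int_Df_i\,dm$, the extension operator is $\mathfrak Eu=u$ on $\overline D$, $\mathfrak Eu=\sum_{i\in\Lambda}[u]_i\psi_i$ on $\mathcal X\setminus\overline D$. **Proposition.** There is $A_0>1$, depending only on the constants in (VD), Cap$(\phi)_\le$, ${\bf J}_\phi$, on $c_1,c_2,\beta_1,\beta_2$ and on $c_D$, such that for every $A\ge A_0$ the following hold. A $\frac14$-Whitney cover of $\mathcal X\setminus\overline D$ exists, and for each such cover there are admissible families with constant $A$. For every cover and all admissible families with constant $A$: 1. $\mathfrak Eu\in\mathcal F$ for every $u\in\bar{\mathcal F}$. 2. There is a constant $C_1>0$, depending only on $(\mathcal X,d,m,J,\phi)$, $D$ and $A$, such that $$\mathcal E_1(\mathfrak Eu,\mathfrak Eu)\le C_1\,\bar{\mathcal E}_1(u,u)\qquad\text{for every }u\in\bar{\mathcal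 F}.$$ Moreover, for every $\delta_0>0$, if $\operatorname{diam}(D)\ge\delta_0$ (in particular if $D$ is unbounded), then $C_1$ can be bounded by a constant depending only on $\delta_0$, $A$, the constants in (VD), Cap$(\phi)_\le$, ${\bf J}_\phi$, $c_1,c_2,\beta_1,\beta_2$ and $c_D$. 3. There is a constant $C>0$, depending only on $A$, the constants in (VD), Cap$(\phi)_\le$, ${\bf J}_\phi$, $c_1,c_2,\beta_1,\beta_2$ and $c_D$, such that for every $u\in\bar{\mathcal F}$, $x_0\in\overline D$ and $0<r<\operatorname{diam}(D)$, $$\int_{B(x_0,r)\times B(x_0,r)}\big(\mathfrak Eu(x)-\mathfrak Eu(y)\big)^2J(dx,dy)\le C\int_{B_D(x_0,7r)\times B_D(x_0,14r)}\big(u(x)-u(y)\big)^2J(dx,dy).$$ -/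

import Mathlib

open MeasureTheory Set Filter Topology Metric
open scoped ENNReal

universe u

namespace ReflectedJump

noncomputable section

variable {X : Type u} [MetricSpace X] [MeasurableSpace X]

/-- Volume doubling with constant `C`: `V(x, 2r) ≤ C V(x, r)` for all `x` and `r > 0`. -/
def VolumeDoubling (m : Measure X) (C : ℝ) : Prop :=
  ∀ (x : X) (r : ℝ), 0 < r → m (ball x (2 * r)) ≤ ENNReal.ofReal C * m (ball x r)

/-- Admissible scale functions `φ : [0,∞) → [0,∞)` (only the values on `[0,∞)` matter). -/
structure IsScaleFunction (φ : ℝ → ℝ) (c₁ c₂ β₁ β₂ : ℝ) : Prop where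
  strictMonoOn : StrictMonoOn φ (Ici 0)
  map_zero : φ 0 = 0
  map_one : φ 1 = 1
  lower : ∀ r R : ℝ, 0 < r → r ≤ R → c₁ * (R / r) ^ β₁ ≤ φ R / φ r
  upper : ∀ r R : ℝ, 0 < r → r ≤ R → φ R / φ r ≤ c₂ * (R / r) ^ β₂

/-- `∫_S (u(x) - u(y))² J(x,y) m(dx) m(dy)` for `S ⊆ X × X`, as an extended nonnegative number. -/
def energyOn (m : Measure X) (J : X → X → ℝ≥0∞) (S : Set (X × X)) (v : X → ℝ) : ℝ≥0∞ :=
  ∫⁻ p in S, ENNReal.ofReal ((v p.1 - v p.2) ^ 2) * J p.1 p.2 ∂(m.prod m)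

/-- Membership in `F`: square integrable functions with finite jump energy. -/
def MemF (m : Measure X) (J : X → X → ℝ≥0∞) (v : X → ℝ) : Prop :=
  MemLp v 2 m ∧ energyOn m J univ v < ∞

/-- The quadratic form `E(v,v)`. -/
def form (m : Measure X) (J : X → X → ℝ≥0∞) (v : X → ℝ) : ℝ≥0∞ :=
  2⁻¹ * energyOn m J univ v

/-- `E₁(v,v) = E(v,v) + ‖v‖²` in `L²(X; m)`. -/
def formOne (m : Measure X) (J : X → X → ℝ≥0∞) (v : X → ℝ) : ℝ≥0∞ :=
  form m J v + ∫⁻ x, ENNReal.ofReal (v x ^ 2) ∂m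

/-- `(E, F)` is the regular symmetric pure jump form with jump kernel `J`: the kernel is measurable
and symmetric, and `F ∩ C_c(X)` is dense in `F` for the norm `E₁^{1/2}` and in `C_c(X)` for the
uniform norm. (Closedness and the Markov property are automatic, since `F` is the maximal domain,
by Fatou's lemma; density of `F` in `L²` follows from the second density.) -/
structure IsRegularJumpForm (m : Measure X) (J : X → X → ℝ≥0∞) : Prop where
  measurable : Measurable (fun p : X × X => J p.1 p.2)
  symm : ∀ x y, J x y = J y x
  dense_form : ∀ v : X → ℝ, MemF m J v → ∀ ε : ℝ≥0∞, 0 < ε →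
    ∃ w : X → ℝ, MemF m J w ∧ Continuous w ∧ HasCompactSupport w ∧
      formOne m J (fun x => v x - w x) < ε
  dense_unif : ∀ v : X → ℝ, Continuous v → HasCompactSupport v → ∀ ε : ℝ, 0 < ε →
    ∃ w : X → ℝ, MemF m J w ∧ Continuous w ∧ HasCompactSupport w ∧ ∀ x, |v x - w x| < ε

/-- Two-sided bounds on the jump kernel off the diagonal, with constants `C₁` and `C₂`. -/
def JumpBounds (m : Measure X) (J : X → X → ℝ≥0∞) (φ : ℝ → ℝ) (C₁ C₂ : ℝ) : Prop :=
  ∀ x y : X, x ≠ y →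
    ENNReal.ofReal C₁ / (m (ball x (dist x y)) * ENNReal.ofReal (φ (dist x y))) ≤ J x y ∧
    J x y ≤ ENNReal.ofReal C₂ / (m (ball x (dist x y)) * ENNReal.ofReal (φ (dist x y)))

/-- The relative capacity `Cap(A, B)`: the infimum of `E(v,v)` over `v ∈ F` with `v = 1` on `A` and
`v = 0` off `B` (for elements of `L²(X; m)`, hence almost everywhere); it is `∞` if there is no
such `v`. -/
def relCap (m : Measure X) (J : X → X → ℝ≥0∞) (A B : Set X) : ℝ≥0∞ :=
  ⨅ (v : X → ℝ) (_ : MemF m J v ∧ (∀ᵐ x ∂m, x ∈ A → v x = 1) ∧ (∀ᵐ x ∂m, x ∉ B → v x = 0)),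
    form m J v

/-- The capacity upper bound `Cap(B(x,r), B(x,2r)) ≤ c m(B(x,r)) / φ(r)` for `r < diam(X)/3`. -/
def CapUpper (m : Measure X) (J : X → X → ℝ≥0∞) (φ : ℝ → ℝ) (c : ℝ) : Prop :=
  ∀ (x : X) (r : ℝ), 0 < r → ENNReal.ofReal r < ediam (univ : Set X) / 3 →
    relCap m J (ball x r) (ball x (2 * r)) ≤
      ENNReal.ofReal c * m (ball x r) / ENNReal.ofReal (φ r)

/-- Ahlfors regularity of `D` with constant `c`. -/
def AhlforsRegular (m : Measure X) (D : Set X) (c : ℝ) : Prop :=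
  ∀ x ∈ D, ∀ r : ℝ, 0 < r → ENNReal.ofReal r < ediam D / 2 →
    ENNReal.ofReal c * m (ball x r) ≤ m (ball x r ∩ D)

/-- Membership in the active reflected Dirichlet space of `D`. The measure `m₀` is `m` restricted to
`D`; a function on `closure D` is represented by a function on `X` whose values off `closure D` play
no role. -/
def MemReflected (m : Measure X) (J : X → X → ℝ≥0∞) (D : Set X) (v : X → ℝ) : Prop :=
  MemLp v 2 (m.restrict D) ∧ energyOn m J (D ×ˢ D) v < ∞

/-- The reflected form plus the squared norm of `L²(closure D; m₀)`. -/
def reflectedFormOne (m : Measure X) (J : X → X → ℝ≥0∞) (D : Set X) (v : X → ℝ) : ℝ≥0∞ :=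
  2⁻¹ * energyOn m J (D ×ˢ D) v + ∫⁻ x in D, ENNReal.ofReal (v x ^ 2) ∂m

/-- An `ε`-Whitney cover of `U`, indexed by `ι`. -/
structure WhitneyCover (ε : ℝ) (U : Set X) (ι : Type u) where
  center : ι → X
  radius : ι → ℝ
  center_mem : ∀ i, center i ∈ U
  radius_pos : ∀ i, 0 < radius i
  ball_subset : ∀ i, ball (center i) (radius i) ⊆ U
  disjoint : ∀ i j, i ≠ j → Disjoint (ball (center i) (radius i)) (ball (center j) (radius j))
  radius_eq : ∀ i, radius i = ε / (1 + ε) * infDist (center i) Uᶜ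
  cover : ⋃ i, ball (center i) (2 * (1 + ε) * radius i) = U

/-- `Λ = {i : r_i < diam(D)/2}`. -/
def WhitneyCover.small {ε : ℝ} {U : Set X} {ι : Type u} (W : WhitneyCover ε U ι) (D : Set X) :
    Set ι :=
  {i | ENNReal.ofReal (W.radius i) < ediam D / 2}

/-- The support of a function in `L²(X; m)`: the smallest closed set off which it vanishes
almost everywhere. -/
def essSupp (m : Measure X) (g : X → ℝ) : Set X :=
  ⋂₀ {K : Set X | IsClosed K ∧ ∀ᵐ x ∂m, x ∉ K → g x = 0}

/-- The families `(f_i)`, `i ∈ Λ`, of weights in `D` over which a function is averaged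
(the values `f i` for `i ∉ Λ` play no role). -/
structure IsWeightFamily {ε : ℝ} {U : Set X} {ι : Type u} (m : Measure X) (D : Set X)
    (W : WhitneyCover ε U ι) (A : ℝ) (f : ι → X → ℝ) : Prop where
  memLp : ∀ i ∈ W.small D, MemLp (f i) 2 m
  mem_Icc : ∀ i ∈ W.small D, ∀ᵐ x ∂m, f i x ∈ Icc (0 : ℝ) 1
  sum_le : ∀ᵐ x ∂m, ∑' i : W.small D, ENNReal.ofReal (f i x) ≤ D.indicator (fun _ => 1) x
  diam_supp : ∀ i ∈ W.small D, ediam (essSupp m (f i)) ≤ ENNReal.ofReal (2 * W.radius i)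
  dist_supp : ∀ i ∈ W.small D,
    infEDist (W.center i) (essSupp m (f i)) ≤ ENNReal.ofReal (7 * W.radius i)
  mass_lower : ∀ i ∈ W.small D, ENNReal.ofReal A⁻¹ * m (ball (W.center i) (W.radius i)) ≤
    ∫⁻ x in D, ENNReal.ofReal (f i x) ∂m
  mass_upper : ∀ i ∈ W.small D, ∫⁻ x in D, ENNReal.ofReal (f i x) ∂m ≤
    ENNReal.ofReal A * m (ball (W.center i) (W.radius i))

/-- The families `(η_i)` of cut-off functions in `F` for `(5/2)B_i ⊆ 3B_i`, with energy at most
`A m(B_i) / φ(r_i)`. -/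
structure IsCutoffFamily {ε : ℝ} {U : Set X} {ι : Type u} (m : Measure X) (J : X → X → ℝ≥0∞)
    (φ : ℝ → ℝ) (W : WhitneyCover ε U ι) (A : ℝ) (η : ι → X → ℝ) : Prop where
  memF : ∀ i, MemF m J (η i)
  mem_Icc : ∀ i, ∀ᵐ x ∂m, η i x ∈ Icc (0 : ℝ) 1
  eq_one : ∀ i, ∀ᵐ x ∂m, x ∈ ball (W.center i) (5 / 2 * W.radius i) → η i x = 1
  eq_zero : ∀ i, ∀ᵐ x ∂m, x ∉ ball (W.center i) (3 * W.radius i) → η i x = 0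
  energy : ∀ i, form m J (η i) ≤
    ENNReal.ofReal A * m (ball (W.center i) (W.radius i)) / ENNReal.ofReal (φ (W.radius i))

open Classical in
/-- The partition of unity `ψ_i = η_i / ∑_j η_j` off `closure D`, extended by `0`. -/
def partitionFn {ι : Type u} (D : Set X) (η : ι → X → ℝ) (i : ι) (x : X) : ℝ :=
  if x ∈ closure D then 0 else η i x / ∑' j, η j x

/-- The weighted average `[v]_i = ∫_D f_i v dm / ∫_D f_i dm`. -/
def average {ι : Type u} (m : Measure X) (D : Set X) (f : ι → X → ℝ) (v : X → ℝ) (i : ι) : ℝ :=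
  (∫ x in D, f i x * v x ∂m) / ∫ x in D, f i x ∂m

open Classical in
/-- The extension operator: `v` on `closure D`, and `∑_{i ∈ Λ} [v]_i ψ_i` off `closure D`. -/
def extension {ε : ℝ} {U : Set X} {ι : Type u} (m : Measure X) (D : Set X)
    (W : WhitneyCover ε U ι) (f η : ι → X → ℝ) (v : X → ℝ) (x : X) : ℝ :=
  if x ∈ closure D then v x
  else ∑' i : W.small D, average m D f v i * partitionFn D η i x

end

end ReflectedJump

/-!
Points off `closure D` are reached through a Whitney cover: the ball `B_i` has a radius `r_i`
comparable to its distance to `D`, so it looks into `D` at scale `r_i`, and by Ahlfors regularity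
a fixed part of the mass at that scale lies in `D`.

* **Averaging weights.** Near `B_i` choose a piece of `D` of mass comparable to `m(B_i)`. These
  pieces have a Carleson packing property: the ones that meet a given piece and belong to balls that
  are no larger have total mass at most a constant times the mass of that piece, because the balls
  `B_i` are disjoint. Keeping in each piece the points that few of these cover gives sets of bounded
  overlap, and constant multiples of their indicators are weights with `∑ f_i ≤ 1_D`
  (`exists_isWeightFamily`). Cut-offs come from the capacity bound (`exists_isCutoffFamily`).

* **Reduction to sums.** Boundary points of `D` are never density points of the boundary, so the
  boundary is null (`measure_closure_diff_eq_zero`) and the extension is determined by its values on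
  `D` and off `closure D`. There the extension is `∑ a_i ψ_i` with a partition of unity `ψ_i`, and
  its energy is bounded by a double sum of `(a_i - a_j)²` against an interaction of the indices
  (`energyOn_glue_diff_le`). Pairs of points in a common ball `3 B_i` only involve the boundedly many
  `j` with `3 B_j` meeting `3 B_i`; these have `r_j` comparable to `r_i`, and the interaction is
  controlled by the energy of the cut-offs, of order `m(B_i) / φ(r_i)`. The other pairs of points
  have a distance at least comparable to the radii, and contribute the integral of `J ψ_i ψ_j`.

* **Return to `D`.** When both coefficients are averages, Jensen's inequality turns
  `(a_i - a_j)²` into an integral of `(u(z) - u(w))²` against `f_i(z) f_j(w)`. The points `z`, `w` are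
  at a distance comparable to that of the balls, or smaller, so by doubling and the two-sided bounds
  for `J` the interaction is at most a constant times `J(z, w)`, and `∑ f_i ≤ 1` sums these terms to
  the energy of `u` on `D`. The pairs with one point in `D` are treated in the same way. Balls of size
  at least `diam D / 2` carry no average; their terms are bounded by the tail of `J` at that scale
  and cost a multiple of `‖u‖²`. Both are in `energyOn_glue_le`.

A Whitney ball whose triple meets `B(x₀, r)` with `x₀ ∈ closure D` has radius less than `r / 2`, and
the support of its weight lies in `B(x₀, 7 r)`. For `r < diam D` there are thus no large balls, and
the local estimate holds without the `L²` term.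
-/

namespace ReflectedJump

noncomputable section

set_option linter.unusedSectionVars false

/-! ### Volume, scale function and jump kernel -/

/-- The quantitative data of volume doubling, of the scale function and of the jump kernel bounds.
All estimates below are in terms of these numbers. -/
structure Constants where
  (Cv c₁ c₂ β₁ β₂ J₁ J₂ : ℝ)
  one_lt_Cv : 1 < Cv
  c₁_pos : 0 < c₁
  c₂_pos : 0 < c₂
  β₁_pos : 0 < β₁
  J₁_pos : 0 < J₁

namespace Constants

variable (k : Constants)

/-- The doubling constant as an extended nonnegative number. -/
def V : ℝ≥0∞ := ENNReal.ofReal k.Cv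

/-- The factor by which `φ` grows at most when the radius is multiplied by `2 ^ n`. -/
def Q (n : ℕ) : ℝ≥0∞ := ENNReal.ofReal (k.c₂ * ((2 : ℝ) ^ n) ^ k.β₂)

/-- The factor by which `V(x, r) φ(r)` grows at most when the radius is multiplied by `2 ^ n`. -/
def G (n : ℕ) : ℝ≥0∞ := k.V ^ n * k.Q n

/-- The factor in the comparison of two values of the jump kernel. -/
def H (n : ℕ) : ℝ≥0∞ := ENNReal.ofReal k.J₂ * (k.G n / ENNReal.ofReal k.J₁)

/-- The ratio of the geometric series that bounds the tail of the jump kernel. -/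
def q : ℝ≥0∞ := ENNReal.ofReal ((2 : ℝ) ^ k.β₁)⁻¹

/-- The constant in the bound for the tail of the jump kernel. -/
def tail : ℝ≥0∞ := ENNReal.ofReal k.J₂ * k.V * (ENNReal.ofReal k.c₁)⁻¹ * (1 - k.q)⁻¹

lemma V_ne_top : k.V ≠ ∞ := ENNReal.ofReal_ne_top

lemma one_le_V : 1 ≤ k.V := by
  rw [V, ENNReal.one_le_ofReal]; exact k.one_lt_Cv.le

lemma Q_ne_top (n : ℕ) : k.Q n ≠ ∞ := ENNReal.ofReal_ne_top

lemma G_ne_top (n : ℕ) : k.G n ≠ ∞ :=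
  ENNReal.mul_ne_top (ENNReal.pow_ne_top k.V_ne_top) (k.Q_ne_top n)

lemma H_ne_top (n : ℕ) : k.H n ≠ ∞ :=
  ENNReal.mul_ne_top ENNReal.ofReal_ne_top
    (ENNReal.div_ne_top (k.G_ne_top n) (ENNReal.ofReal_pos.2 k.J₁_pos).ne')

lemma q_lt_one : k.q < 1 := by
  rw [q, ENNReal.ofReal_lt_one]
  exact inv_lt_one_of_one_lt₀ (Real.one_lt_rpow (by norm_num) k.β₁_pos)

lemma tail_ne_top : k.tail ≠ ∞ := by
  refine ENNReal.mul_ne_top (ENNReal.mul_ne_top (ENNReal.mul_ne_top ENNReal.ofReal_ne_top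
    k.V_ne_top) ?_) ?_
  · exact ENNReal.inv_ne_top.2 (ENNReal.ofReal_pos.2 k.c₁_pos).ne'
  · exact ENNReal.inv_ne_top.2 (tsub_pos_of_lt k.q_lt_one).ne'

end Constants

/-- The standing assumptions on the space, the scale function and the jump kernel, apart from the
capacity bound. -/
structure IsJumpSpace {X : Type u} [MetricSpace X] [MeasurableSpace X] (k : Constants)
    (m : Measure X) (J : X → X → ℝ≥0∞) (φ : ℝ → ℝ) : Prop where
  scale : IsScaleFunction φ k.c₁ k.c₂ k.β₁ k.β₂
  measurable : Measurable (fun p : X × X => J p.1 p.2)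
  symm : ∀ x y, J x y = J y x
  doubling : VolumeDoubling m k.Cv
  jump : JumpBounds m J φ k.J₁ k.J₂

/-- The scale function with extended nonnegative values. -/
def scaleE (φ : ℝ → ℝ) (r : ℝ) : ℝ≥0∞ := ENNReal.ofReal (φ r)

variable {X : Type u} [MetricSpace X] [SecondCountableTopology X] [MeasurableSpace X] [BorelSpace X]
  {m : Measure X} [IsLocallyFiniteMeasure m] [m.IsOpenPosMeasure]
  {k : Constants} {J : X → X → ℝ≥0∞} {φ : ℝ → ℝ}

namespace IsJumpSpace

lemma measure_ball_two_pow_mul_le (h : IsJumpSpace k m J φ) (x : X) {r : ℝ} (hr : 0 < r) (n : ℕ) :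
    m (ball x (2 ^ n * r)) ≤ k.V ^ n * m (ball x r) := by
  induction n with
  | zero => simp
  | succ n ih =>
    calc m (ball x (2 ^ (n + 1) * r)) = m (ball x (2 * (2 ^ n * r))) := by congr 2; ring
      _ ≤ k.V * m (ball x (2 ^ n * r)) := h.doubling x _ (by positivity)
      _ ≤ k.V * (k.V ^ n * m (ball x r)) := by gcongr
      _ = k.V ^ (n + 1) * m (ball x r) := by rw [pow_succ]; ring

lemma measure_ball_ne_top (h : IsJumpSpace k m J φ) (x : X) (r : ℝ) : m (ball x r) ≠ ∞ := by
  obtain ⟨ε, hε, hfin⟩ := (nhds_basis_ball.mem_iff.1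
    (IsLocallyFiniteMeasure.finiteAtNhds (μ := m) x).choose_spec.1)
  have hε' : m (ball x ε) ≠ ∞ := ((measure_mono hfin).trans_lt
    (IsLocallyFiniteMeasure.finiteAtNhds (μ := m) x).choose_spec.2).ne
  obtain ⟨n, hn⟩ := pow_unbounded_of_one_lt (r / ε) (one_lt_two (α := ℝ))
  refine ne_top_of_le_ne_top (ENNReal.mul_ne_top (ENNReal.pow_ne_top k.V_ne_top) hε')
    ((measure_mono (ball_subset_ball ?_)).trans (h.measure_ball_two_pow_mul_le x hε n))
  exact ((div_lt_iff₀ hε).1 hn).le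

lemma measure_ball_le (h : IsJumpSpace k m J φ) {x z : X} {r R : ℝ} (n : ℕ) (hr : 0 < r)
    (hR : dist x z + R ≤ 2 ^ n * r) : m (ball z R) ≤ k.V ^ n * m (ball x r) := by
  refine (measure_mono (ball_subset_ball' ?_)).trans (h.measure_ball_two_pow_mul_le x hr n)
  rw [dist_comm]; linarith

lemma scale_pos (h : IsJumpSpace k m J φ) {r : ℝ} (hr : 0 < r) : 0 < φ r := by
  have := h.scale.strictMonoOn (mem_Ici.2 le_rfl) (mem_Ici.2 hr.le) hr
  rwa [h.scale.map_zero] at this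

lemma scaleE_ne_zero (h : IsJumpSpace k m J φ) {r : ℝ} (hr : 0 < r) : scaleE φ r ≠ 0 :=
  (ENNReal.ofReal_pos.2 (h.scale_pos hr)).ne'

lemma scaleE_ne_top {r : ℝ} : scaleE φ r ≠ ∞ := ENNReal.ofReal_ne_top

lemma scaleE_mono (h : IsJumpSpace k m J φ) {r R : ℝ} (hr : 0 ≤ r) (hR : r ≤ R) :
    scaleE φ r ≤ scaleE φ R :=
  ENNReal.ofReal_le_ofReal (h.scale.strictMonoOn.monotoneOn (mem_Ici.2 hr)
    (mem_Ici.2 (hr.trans hR)) hR)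

lemma scaleE_le (h : IsJumpSpace k m J φ) {r R : ℝ} (n : ℕ) (hr : 0 < r) (hR₀ : 0 ≤ R)
    (hR : R ≤ 2 ^ n * r) : scaleE φ R ≤ k.Q n * scaleE φ r := by
  refine (h.scaleE_mono hR₀ hR).trans ?_
  have h1 : r ≤ 2 ^ n * r := le_mul_of_one_le_left hr.le (one_le_pow₀ one_le_two)
  have := h.scale.upper r (2 ^ n * r) hr h1
  rw [mul_div_cancel_right₀ _ hr.ne', div_le_iff₀ (h.scale_pos hr)] at this
  rw [scaleE, scaleE, Constants.Q, ← ENNReal.ofReal_mul (by have := k.c₂_pos; positivity)]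
  exact ENNReal.ofReal_le_ofReal this

lemma scaleE_two_pow_mul_ge (h : IsJumpSpace k m J φ) {r : ℝ} (n : ℕ) (hr : 0 < r) :
    (scaleE φ (2 ^ n * r))⁻¹ ≤ (ENNReal.ofReal k.c₁)⁻¹ * k.q ^ n * (scaleE φ r)⁻¹ := by
  have h1 : r ≤ 2 ^ n * r := le_mul_of_one_le_left hr.le (one_le_pow₀ one_le_two)
  have := h.scale.lower r (2 ^ n * r) hr h1
  rw [mul_div_cancel_right₀ _ hr.ne', le_div_iff₀ (h.scale_pos hr)] at this
  have hc := k.c₁_pos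
  have hφ := h.scale_pos hr
  have h2 : (0 : ℝ) < 2 ^ k.β₁ := by positivity
  have e : ((2 : ℝ) ^ n) ^ k.β₁ = (2 ^ k.β₁) ^ n := by
    rw [← Real.rpow_natCast, ← Real.rpow_mul (by norm_num), mul_comm, Real.rpow_mul (by norm_num),
      Real.rpow_natCast]
  rw [e] at this
  rw [scaleE, scaleE, Constants.q, ← ENNReal.ofReal_inv_of_pos (h.scale_pos (by positivity)),
    ← ENNReal.ofReal_inv_of_pos hc, ← ENNReal.ofReal_inv_of_pos hφ,
    ← ENNReal.ofReal_pow (by positivity), ← ENNReal.ofReal_mul (by positivity),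
    ← ENNReal.ofReal_mul (by positivity)]
  refine ENNReal.ofReal_le_ofReal ?_
  rw [inv_pow, ← mul_inv, ← mul_inv]
  exact inv_anti₀ (by positivity) this

/-- Volume times scale is doubling under a change of centre and radius. -/
lemma volume_mul_scaleE_le (h : IsJumpSpace k m J φ) {x z : X} {r R : ℝ} (n : ℕ) (hr : 0 < r)
    (hR₀ : 0 ≤ R) (hR : dist x z + R ≤ 2 ^ n * r) :
    m (ball z R) * scaleE φ R ≤ k.G n * (m (ball x r) * scaleE φ r) := by
  calc m (ball z R) * scaleE φ R ≤ (k.V ^ n * m (ball x r)) * (k.Q n * scaleE φ r) := by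
        gcongr
        · exact h.measure_ball_le n hr hR
        · exact h.scaleE_le n hr hR₀ (by linarith [dist_nonneg (x := x) (y := z)])
    _ = _ := by rw [Constants.G]; ring

lemma volume_mul_scaleE_ne_zero (h : IsJumpSpace k m J φ) (x : X) {r : ℝ} (hr : 0 < r) :
    m (ball x r) * scaleE φ r ≠ 0 :=
  mul_ne_zero (measure_ball_pos m x hr).ne' (h.scaleE_ne_zero hr)

lemma volume_mul_scaleE_ne_top (h : IsJumpSpace k m J φ) (x : X) (r : ℝ) :
    m (ball x r) * scaleE φ r ≠ ∞ :=
  ENNReal.mul_ne_top (h.measure_ball_ne_top x r) scaleE_ne_top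

/-- Lower bound for the jump kernel between two points that are close to a ball. -/
lemma inv_volume_mul_scaleE_le (h : IsJumpSpace k m J φ) {x z w : X} {r : ℝ} (n : ℕ) (hr : 0 < r)
    (hzw : z ≠ w) (hR : dist x z + dist z w ≤ 2 ^ n * r) :
    (m (ball x r) * scaleE φ r)⁻¹ ≤ k.G n / ENNReal.ofReal k.J₁ * J z w := by
  have hJ := (ENNReal.ofReal_pos.2 k.J₁_pos).ne'
  have hd : 0 < dist z w := dist_pos.2 hzw
  have h1 := h.volume_mul_scaleE_le n hr hd.le hR
  have h2 := (h.jump z w hzw).1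
  have h3 : (m (ball x r) * scaleE φ r)⁻¹ ≤ k.G n * (m (ball z (dist z w)) *
      scaleE φ (dist z w))⁻¹ := by
    rw [← div_eq_mul_inv, ENNReal.le_div_iff_mul_le
      (Or.inl (h.volume_mul_scaleE_ne_zero z hd)) (Or.inl (h.volume_mul_scaleE_ne_top z _)),
      mul_comm, ← div_eq_mul_inv]
    exact ENNReal.div_le_of_le_mul h1
  refine h3.trans ?_
  calc k.G n * (m (ball z (dist z w)) * scaleE φ (dist z w))⁻¹
      = k.G n / ENNReal.ofReal k.J₁ *
        (ENNReal.ofReal k.J₁ / (m (ball z (dist z w)) * scaleE φ (dist z w))) := by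
        rw [div_eq_mul_inv, div_eq_mul_inv, mul_assoc, ← mul_assoc (ENNReal.ofReal k.J₁)⁻¹,
          ENNReal.inv_mul_cancel hJ ENNReal.ofReal_ne_top, one_mul]
    _ ≤ _ := by gcongr; exact h2

/-- Comparison of two values of the jump kernel. -/
lemma jump_le (h : IsJumpSpace k m J φ) {x y z w : X} (n : ℕ) (hxy : x ≠ y) (hzw : z ≠ w)
    (hR : dist x z + dist z w ≤ 2 ^ n * dist x y) : J x y ≤ k.H n * J z w := by
  refine (h.jump x y hxy).2.trans ?_
  rw [Constants.H, mul_assoc, div_eq_mul_inv]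
  gcongr
  exact h.inv_volume_mul_scaleE_le n (dist_pos.2 hxy) hzw hR

/-- The tail of the jump kernel. -/
lemma lintegral_jump_le (h : IsJumpSpace k m J φ) (x : X) {s : ℝ} (hs : 0 < s) :
    ∫⁻ y in {y | s ≤ dist x y}, J x y ∂m ≤ k.tail * (scaleE φ s)⁻¹ := by
  let E : ℕ → Set X := fun n => {y | 2 ^ n * s ≤ dist x y ∧ dist x y < 2 ^ (n + 1) * s}
  have hE : {y | s ≤ dist x y} ⊆ ⋃ n, E n := by
    intro y hy
    have hy' : 1 ≤ dist x y / s := (one_le_div hs).2 hy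
    obtain ⟨n, h1, h2⟩ := exists_nat_pow_near hy' (one_lt_two (α := ℝ))
    refine mem_iUnion.2 ⟨n, (le_div_iff₀ hs).1 h1, (div_lt_iff₀ hs).1 h2⟩
  have hEm : ∀ n, MeasurableSet (E n) := fun n =>
    (measurableSet_le measurable_const (measurable_const.dist measurable_id)).inter
      (measurableSet_lt (measurable_const.dist measurable_id) measurable_const)
  have hterm : ∀ n, ∫⁻ y in E n, J x y ∂m ≤ ENNReal.ofReal k.J₂ * k.V *
      (ENNReal.ofReal k.c₁)⁻¹ * (scaleE φ s)⁻¹ * k.q ^ n := by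
    intro n
    have hr : 0 < 2 ^ n * s := by positivity
    calc ∫⁻ y in E n, J x y ∂m
        ≤ ∫⁻ y in E n, ENNReal.ofReal k.J₂ / (m (ball x (2 ^ n * s)) * scaleE φ (2 ^ n * s)) ∂m := by
          refine setLIntegral_mono' (hEm n) fun y hy => ?_
          have hxy : x ≠ y := dist_pos.1 (hr.trans_le hy.1)
          refine (h.jump x y hxy).2.trans ?_
          gcongr
          · exact hy.1
          · exact h.scaleE_mono hr.le hy.1
      _ = ENNReal.ofReal k.J₂ / (m (ball x (2 ^ n * s)) * scaleE φ (2 ^ n * s)) * m (E n) := by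
          rw [setLIntegral_const]
      _ ≤ ENNReal.ofReal k.J₂ / (m (ball x (2 ^ n * s)) * scaleE φ (2 ^ n * s)) *
          (k.V * m (ball x (2 ^ n * s))) := by
          gcongr
          calc m (E n) ≤ m (ball x (2 * (2 ^ n * s))) := by
                refine measure_mono fun y hy => ?_
                rw [mem_ball, dist_comm]
                calc _ < _ := hy.2
                  _ = _ := by ring
            _ ≤ _ := h.doubling x _ hr
      _ = ENNReal.ofReal k.J₂ * k.V * (scaleE φ (2 ^ n * s))⁻¹ := by
          have h1 := (measure_ball_pos m x hr).ne'
          have h2 := h.measure_ball_ne_top x (2 ^ n * s)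
          rw [div_eq_mul_inv, ENNReal.mul_inv (Or.inl h1) (Or.inl h2)]
          calc _ = ENNReal.ofReal k.J₂ * k.V * (scaleE φ (2 ^ n * s))⁻¹ *
                ((m (ball x (2 ^ n * s)))⁻¹ * m (ball x (2 ^ n * s))) := by ring
            _ = _ := by rw [ENNReal.inv_mul_cancel h1 h2, mul_one]
      _ ≤ ENNReal.ofReal k.J₂ * k.V * ((ENNReal.ofReal k.c₁)⁻¹ * k.q ^ n * (scaleE φ s)⁻¹) := by
          gcongr; exact h.scaleE_two_pow_mul_ge n hs
      _ = _ := by ring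
  calc ∫⁻ y in {y | s ≤ dist x y}, J x y ∂m ≤ ∫⁻ y in ⋃ n, E n, J x y ∂m :=
        lintegral_mono_set hE
    _ ≤ ∑' n, ∫⁻ y in E n, J x y ∂m := lintegral_iUnion_le _ _
    _ ≤ ∑' n, ENNReal.ofReal k.J₂ * k.V * (ENNReal.ofReal k.c₁)⁻¹ * (scaleE φ s)⁻¹ * k.q ^ n :=
        ENNReal.tsum_le_tsum hterm
    _ = k.tail * (scaleE φ s)⁻¹ := by
        rw [ENNReal.tsum_mul_left, ENNReal.tsum_geometric, Constants.tail]; ring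

end IsJumpSpace

/-! ### Disjoint balls and Whitney covers -/

lemma exists_maximal_disjoint_balls (U : Set X) (ρ : X → ℝ) (hρ : ∀ x ∈ U, 0 < ρ x) :
    ∃ s ⊆ U, s.PairwiseDisjoint (fun x => ball x (ρ x)) ∧
      ∀ x ∈ U, ∃ y ∈ s, dist x y < ρ x + ρ y := by
  obtain ⟨s, hs⟩ := zorn_subset {s : Set X | s ⊆ U ∧ s.PairwiseDisjoint (fun x => ball x (ρ x))}
    (fun c hc hchain => ⟨⋃₀ c, ⟨sUnion_subset fun t ht => (hc ht).1,
      (pairwiseDisjoint_sUnion hchain.directedOn).2 fun t ht => (hc ht).2⟩,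
      fun t ht => subset_sUnion_of_mem ht⟩)
  refine ⟨s, hs.prop.1, hs.prop.2, fun x hx => ?_⟩
  by_contra! hcon
  have hins : insert x s ∈ {s : Set X | s ⊆ U ∧ s.PairwiseDisjoint (fun x => ball x (ρ x))} := by
    refine ⟨insert_subset hx hs.prop.1, hs.prop.2.insert fun y hy _ => ?_⟩
    exact ball_disjoint_ball (hcon y hy)
  have hxs : x ∈ s := hs.le_of_ge hins (subset_insert x s) (mem_insert x s)
  have := hcon x hxs
  rw [dist_self] at this
  linarith [hρ x hx]

namespace IsJumpSpace

lemma card_le_of_disjoint_balls (h : IsJumpSpace k m J φ) {ι : Type*} (s : Finset ι) (c : ι → X)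
    (ρ : ι → ℝ) {x : X} {R : ℝ} (n : ℕ) (hR : 0 < R) (hρ : ∀ j ∈ s, 0 < ρ j)
    (hdisj : (s : Set ι).PairwiseDisjoint fun j => ball (c j) (ρ j))
    (hsub : ∀ j ∈ s, ball (c j) (ρ j) ⊆ ball x R)
    (hle : ∀ j ∈ s, dist (c j) x + R ≤ 2 ^ n * ρ j) : (s.card : ℝ≥0∞) ≤ k.V ^ n := by
  have h0 := (measure_ball_pos m x hR).ne'
  have h1 := h.measure_ball_ne_top x R
  refine (ENNReal.mul_le_mul_iff_left h0 h1).1 ?_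
  calc (s.card : ℝ≥0∞) * m (ball x R) = ∑ j ∈ s, m (ball x R) := by simp
    _ ≤ ∑ j ∈ s, k.V ^ n * m (ball (c j) (ρ j)) :=
        Finset.sum_le_sum fun j hj => h.measure_ball_le n (hρ j hj) (hle j hj)
    _ = k.V ^ n * m (⋃ j ∈ s, ball (c j) (ρ j)) := by
        rw [← Finset.mul_sum, measure_biUnion_finset hdisj fun _ _ => measurableSet_ball]
    _ ≤ k.V ^ n * m (ball x R) := by
        gcongr; exact iUnion₂_subset hsub

lemma exists_finset_of_disjoint_balls (h : IsJumpSpace k m J φ) {ι : Type*} (T : Set ι) (c : ι → X)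
    (ρ : ι → ℝ) {x : X} {R : ℝ} (n : ℕ) (hR : 0 < R) (hρ : ∀ j ∈ T, 0 < ρ j)
    (hdisj : T.PairwiseDisjoint fun j => ball (c j) (ρ j))
    (hsub : ∀ j ∈ T, ball (c j) (ρ j) ⊆ ball x R)
    (hle : ∀ j ∈ T, dist (c j) x + R ≤ 2 ^ n * ρ j) :
    ∃ s : Finset ι, (∀ j, j ∈ s ↔ j ∈ T) ∧ (s.card : ℝ≥0∞) ≤ k.V ^ n := by
  have key : ∀ s : Finset ι, (s : Set ι) ⊆ T → (s.card : ℝ≥0∞) ≤ k.V ^ n := fun s hs =>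
    h.card_le_of_disjoint_balls s c ρ n hR (fun j hj => hρ j (hs hj)) (hdisj.subset hs)
      (fun j hj => hsub j (hs hj)) (fun j hj => hle j (hs hj))
  have hfin : T.Finite := by
    by_contra hinf
    obtain ⟨N, hN⟩ := ENNReal.exists_nat_gt (ENNReal.pow_ne_top (n := n) k.V_ne_top)
    obtain ⟨s, hs, hcard⟩ := Set.Infinite.exists_subset_card_eq hinf N
    have := key s hs
    rw [hcard] at this
    exact absurd hN this.not_gt
  exact ⟨hfin.toFinset, fun j => hfin.mem_toFinset, key _ (by simp)⟩

end IsJumpSpace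

/-- The radii are proportional to the distance `δ` to `closure D`. A maximal disjoint family of balls
is a cover after enlarging: if `dist x y < (δ x + δ y) / 5`, then `dist x y < δ y / 2`, since `δ` is
Lipschitz with constant `1`. -/
theorem exists_whitneyCover {D : Set X} (hD : D.Nonempty) :
    ∃ ι : Type u, Nonempty (WhitneyCover (1 / 4) (closure D)ᶜ ι) := by
  set δ : X → ℝ := fun x => infDist x (closure D) with hδ
  have hδpos : ∀ x ∈ (closure D)ᶜ, 0 < 1 / 5 * δ x := fun x hx => by
    have := (isClosed_closure.notMem_iff_infDist_pos hD.closure).1 hx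
    positivity
  obtain ⟨s, hsU, hdisj, hmax⟩ := exists_maximal_disjoint_balls (closure D)ᶜ
    (fun x => 1 / 5 * δ x) hδpos
  have hsub : ∀ x, ∀ t ≤ 1, ball x (t * δ x) ⊆ (closure D)ᶜ := fun x t ht y hy hyD => by
    have h1 : δ x ≤ dist x y := infDist_le_dist_of_mem hyD
    have h2 : dist x y < t * δ x := by rwa [dist_comm]
    have h3 : 0 ≤ δ x := infDist_nonneg
    nlinarith
  refine ⟨s, ⟨⟨fun i => i, fun i => 1 / 5 * δ i, fun i => hsU i.2, fun i => hδpos i (hsU i.2),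
    fun i => hsub _ _ (by norm_num),
    fun i j hij => hdisj i.2 j.2 (by simpa [Subtype.ext_iff] using hij),
    fun i => ?_, ?_⟩⟩⟩
  · rw [compl_compl]; norm_num [hδ]
  · refine Subset.antisymm (iUnion_subset fun i => ?_) fun x hx => ?_
    · refine (ball_subset_ball (le_of_eq ?_)).trans (hsub (i : X) (1 / 2) (by norm_num))
      ring
    · obtain ⟨y, hy, hxy⟩ := hmax x hx
      refine mem_iUnion.2 ⟨⟨y, hy⟩, ?_⟩
      have h1 : δ x ≤ δ y + dist x y := infDist_le_infDist_add_dist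
      simp only [mem_ball]
      linarith

namespace WhitneyCover

variable {D : Set X} {ι : Type u} (W : WhitneyCover (1 / 4) (closure D)ᶜ ι)

lemma infDist_center (i : ι) : infDist (W.center i) D = 5 * W.radius i := by
  have := W.radius_eq i
  rw [compl_compl, infDist_closure] at this
  rw [this]; ring

lemma le_dist_center (i : ι) {z : X} (hz : z ∈ closure D) :
    5 * W.radius i ≤ dist (W.center i) z := by
  rw [← W.infDist_center, ← infDist_closure]; exact infDist_le_dist_of_mem hz

lemma exists_mem_dist_lt (hD : D.Nonempty) (i : ι) :
    ∃ z ∈ D, dist (W.center i) z < 6 * W.radius i := by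
  refine (infDist_lt_iff hD).1 ?_
  rw [W.infDist_center]
  linarith [W.radius_pos i]

lemma countable (W : WhitneyCover (1 / 4) (closure D)ᶜ ι) : Countable ι := by
  have : (univ : Set ι).Countable :=
    Set.PairwiseDisjoint.countable_of_isOpen (s := fun i => ball (W.center i) (W.radius i))
      (fun i _ j _ hij => W.disjoint i j hij) (fun i _ => isOpen_ball)
      (fun i _ => nonempty_ball.2 (W.radius_pos i))
  exact countable_univ_iff.1 this

/-- The ball `3 B_i`, which carries the cut-off function `η_i`. -/
def triple (i : ι) : Set X := ball (W.center i) (3 * W.radius i)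

lemma measurableSet_triple (i : ι) : MeasurableSet (W.triple i) := measurableSet_ball

/-- Two indices are near if the balls `3 B_i` and `3 B_j` meet. -/
def Near (i j : ι) : Prop := (W.triple i ∩ W.triple j).Nonempty

variable {W}

lemma Near.symm {i j : ι} (h : W.Near i j) : W.Near j i := by
  rwa [Near, inter_comm]

lemma Near.dist_lt {i j : ι} (h : W.Near i j) :
    dist (W.center i) (W.center j) < 3 * W.radius i + 3 * W.radius j := by
  obtain ⟨z, hz₁, hz₂⟩ := h
  have := dist_triangle_right (W.center i) (W.center j) z
  rw [triple, mem_ball'] at hz₁ hz₂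
  linarith

lemma Near.radius_lt {i j : ι} (h : W.Near i j) : W.radius i < 4 * W.radius j := by
  have h1 : infDist (W.center i) D ≤ infDist (W.center j) D + dist (W.center i) (W.center j) :=
    infDist_le_infDist_add_dist
  rw [W.infDist_center, W.infDist_center] at h1
  linarith [h.dist_lt]

lemma near_of_mem {i j : ι} {x : X} (hi : x ∈ W.triple i) (hj : x ∈ W.triple j) : W.Near i j :=
  ⟨x, hi, hj⟩

variable (W)

lemma exists_mem_ball {x : X} (hx : x ∉ closure D) :
    ∃ i, x ∈ ball (W.center i) (5 / 2 * W.radius i) := by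
  have : x ∈ ⋃ i, ball (W.center i) (2 * (1 + 1 / 4) * W.radius i) := by rw [W.cover]; exact hx
  obtain ⟨i, hi⟩ := mem_iUnion.1 this
  exact ⟨i, by convert hi using 2; ring⟩

lemma ball_subset_triple (i : ι) : ball (W.center i) (5 / 2 * W.radius i) ⊆ W.triple i :=
  ball_subset_ball (by linarith [W.radius_pos i])

lemma lt_dist_of_mem_triple {i : ι} {x z : X} (hx : x ∈ W.triple i) (hz : z ∈ closure D) :
    2 * W.radius i < dist x z := by
  have h1 := W.le_dist_center i hz
  have h2 := dist_triangle_left (W.center i) z x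
  rw [triple, mem_ball] at hx
  linarith

lemma notMem_closure_of_mem_triple {i : ι} {x : X} (hx : x ∈ W.triple i) : x ∉ closure D :=
  fun h => by
    have := W.lt_dist_of_mem_triple hx h
    rw [dist_self] at this
    linarith [W.radius_pos i]

/-- Every Whitney ball has a bounded number of neighbours. -/
lemma exists_finset_near (h : IsJumpSpace k m J φ) (i : ι) :
    ∃ N : Finset ι, (∀ j, j ∈ N ↔ W.Near i j) ∧ (N.card : ℝ≥0∞) ≤ k.V ^ 8 := by
  have hi := W.radius_pos i
  refine h.exists_finset_of_disjoint_balls {j | W.Near i j} W.center W.radius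
    (x := W.center i) (R := 19 * W.radius i) 8 (by positivity) (fun j _ => W.radius_pos j)
    (fun j _ l _ hjl => W.disjoint j l hjl) (fun j hj => ball_subset_ball' ?_) (fun j hj => ?_)
  · have h1 := Near.radius_lt (Near.symm hj)
    have h2 := Near.dist_lt (Near.symm hj)
    linarith
  · have h1 := Near.radius_lt hj
    have h2 := Near.dist_lt (Near.symm hj)
    linarith

lemma measure_ball_le_of_near (h : IsJumpSpace k m J φ) {i j : ι} (hij : W.Near i j) :
    m (ball (W.center i) (W.radius i)) ≤ k.V ^ 5 * m (ball (W.center j) (W.radius j)) := by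
  refine h.measure_ball_le 5 (W.radius_pos j) ?_
  have h1 := hij.radius_lt
  have h2 := hij.symm.dist_lt
  linarith [W.radius_pos j]

lemma measure_triple_le (h : IsJumpSpace k m J φ) (i : ι) :
    m (W.triple i) ≤ k.V ^ 2 * m (ball (W.center i) (W.radius i)) := by
  refine h.measure_ball_le 2 (W.radius_pos i) ?_
  rw [dist_self]
  linarith [W.radius_pos i]

end WhitneyCover

/-! ### Existence of the averaging weights -/

lemma ae_eq_zero_of_notMem_essSupp (g : X → ℝ) : ∀ᵐ x ∂m, x ∉ essSupp m g → g x = 0 := by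
  obtain ⟨T, hTc, hTS, hT⟩ := TopologicalSpace.isOpen_sUnion_countable
    {O : Set X | IsOpen O ∧ ∀ᵐ x ∂m, x ∈ O → g x = 0} fun s hs => hs.1
  have h1 : ∀ᵐ x ∂m, ∀ O ∈ T, x ∈ O → g x = 0 :=
    (ae_ball_iff hTc).2 fun O hO => (hTS hO).2
  filter_upwards [h1] with x hx hxS
  have : x ∈ ⋃₀ T := by
    rw [hT]
    simp only [essSupp, mem_sInter, not_forall] at hxS
    obtain ⟨K, hK, hxK⟩ := hxS
    exact ⟨Kᶜ, ⟨hK.1.isOpen_compl, hK.2⟩, hxK⟩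
  obtain ⟨O, hO, hxO⟩ := this
  exact hx O hO hxO

/-- The constant with which averaging weights exist. -/
def Constants.weight (k : Constants) (cD : ℝ) : ℝ := 4 * k.Cv ^ 10 / cD ^ 2

/-- A countable family of sets with a Carleson packing property for the size function `ρ` has
large subsets with bounded overlap: from each set keep the points that lie in few sets of at most
the same size. -/
lemma exists_subsets_of_bounded_overlap {Y ι : Type*} [MeasurableSpace Y] [Countable ι]
    (μ : Measure Y) (s : ι → Set Y) (hs : ∀ i, MeasurableSet (s i)) (ρ : ι → ℝ) (T : Set ι)
    (K : ℝ≥0∞) (hK₀ : K ≠ 0) (hK : K ≠ ∞) (hfin : ∀ i ∈ T, μ (s i) ≠ ∞)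
    (hpack : ∀ i ∈ T, ∑' j, {j | ρ j ≤ ρ i}.indicator (fun j => μ (s j ∩ s i)) j ≤ K * μ (s i)) :
    ∃ E : ι → Set Y, (∀ i, MeasurableSet (E i)) ∧ (∀ i, E i ⊆ s i) ∧
      (∀ i ∈ T, μ (s i) ≤ 2 * μ (E i)) ∧
      ∀ x, ∑' i, (E i).indicator (fun _ => (1 : ℝ≥0∞)) x ≤ 2 * K := by
  classical
  let N : ι → Y → ℝ≥0∞ := fun i x =>
    ∑' j, {j | ρ j ≤ ρ i}.indicator (fun j => (s j).indicator (fun _ => (1 : ℝ≥0∞)) x) j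
  have hterm : ∀ i j, Measurable fun x =>
      {j | ρ j ≤ ρ i}.indicator (fun j => (s j).indicator (fun _ => (1 : ℝ≥0∞)) x) j := by
    intro i j
    by_cases hj : ρ j ≤ ρ i
    · simp only [indicator_of_mem (show j ∈ {j | ρ j ≤ ρ i} from hj)]
      exact measurable_const.indicator (hs j)
    · simp [indicator_of_notMem (show j ∉ {j | ρ j ≤ ρ i} from hj)]
  have hN : ∀ i, Measurable (N i) := fun i => Measurable.tsum (hterm i)
  refine ⟨fun i => s i ∩ {x | N i x ≤ 2 * K},
    fun i => (hs i).inter (measurableSet_le (hN i) measurable_const),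
    fun i => inter_subset_left, fun i hi => ?_, fun x => ?_⟩
  · have hint : ∫⁻ x in s i, N i x ∂μ ≤ K * μ (s i) := by
      rw [lintegral_tsum fun j => (hterm i j).aemeasurable]
      refine le_trans (le_of_eq (tsum_congr fun j => ?_)) (hpack i hi)
      by_cases hj : ρ j ≤ ρ i
      · simp [indicator_of_mem (show j ∈ {j | ρ j ≤ ρ i} from hj), lintegral_indicator (hs j),
          Measure.restrict_apply (hs j)]
      · simp [indicator_of_notMem (show j ∉ {j | ρ j ≤ ρ i} from hj)]
    have hmarkov : 2 * K * μ (s i ∩ {x | 2 * K ≤ N i x}) ≤ K * μ (s i) := by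
      refine le_trans ?_ hint
      have := mul_meas_ge_le_lintegral₀ (μ := μ.restrict (s i)) (hN i).aemeasurable (2 * K)
      rwa [Measure.restrict_apply (measurableSet_le measurable_const (hN i)), inter_comm] at this
    have h2 : 2 * μ (s i ∩ {x | 2 * K ≤ N i x}) ≤ μ (s i) := by
      refine (ENNReal.mul_le_mul_iff_right hK₀ hK).1 ?_
      calc K * (2 * μ (s i ∩ {x | 2 * K ≤ N i x})) = 2 * K * μ (s i ∩ {x | 2 * K ≤ N i x}) := by
            ring
        _ ≤ _ := hmarkov
    have hcov : μ (s i) ≤ μ (s i ∩ {x | N i x ≤ 2 * K}) + μ (s i ∩ {x | 2 * K ≤ N i x}) := by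
      refine (measure_mono fun x hx => ?_).trans (measure_union_le _ _)
      rcases le_total (N i x) (2 * K) with h | h
      · exact Or.inl ⟨hx, h⟩
      · exact Or.inr ⟨hx, h⟩
    have h3 : μ (s i) + μ (s i) ≤ 2 * μ (s i ∩ {x | N i x ≤ 2 * K}) + μ (s i) := by
      calc μ (s i) + μ (s i) = 2 * μ (s i) := (two_mul _).symm
        _ ≤ 2 * (μ (s i ∩ {x | N i x ≤ 2 * K}) + μ (s i ∩ {x | 2 * K ≤ N i x})) := by gcongr
        _ ≤ _ := by rw [mul_add]; gcongr
    exact (ENNReal.add_le_add_iff_right (hfin i hi)).1 h3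
  · rw [ENNReal.tsum_eq_iSup_sum]
    refine iSup_le fun t => ?_
    set t' := t.filter fun i => x ∈ s i ∩ {x | N i x ≤ 2 * K} with ht'
    have hsum : ∑ i ∈ t, (s i ∩ {x | N i x ≤ 2 * K}).indicator (fun _ => (1 : ℝ≥0∞)) x
        = t'.card := by
      simp [ht', indicator_apply]
    rw [hsum]
    rcases t'.eq_empty_or_nonempty with h0 | hne
    · simp [h0]
    · -- Every set of `t'` counts in `N i` when `i` has the largest size in `t'`.
      obtain ⟨i, hi, hmax⟩ := t'.exists_max_image ρ hne
      have hmem : ∀ j ∈ t', x ∈ s j ∩ {x | N j x ≤ 2 * K} := fun j hj => (Finset.mem_filter.1 hj).2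
      refine le_trans ?_ (hmem i hi).2
      calc (t'.card : ℝ≥0∞) = ∑ j ∈ t', 1 := by simp
        _ = ∑ j ∈ t', {j | ρ j ≤ ρ i}.indicator
              (fun j => (s j).indicator (fun _ => (1 : ℝ≥0∞)) x) j := by
            refine Finset.sum_congr rfl fun j hj => ?_
            rw [indicator_of_mem (show j ∈ {j | ρ j ≤ ρ i} from hmax j hj),
              indicator_of_mem (hmem j hj).1]
        _ ≤ N i x := ENNReal.sum_le_tsum t'

theorem exists_isWeightFamily (h : IsJumpSpace k m J φ) {D : Set X} {cD : ℝ} (hDo : IsOpen D)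
    (hD : D.Nonempty) (hcD : 0 < cD) (hcD' : cD ≤ 1) (hreg : AhlforsRegular m D cD) {ι : Type u}
    (W : WhitneyCover (1 / 4) (closure D)ᶜ ι) {A : ℝ} (hA : k.weight cD ≤ A) :
    ∃ f : ι → X → ℝ, IsWeightFamily m D W A f := by
  classical
  have := W.countable
  choose ξ hξD hξ using W.exists_mem_dist_lt hD
  have hr := W.radius_pos
  have hCv := k.one_lt_Cv
  -- The packing constant: `Cv ^ 3` compares a piece with its Whitney ball, `Cv ^ 4` the ball of radius
  -- `16 r_i` that contains the Whitney balls in question with the one of radius `r_i`, and `cD` is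
  -- the part of the volume that lies in `D`.
  set K : ℝ := k.Cv ^ 7 / cD with hKdef
  have hK1 : 1 ≤ K := by
    rw [hKdef, one_le_div hcD]
    exact hcD'.trans (one_le_pow₀ hCv.le)
  let Q : ι → Set X := fun i => D ∩ ball (ξ i) (W.radius i)
  have hQm : ∀ i, MeasurableSet (Q i) := fun i => hDo.measurableSet.inter measurableSet_ball
  have hQfin : ∀ i, m (Q i) ≠ ∞ := fun i =>
    ne_top_of_le_ne_top (h.measure_ball_ne_top _ _) (measure_mono inter_subset_right)
  have hQup : ∀ i, m (Q i) ≤ k.V ^ 3 * m (ball (W.center i) (W.radius i)) := fun i =>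
    (measure_mono inter_subset_right).trans
      (h.measure_ball_le 3 (hr i) (by linarith [hξ i, hr i]))
  have hQlow : ∀ i ∈ W.small D,
      ENNReal.ofReal cD * m (ball (ξ i) (W.radius i)) ≤ m (Q i) := fun i hi => by
    have := hreg (ξ i) (hξD i) (W.radius i) (hr i) hi
    rwa [inter_comm] at this
  have hcD0 : ENNReal.ofReal cD ≠ 0 := (ENNReal.ofReal_pos.2 hcD).ne'
  have hKV : ENNReal.ofReal K * ENNReal.ofReal cD = k.V ^ 7 := by
    rw [← ENNReal.ofReal_mul (by positivity), hKdef, div_mul_cancel₀ _ hcD.ne',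
      ENNReal.ofReal_pow (by linarith), Constants.V]
  have hpack : ∀ i ∈ W.small D,
      ∑' j, {j | W.radius j ≤ W.radius i}.indicator (fun j => m (Q j ∩ Q i)) j
        ≤ ENNReal.ofReal K * m (Q i) := by
    intro i hi
    let P : ι → Set X := fun j =>
      if W.radius j ≤ W.radius i ∧ (Q j ∩ Q i).Nonempty then ball (W.center j) (W.radius j) else ∅
    have hP : ∀ j, P j ⊆ ball (W.center j) (W.radius j) := fun j => by
      by_cases hj : W.radius j ≤ W.radius i ∧ (Q j ∩ Q i).Nonempty <;> simp [P, hj]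
    have hPm : ∀ j, MeasurableSet (P j) := fun j => by
      by_cases hj : W.radius j ≤ W.radius i ∧ (Q j ∩ Q i).Nonempty
      · simp [P, hj, measurableSet_ball]
      · simp [P, hj]
    have hPsub : ⋃ j, P j ⊆ ball (ξ i) (16 * W.radius i) := by
      refine iUnion_subset fun j => ?_
      by_cases hj : W.radius j ≤ W.radius i ∧ (Q j ∩ Q i).Nonempty
      · simp only [P, hj, and_self, if_true]
        obtain ⟨hj1, z, ⟨-, hz1⟩, -, hz2⟩ := hj
        refine ball_subset_ball' ?_
        rw [mem_ball'] at hz1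
        rw [mem_ball] at hz2
        have h1 := dist_triangle4 (W.center j) (ξ j) z (ξ i)
        linarith [hξ j, hr i]
      · simp [P, hj]
    calc ∑' j, {j | W.radius j ≤ W.radius i}.indicator (fun j => m (Q j ∩ Q i)) j
        ≤ ∑' j, k.V ^ 3 * m (P j) := by
          refine ENNReal.tsum_le_tsum fun j => ?_
          by_cases hj : W.radius j ≤ W.radius i
          · rw [indicator_of_mem (show j ∈ {j | W.radius j ≤ W.radius i} from hj)]
            rcases (Q j ∩ Q i).eq_empty_or_nonempty with h0 | hne
            · simp [h0]
            · have : P j = ball (W.center j) (W.radius j) := if_pos ⟨hj, hne⟩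
              rw [this]
              exact (measure_mono inter_subset_left).trans (hQup j)
          · rw [indicator_of_notMem (show j ∉ {j | W.radius j ≤ W.radius i} from hj)]
            exact zero_le
      _ = k.V ^ 3 * m (⋃ j, P j) := by
          rw [ENNReal.tsum_mul_left, measure_iUnion (fun j l hjl =>
            (W.disjoint j l hjl).mono (hP j) (hP l)) hPm]
      _ ≤ k.V ^ 3 * (k.V ^ 4 * m (ball (ξ i) (W.radius i))) := by
          gcongr
          refine (measure_mono hPsub).trans (h.measure_ball_le 4 (hr i) ?_)
          rw [dist_self]; norm_num
      _ = ENNReal.ofReal K * (ENNReal.ofReal cD * m (ball (ξ i) (W.radius i))) := by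
          rw [← mul_assoc, ← mul_assoc, hKV]; ring
      _ ≤ _ := by gcongr; exact hQlow i hi
  obtain ⟨E, hEm, hEQ, hEmass, hEover⟩ := exists_subsets_of_bounded_overlap m Q hQm W.radius
    (W.small D) (ENNReal.ofReal K) (ENNReal.ofReal_pos.2 (by positivity)).ne' ENNReal.ofReal_ne_top
    (fun i _ => hQfin i) hpack
  -- At most `2 * K` of the sets `E i` share a point.
  set c : ℝ := (2 * K)⁻¹ with hc
  have hc0 : 0 < c := by positivity
  have hc1 : c ≤ 1 := inv_le_one_of_one_le₀ (by linarith)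
  have hEfin : ∀ i, m (E i) ≠ ∞ := fun i => ne_top_of_le_ne_top (hQfin i) (measure_mono (hEQ i))
  have hof : ∀ i x, ENNReal.ofReal ((E i).indicator (fun _ => c) x)
      = ENNReal.ofReal c * (E i).indicator (fun _ => (1 : ℝ≥0∞)) x := fun i x => by
    by_cases hx : x ∈ E i <;> simp [hx]
  have hmass : ∀ i, ∫⁻ x in D, ENNReal.ofReal ((E i).indicator (fun _ => c) x) ∂m
      = ENNReal.ofReal c * m (E i) := fun i => by
    simp_rw [hof]
    rw [lintegral_const_mul _ (measurable_const.indicator (hEm i)), lintegral_indicator (hEm i),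
      Measure.restrict_restrict (hEm i),
      inter_eq_left.2 ((hEQ i).trans inter_subset_left)]
    simp
  have hsupp : ∀ i, essSupp m ((E i).indicator fun _ => c) ⊆ closedBall (ξ i) (W.radius i) :=
    fun i => sInter_subset_of_mem ⟨isClosed_closedBall, Eventually.of_forall fun x hx =>
      indicator_of_notMem (fun hxE => hx (ball_subset_closedBall (hEQ i hxE).2)) _⟩
  have hw0 : 0 < k.weight cD := by
    have : 0 < k.Cv := by linarith
    unfold Constants.weight; positivity
  have hA0 : 0 < A := hw0.trans_le hA
  refine ⟨fun i => (E i).indicator fun _ => c, ⟨fun i _ => ?_, fun i _ => ?_, ?_, fun i _ => ?_,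
    fun i hi => ?_, fun i hi => ?_, fun i _ => ?_⟩⟩
  · exact memLp_indicator_const 2 (hEm i) c (Or.inr (hEfin i))
  · refine Eventually.of_forall fun x => ?_
    by_cases hx : x ∈ E i <;> simp [hx, hc0.le, hc1]
  · refine Eventually.of_forall fun x => ?_
    by_cases hx : x ∈ D
    · rw [indicator_of_mem hx]
      calc ∑' i : W.small D, ENNReal.ofReal ((E i).indicator (fun _ => c) x)
          ≤ ∑' i, ENNReal.ofReal ((E i).indicator (fun _ => c) x) :=
            ENNReal.tsum_comp_le_tsum_of_injective Subtype.val_injective _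
        _ = ENNReal.ofReal c * ∑' i, (E i).indicator (fun _ => (1 : ℝ≥0∞)) x := by
            simp_rw [hof, ENNReal.tsum_mul_left]
        _ ≤ ENNReal.ofReal c * (2 * ENNReal.ofReal K) := by gcongr; exact hEover x
        _ = 1 := by
            rw [← ENNReal.ofReal_ofNat 2, ← ENNReal.ofReal_mul (by norm_num),
              ← ENNReal.ofReal_mul hc0.le, hc, inv_mul_cancel₀ (by positivity), ENNReal.ofReal_one]
    · have : ∀ i, x ∉ E i := fun i hi => hx (hEQ i hi).1
      simp [this]
  · refine ediam_le fun x hx y hy => ?_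
    rw [edist_dist]
    refine ENNReal.ofReal_le_ofReal ?_
    have h1 := mem_closedBall.1 (hsupp i hx)
    have h2 := mem_closedBall'.1 (hsupp i hy)
    linarith [dist_triangle x (ξ i) y]
  · have hEpos : m (E i) ≠ 0 := fun h0 => by
      have h1 := hEmass i hi
      have h2 := hQlow i hi
      rw [h0, mul_zero, nonpos_iff_eq_zero] at h1
      rw [h1, nonpos_iff_eq_zero, mul_eq_zero] at h2
      exact h2.elim hcD0 (measure_ball_pos m _ (hr i)).ne'
    have hne : (essSupp m ((E i).indicator fun _ => c)).Nonempty := by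
      by_contra hemp
      rw [not_nonempty_iff_eq_empty] at hemp
      have h1 := ae_eq_zero_of_notMem_essSupp (m := m) ((E i).indicator fun _ => c)
      rw [hemp] at h1
      refine hEpos (measure_mono_null (fun x hx => ?_) h1)
      simp [hx, hc0.ne']
    obtain ⟨z, hz⟩ := hne
    refine (infEDist_le_edist_of_mem hz).trans ?_
    rw [edist_dist]
    refine ENNReal.ofReal_le_ofReal ?_
    have h1 := mem_closedBall'.1 (hsupp i hz)
    linarith [dist_triangle (W.center i) (ξ i) z, hξ i]
  · rw [hmass]
    have h1 : m (ball (W.center i) (W.radius i)) ≤ k.V ^ 3 * m (ball (ξ i) (W.radius i)) := by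
      refine h.measure_ball_le 3 (hr i) ?_
      rw [dist_comm]; linarith [hξ i, hr i]
    have h2 : ENNReal.ofReal (cD / 2) * m (ball (ξ i) (W.radius i)) ≤ m (E i) := by
      have h3 := (hQlow i hi).trans (hEmass i hi)
      rw [div_eq_mul_inv, ENNReal.ofReal_mul hcD.le, ENNReal.ofReal_inv_of_pos two_pos,
        ENNReal.ofReal_ofNat, mul_comm (ENNReal.ofReal cD), mul_assoc, mul_comm,
        ← div_eq_mul_inv]
      exact ENNReal.div_le_of_le_mul (by rwa [mul_comm (m (E i))])
    calc ENNReal.ofReal A⁻¹ * m (ball (W.center i) (W.radius i))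
        ≤ ENNReal.ofReal A⁻¹ * (k.V ^ 3 * m (ball (ξ i) (W.radius i))) := by gcongr
      _ = ENNReal.ofReal (A⁻¹ * k.Cv ^ 3) * m (ball (ξ i) (W.radius i)) := by
          rw [ENNReal.ofReal_mul (by positivity), ENNReal.ofReal_pow (by linarith), Constants.V,
            mul_assoc]
      _ ≤ ENNReal.ofReal (c * (cD / 2)) * m (ball (ξ i) (W.radius i)) := by
          gcongr ENNReal.ofReal ?_ * _
          have h4 : 0 < k.Cv := by linarith
          rw [inv_mul_le_iff₀ hA0, hc, hKdef]
          calc k.Cv ^ 3 = k.weight cD * ((2 * (k.Cv ^ 7 / cD))⁻¹ * (cD / 2)) := by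
                unfold Constants.weight; field_simp; ring
            _ ≤ _ := by gcongr
      _ = ENNReal.ofReal c * (ENNReal.ofReal (cD / 2) * m (ball (ξ i) (W.radius i))) := by
          rw [ENNReal.ofReal_mul hc0.le, mul_assoc]
      _ ≤ _ := by gcongr
  · rw [hmass]
    calc ENNReal.ofReal c * m (E i) ≤ 1 * (k.V ^ 3 * m (ball (W.center i) (W.radius i))) := by
          gcongr
          · exact ENNReal.ofReal_le_one.2 hc1
          · exact (measure_mono (hEQ i)).trans (hQup i)
      _ = ENNReal.ofReal (k.Cv ^ 3) * m (ball (W.center i) (W.radius i)) := by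
          rw [one_mul, ENNReal.ofReal_pow (by linarith), Constants.V]
      _ ≤ _ := by
          gcongr
          refine le_trans ?_ hA
          unfold Constants.weight
          rw [le_div_iff₀ (by positivity)]
          have h5 : k.Cv ^ 3 ≤ k.Cv ^ 10 := pow_le_pow_right₀ hCv.le (by norm_num)
          have h6 : cD ^ 2 ≤ 1 := pow_le_one₀ hcD.le hcD'
          have h7 : 0 < k.Cv ^ 3 := by positivity
          nlinarith

/-! ### Existence of the cut-off functions -/

lemma aemeasurable_energy {μ : Measure X} [SFinite μ]
    (hJ : Measurable (fun p : X × X => J p.1 p.2)) {v : X → ℝ} (hv : AEStronglyMeasurable v μ) :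
    AEMeasurable (fun p : X × X => ENNReal.ofReal ((v p.1 - v p.2) ^ 2) * J p.1 p.2)
      (μ.prod μ) := by
  have h1 : AEMeasurable (fun p : X × X => v p.1) (μ.prod μ) := hv.comp_fst.aemeasurable
  have h2 : AEMeasurable (fun p : X × X => v p.2) (μ.prod μ) := hv.comp_snd.aemeasurable
  exact (((h1.sub h2).pow_const 2).ennreal_ofReal).mul hJ.aemeasurable

lemma memF_sup (hJ : Measurable (fun p : X × X => J p.1 p.2)) {v w : X → ℝ} (hv : MemF m J v)
    (hw : MemF m J w) :
    MemF m J (v ⊔ w) ∧ form m J (v ⊔ w) ≤ form m J v + form m J w := by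
  have hle : energyOn m J univ (v ⊔ w) ≤ energyOn m J univ v + energyOn m J univ w := by
    simp only [energyOn, Measure.restrict_univ]
    rw [← lintegral_add_left' (aemeasurable_energy hJ hv.1.1)]
    refine lintegral_mono fun p => ?_
    rw [← add_mul, ← ENNReal.ofReal_add (by positivity) (by positivity)]
    gcongr
    have h1 : |max (v p.1) (w p.1) - max (v p.2) (w p.2)| ≤
        max |v p.1 - v p.2| |w p.1 - w p.2| := abs_max_sub_max_le_max _ _ _ _
    rcases le_max_iff.1 h1 with h2 | h2
    · exact (sq_le_sq.2 h2).trans (le_add_of_nonneg_right (sq_nonneg _))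
    · exact (sq_le_sq.2 h2).trans (le_add_of_nonneg_left (sq_nonneg _))
  refine ⟨⟨hv.1.sup hw.1, hle.trans_lt (ENNReal.add_lt_top.2 ⟨hv.2, hw.2⟩)⟩, ?_⟩
  rw [form, form, form, ← mul_add]
  gcongr

lemma memF_clamp {v : X → ℝ} (hv : MemF m J v) :
    MemF m J (fun x => min (max (v x) 0) 1) ∧
      form m J (fun x => min (max (v x) 0) 1) ≤ form m J v := by
  have hle : energyOn m J univ (fun x => min (max (v x) 0) 1) ≤ energyOn m J univ v := by
    refine lintegral_mono fun p => ?_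
    dsimp only
    gcongr ENNReal.ofReal ?_ * _
    refine sq_le_sq.2 ((abs_min_sub_min_le_max _ _ _ _).trans ?_)
    refine max_le ((abs_max_sub_max_le_max _ _ _ _).trans ?_) (by simp)
    simp
  refine ⟨⟨hv.1.mono ?_ (Eventually.of_forall fun x => ?_), hle.trans_lt hv.2⟩, by
    rw [form, form]; gcongr⟩
  · exact ((hv.1.1.aemeasurable.max aemeasurable_const).min aemeasurable_const).aestronglyMeasurable
  · simp only [Real.norm_eq_abs]
    rw [abs_of_nonneg (le_min (le_max_right _ _) zero_le_one)]
    exact (min_le_left _ _).trans (max_le (le_abs_self _) (abs_nonneg _))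

lemma exists_cutoff_of_relCap_lt {A B : Set X} {b : ℝ≥0∞} (hb : relCap m J A B < b) :
    ∃ v : X → ℝ, MemF m J v ∧ (∀ x, v x ∈ Icc (0 : ℝ) 1) ∧ (∀ᵐ x ∂m, x ∈ A → v x = 1) ∧
      (∀ᵐ x ∂m, x ∉ B → v x = 0) ∧ form m J v ≤ b := by
  simp only [relCap, iInf_lt_iff] at hb
  obtain ⟨v, ⟨hF, h1, h0⟩, hlt⟩ := hb
  refine ⟨fun x => min (max (v x) 0) 1, (memF_clamp hF).1,
    fun x => ⟨le_min (le_max_right _ _) zero_le_one, min_le_right _ _⟩, ?_, ?_,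
    (memF_clamp hF).2.trans hlt.le⟩
  · filter_upwards [h1] with x hx hxA
    simp [hx hxA]
  · filter_upwards [h0] with x hx hxB
    simp [hx hxB]

/-- Cut-off functions for finitely many pairs of sets combine to one for the unions. -/
lemma exists_cutoff_biUnion (hJ : Measurable (fun p : X × X => J p.1 p.2)) {ι : Type*}
    (s : Finset ι) (A B : ι → Set X) (b : ι → ℝ≥0∞) (hb : ∀ i ∈ s, relCap m J (A i) (B i) < b i) :
    ∃ v : X → ℝ, MemF m J v ∧ (∀ x, v x ∈ Icc (0 : ℝ) 1) ∧
      (∀ᵐ x ∂m, x ∈ ⋃ i ∈ s, A i → v x = 1) ∧ (∀ᵐ x ∂m, x ∉ ⋃ i ∈ s, B i → v x = 0) ∧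
      form m J v ≤ ∑ i ∈ s, b i := by
  classical
  induction s using Finset.induction_on with
  | empty =>
    refine ⟨0, ⟨MemLp.zero, ?_⟩, fun x => ⟨le_rfl, zero_le_one⟩, ?_, ?_, ?_⟩ <;>
      simp [energyOn, form]
  | insert i s his ih =>
    obtain ⟨v, hvF, hv01, hv1, hv0, hve⟩ := ih fun j hj => hb j (Finset.mem_insert_of_mem hj)
    obtain ⟨w, hwF, hw01, hw1, hw0, hwe⟩ :=
      exists_cutoff_of_relCap_lt (hb i (Finset.mem_insert_self i s))
    refine ⟨w ⊔ v, (memF_sup hJ hwF hvF).1,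
      fun x => ⟨le_max_of_le_left (hw01 x).1, max_le (hw01 x).2 (hv01 x).2⟩, ?_, ?_, ?_⟩
    · filter_upwards [hv1, hw1] with x hx1 hx2 hx
      rw [Finset.set_biUnion_insert] at hx
      rcases hx with hx | hx
      · simp [hx2 hx, (hv01 x).2]
      · simp [hx1 hx, (hw01 x).2]
    · filter_upwards [hv0, hw0] with x hx1 hx2 hx
      rw [Finset.set_biUnion_insert, mem_union, not_or] at hx
      simp [hx1 hx.2, hx2 hx.1]
    · rw [Finset.sum_insert his]
      exact (memF_sup hJ hwF hvF).2.trans (add_le_add hwe hve)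

/-- The capacity bound is for a ball and its double, and here the cut-off is for `(5/2) B_i` in
`3 B_i`: cover the first by boundedly many balls of radius `r_i / 4`, whose doubles lie in the
second, and take the maximum of their cut-offs. -/
theorem exists_isCutoffFamily (h : IsJumpSpace k m J φ) {Cc : ℝ} (hCc : 0 < Cc)
    (hcap : CapUpper m J φ Cc) {D : Set X} (hD : D.Nonempty) {ι : Type u}
    (W : WhitneyCover (1 / 4) (closure D)ᶜ ι) {A : ℝ}
    (hA : k.V ^ 6 * (2 * ENNReal.ofReal Cc * (k.V ^ 2 * k.Q 2)) ≤ ENNReal.ofReal A) :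
    ∃ η : ι → X → ℝ, IsCutoffFamily m J φ W A η := by
  have key : ∀ i, ∃ v : X → ℝ, MemF m J v ∧ (∀ x, v x ∈ Icc (0 : ℝ) 1) ∧
      (∀ᵐ x ∂m, x ∈ ball (W.center i) (5 / 2 * W.radius i) → v x = 1) ∧
      (∀ᵐ x ∂m, x ∉ ball (W.center i) (3 * W.radius i) → v x = 0) ∧
      form m J v ≤ ENNReal.ofReal A * m (ball (W.center i) (W.radius i)) /
        ENNReal.ofReal (φ (W.radius i)) := by
    intro i
    set r := W.radius i with hrdef
    set c := W.center i with hcdef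
    have hr : 0 < r := W.radius_pos i
    obtain ⟨T, hTsub, hTdisj, hTmax⟩ := exists_maximal_disjoint_balls (ball c (5 / 2 * r))
      (fun _ => r / 8) (fun _ _ => by positivity)
    obtain ⟨s, hs, hcard⟩ := h.exists_finset_of_disjoint_balls T id (fun _ => r / 8)
      (x := c) (R := 3 * r) 6 (by positivity) (fun _ _ => by positivity) hTdisj
      (fun y hy => ball_subset_ball' (by
        have := mem_ball.1 (hTsub hy); simp only [id]; linarith))
      (fun y hy => by have := mem_ball.1 (hTsub hy); simp only [id]; linarith)
    -- The diameter of the space is at least the distance `5 r` from `c` to `D`.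
    have hdiam : ENNReal.ofReal (r / 4) < ediam (univ : Set X) / 3 := by
      rw [ENNReal.lt_div_iff_mul_lt (by simp) (by simp), ← ENNReal.ofReal_ofNat 3,
        ← ENNReal.ofReal_mul (by positivity)]
      obtain ⟨z, hz⟩ := hD
      refine lt_of_lt_of_le ?_ (edist_le_ediam_of_mem (mem_univ c) (mem_univ z))
      rw [edist_dist, ENNReal.ofReal_lt_ofReal_iff_of_nonneg (by positivity)]
      have := W.le_dist_center i (subset_closure hz)
      linarith
    set b : ℝ≥0∞ := 2 * ENNReal.ofReal Cc * (k.V ^ 2 * k.Q 2) * (m (ball c r) / scaleE φ r)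
      with hbdef
    have hcapb : ∀ y ∈ s, relCap m J (ball y (r / 4)) (ball y (r / 2)) < b := by
      intro y hy
      have hyc : dist y c < 5 / 2 * r := mem_ball.1 (hTsub ((hs y).1 hy))
      set t : ℝ≥0∞ := ENNReal.ofReal Cc * m (ball y (r / 4)) / scaleE φ (r / 4) with ht
      have ht0 : t ≠ 0 := by
        refine ENNReal.div_ne_zero.2 ⟨mul_ne_zero (ENNReal.ofReal_pos.2 hCc).ne'
          (measure_ball_pos m y (by positivity)).ne', ENNReal.ofReal_ne_top⟩
      have httop : t ≠ ∞ := ENNReal.div_ne_top (ENNReal.mul_ne_top ENNReal.ofReal_ne_top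
        (h.measure_ball_ne_top _ _)) (h.scaleE_ne_zero (by positivity))
      have h1 : relCap m J (ball y (r / 4)) (ball y (r / 2)) ≤ t := by
        have := hcap y (r / 4) (by positivity) hdiam
        rwa [show 2 * (r / 4) = r / 2 by ring] at this
      -- The factor `2` leaves room for a competitor that does not attain the infimum.
      have h2 : t < 2 * t := by
        rw [two_mul]; exact ENNReal.lt_add_right httop ht0
      refine h1.trans_lt (h2.trans_le ?_)
      have h3 : m (ball y (r / 4)) ≤ k.V ^ 2 * m (ball c r) :=
        h.measure_ball_le 2 hr (by rw [dist_comm]; linarith)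
      have h4 : scaleE φ r ≤ k.Q 2 * scaleE φ (r / 4) :=
        h.scaleE_le 2 (by positivity) hr.le (by linarith)
      have h5 : (scaleE φ (r / 4))⁻¹ ≤ k.Q 2 * (scaleE φ r)⁻¹ := by
        rw [← div_eq_mul_inv, ENNReal.le_div_iff_mul_le (Or.inl (h.scaleE_ne_zero hr))
          (Or.inl IsJumpSpace.scaleE_ne_top), mul_comm, ← div_eq_mul_inv]
        exact ENNReal.div_le_of_le_mul h4
      calc 2 * t = 2 * (ENNReal.ofReal Cc * m (ball y (r / 4)) * (scaleE φ (r / 4))⁻¹) := by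
            rw [ht, div_eq_mul_inv]
        _ ≤ 2 * (ENNReal.ofReal Cc * (k.V ^ 2 * m (ball c r)) * (k.Q 2 * (scaleE φ r)⁻¹)) := by
            gcongr
        _ = b := by rw [hbdef, div_eq_mul_inv]; ring
    obtain ⟨v, hvF, hv01, hv1, hv0, hve⟩ := exists_cutoff_biUnion h.measurable s
      (fun y => ball y (r / 4)) (fun y => ball y (r / 2)) (fun _ => b) hcapb
    refine ⟨v, hvF, hv01, ?_, ?_, hve.trans ?_⟩
    · filter_upwards [hv1] with x hx hxb
      obtain ⟨y, hy, hxy⟩ := hTmax x hxb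
      refine hx (mem_iUnion₂.2 ⟨y, (hs y).2 hy, ?_⟩)
      rw [mem_ball]; linarith
    · filter_upwards [hv0] with x hx hxb
      refine hx fun hmem => hxb ?_
      obtain ⟨y, hy, hxy⟩ := mem_iUnion₂.1 hmem
      have hyc : dist y c < 5 / 2 * r := mem_ball.1 (hTsub ((hs y).1 hy))
      rw [mem_ball] at hxy ⊢
      linarith [dist_triangle x y c]
    · rw [Finset.sum_const, nsmul_eq_mul]
      calc (s.card : ℝ≥0∞) * b ≤ k.V ^ 6 * b := by gcongr
        _ = k.V ^ 6 * (2 * ENNReal.ofReal Cc * (k.V ^ 2 * k.Q 2)) *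
            (m (ball c r) / scaleE φ r) := by rw [hbdef]; ring
        _ ≤ ENNReal.ofReal A * (m (ball c r) / scaleE φ r) := by gcongr
        _ = _ := by rw [mul_div_assoc, scaleE]
  choose η h1 h2 h3 h4 h5 using key
  exact ⟨η, h1, fun i => Eventually.of_forall (h2 i), h3, h4, h5⟩

/-! ### The partition of unity -/

/-- Jensen's inequality for the square and finitely many weights. -/
lemma sq_sum_mul_sub_le {ι : Type*} (N : Finset ι) (p a : ι → ℝ) (c : ℝ) (hp : ∀ i ∈ N, 0 ≤ p i)
    (hp1 : ∑ i ∈ N, p i = 1) :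
    (∑ i ∈ N, a i * p i - c) ^ 2 ≤ ∑ i ∈ N, p i * (a i - c) ^ 2 := by
  have h1 : ∑ i ∈ N, a i * p i - c = ∑ i ∈ N, p i * (a i - c) := by
    simp only [mul_sub, Finset.sum_sub_distrib, ← Finset.sum_mul, hp1, one_mul]
    simp only [mul_comm]
  rw [h1]
  calc (∑ i ∈ N, p i * (a i - c)) ^ 2 ≤ (∑ i ∈ N, p i) * ∑ i ∈ N, p i * (a i - c) ^ 2 :=
        Finset.sum_sq_le_sum_mul_sum_of_sq_le_mul N hp
          (fun i hi => mul_nonneg (hp i hi) (sq_nonneg _)) fun i _ => le_of_eq (by ring)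
    _ = _ := by rw [hp1, one_mul]

/-- The normalisation of a family of cut-offs is Lipschitz in the square-sum sense. -/
lemma sum_sq_div_sub_div_le {ι : Type*} (N : Finset ι) (e e' : ι → ℝ) (he' : ∀ i ∈ N, 0 ≤ e' i)
    (hs : 1 ≤ ∑ i ∈ N, e i) (hs' : 1 ≤ ∑ i ∈ N, e' i) :
    ∑ j ∈ N, (e j / (∑ i ∈ N, e i) - e' j / ∑ i ∈ N, e' i) ^ 2 ≤
      2 * (1 + N.card) * ∑ j ∈ N, (e j - e' j) ^ 2 := by
  set s := ∑ i ∈ N, e i with hsdef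
  set s' := ∑ i ∈ N, e' i with hsdef'
  set Δ := ∑ j ∈ N, (e j - e' j) ^ 2 with hΔ
  have hs0 : 0 < s := by linarith
  have hs0' : 0 < s' := by linarith
  have hdiff : (s' - s) ^ 2 ≤ N.card * Δ := by
    have h1 : s' - s = ∑ j ∈ N, (e' j - e j) := by rw [Finset.sum_sub_distrib]
    rw [h1, hΔ]
    refine (sq_sum_le_card_mul_sum_sq).trans (le_of_eq ?_)
    congr 1
    exact Finset.sum_congr rfl fun j _ => by ring
  have hq : ∑ j ∈ N, (e' j / s') ^ 2 ≤ 1 := by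
    calc ∑ j ∈ N, (e' j / s') ^ 2 ≤ ∑ j ∈ N, e' j / s' := by
          refine Finset.sum_le_sum fun j hj => ?_
          have h0 : 0 ≤ e' j / s' := div_nonneg (he' j hj) hs0'.le
          have h1 : e' j / s' ≤ 1 := (div_le_one hs0').2 (Finset.single_le_sum he' hj)
          nlinarith
      _ = 1 := by rw [← Finset.sum_div, div_self hs0'.ne']
  have hterm : ∀ j ∈ N, (e j / s - e' j / s') ^ 2 ≤
      2 * (e j - e' j) ^ 2 + (e' j / s') ^ 2 * (2 * (s' - s) ^ 2) := by
    intro j _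
    have h1 : e j / s - e' j / s' = (e j - e' j) / s + e' j / s' * ((s' - s) / s) := by
      field_simp; ring
    have hinv : ∀ t : ℝ, (t / s) ^ 2 ≤ t ^ 2 := fun t => by
      rw [div_pow]
      exact div_le_self (sq_nonneg t) (one_le_pow₀ hs)
    calc (e j / s - e' j / s') ^ 2
        ≤ 2 * (((e j - e' j) / s) ^ 2 + (e' j / s' * ((s' - s) / s)) ^ 2) := by
          rw [h1]; exact add_sq_le
      _ = 2 * ((e j - e' j) / s) ^ 2 + (e' j / s') ^ 2 * (2 * ((s' - s) / s) ^ 2) := by ring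
      _ ≤ _ := add_le_add (mul_le_mul_of_nonneg_left (hinv _) zero_le_two)
          (mul_le_mul_of_nonneg_left (mul_le_mul_of_nonneg_left (hinv _) zero_le_two)
            (sq_nonneg _))
  calc ∑ j ∈ N, (e j / s - e' j / s') ^ 2
      ≤ ∑ j ∈ N, (2 * (e j - e' j) ^ 2 + (e' j / s') ^ 2 * (2 * (s' - s) ^ 2)) :=
        Finset.sum_le_sum hterm
    _ = 2 * Δ + (∑ j ∈ N, (e' j / s') ^ 2) * (2 * (s' - s) ^ 2) := by
        rw [Finset.sum_add_distrib, ← Finset.mul_sum, ← Finset.sum_mul]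
    _ ≤ 2 * Δ + 1 * (2 * (N.card * Δ)) := by gcongr
    _ = _ := by ring

/-- Cut-off functions that have their defining properties everywhere and not only almost
everywhere. -/
structure IsStrictCutoff {D : Set X} {ι : Type u} (m : Measure X) (J : X → X → ℝ≥0∞) (φ : ℝ → ℝ)
    (W : WhitneyCover (1 / 4) (closure D)ᶜ ι) (A : ℝ≥0∞) (η : ι → X → ℝ) : Prop where
  measurable : ∀ i, Measurable (η i)
  mem_Icc : ∀ i x, η i x ∈ Icc (0 : ℝ) 1
  eq_one : ∀ i, ∀ x ∈ ball (W.center i) (5 / 2 * W.radius i), η i x = 1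
  eq_zero : ∀ i, ∀ x ∉ W.triple i, η i x = 0
  energy : ∀ i, energyOn m J univ (η i) ≤
    A * (m (ball (W.center i) (W.radius i)) / scaleE φ (W.radius i))

open Classical in
/-- The function `u` on `closure D`, glued with the superposition `∑ a_i ψ_i` off `closure D`. -/
def glue {ι : Type u} (D : Set X) (a : ι → ℝ) (η : ι → X → ℝ) (u : X → ℝ) (x : X) : ℝ :=
  if x ∈ closure D then u x else ∑' i, a i * partitionFn D η i x

/-- The functions of the partition of unity with extended nonnegative values. -/
def partitionE {ι : Type u} (D : Set X) (η : ι → X → ℝ) (i : ι) (x : X) : ℝ≥0∞ :=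
  ENNReal.ofReal (partitionFn D η i x)

namespace IsStrictCutoff

variable {D : Set X} {ι : Type u} {W : WhitneyCover (1 / 4) (closure D)ᶜ ι} {A : ℝ≥0∞}
  {η : ι → X → ℝ}

lemma tsum_eq (hη : IsStrictCutoff m J φ W A η) {x : X} {i : ι} (hx : x ∈ W.triple i)
    {N : Finset ι} (hN : ∀ j, j ∈ N ↔ W.Near i j) : ∑' j, η j x = ∑ j ∈ N, η j x :=
  tsum_eq_sum fun j hj => hη.eq_zero j x fun hxj =>
    hj ((hN j).2 (WhitneyCover.near_of_mem hx hxj))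

lemma one_le_sum (hη : IsStrictCutoff m J φ W A η) {x : X} {i : ι} (hx : x ∈ W.triple i)
    {N : Finset ι} (hN : ∀ j, j ∈ N ↔ W.Near i j) : 1 ≤ ∑ j ∈ N, η j x := by
  obtain ⟨l, hl⟩ := W.exists_mem_ball (W.notMem_closure_of_mem_triple hx)
  rw [← hη.eq_one l x hl]
  exact Finset.single_le_sum (f := fun j => η j x) (fun j _ => (hη.mem_Icc j x).1)
    ((hN l).2 (WhitneyCover.near_of_mem hx (W.ball_subset_triple l hl)))

lemma partitionFn_eq (hη : IsStrictCutoff m J φ W A η) {x : X} {i : ι} (hx : x ∈ W.triple i)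
    {N : Finset ι} (hN : ∀ j, j ∈ N ↔ W.Near i j) (j : ι) :
    partitionFn D η j x = η j x / ∑ l ∈ N, η l x := by
  rw [partitionFn, if_neg (W.notMem_closure_of_mem_triple hx), hη.tsum_eq hx hN]

lemma partitionFn_nonneg (hη : IsStrictCutoff m J φ W A η) (i : ι) (x : X) :
    0 ≤ partitionFn D η i x := by
  unfold partitionFn
  split_ifs
  · exact le_rfl
  · exact div_nonneg (hη.mem_Icc i x).1 (tsum_nonneg fun j => (hη.mem_Icc j x).1)

lemma partitionFn_eq_zero (hη : IsStrictCutoff m J φ W A η) {i : ι} {x : X}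
    (hx : x ∉ W.triple i) : partitionFn D η i x = 0 := by
  unfold partitionFn
  rw [hη.eq_zero i x hx, zero_div, ite_self]

lemma partitionE_eq_zero (hη : IsStrictCutoff m J φ W A η) {i : ι} {x : X}
    (hx : x ∉ W.triple i) : partitionE D η i x = 0 := by
  rw [partitionE, hη.partitionFn_eq_zero hx, ENNReal.ofReal_zero]

lemma mem_triple_of_partitionE_ne_zero (hη : IsStrictCutoff m J φ W A η) {i : ι} {x : X}
    (hx : partitionE D η i x ≠ 0) : x ∈ W.triple i := by
  by_contra h
  exact hx (hη.partitionE_eq_zero h)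

lemma sum_partitionFn (hη : IsStrictCutoff m J φ W A η) {x : X} {i : ι} (hx : x ∈ W.triple i)
    {N : Finset ι} (hN : ∀ j, j ∈ N ↔ W.Near i j) : ∑ j ∈ N, partitionFn D η j x = 1 := by
  simp_rw [hη.partitionFn_eq hx hN]
  rw [← Finset.sum_div]
  exact div_self (by linarith [hη.one_le_sum hx hN])

lemma glue_eq (hη : IsStrictCutoff m J φ W A η) {x : X} {i : ι} (hx : x ∈ W.triple i)
    {N : Finset ι} (hN : ∀ j, j ∈ N ↔ W.Near i j) (a : ι → ℝ) (u : X → ℝ) :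
    glue D a η u x = ∑ j ∈ N, a j * partitionFn D η j x := by
  rw [glue, if_neg (W.notMem_closure_of_mem_triple hx)]
  refine tsum_eq_sum fun j hj => ?_
  rw [hη.partitionFn_eq_zero fun hxj => hj ((hN j).2 (WhitneyCover.near_of_mem hx hxj)), mul_zero]

lemma tsum_partitionE_le (hη : IsStrictCutoff m J φ W A η) (h : IsJumpSpace k m J φ) (x : X) :
    ∑' i, partitionE D η i x ≤ 1 := by
  by_cases hx : x ∈ closure D
  · simp [partitionE, partitionFn, hx]
  · obtain ⟨i, hi⟩ := W.exists_mem_ball hx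
    obtain ⟨N, hN, -⟩ := W.exists_finset_near h i
    have hi := W.ball_subset_triple i hi
    rw [tsum_eq_sum (s := N) fun j hj => hη.partitionE_eq_zero fun hxj =>
      hj ((hN j).2 (WhitneyCover.near_of_mem hi hxj))]
    simp only [partitionE]
    rw [← ENNReal.ofReal_sum_of_nonneg fun j _ => hη.partitionFn_nonneg j x,
      hη.sum_partitionFn hi hN, ENNReal.ofReal_one]

lemma partitionE_le_indicator (hη : IsStrictCutoff m J φ W A η) (h : IsJumpSpace k m J φ) (i : ι)
    (x : X) : partitionE D η i x ≤ (W.triple i).indicator (fun _ => 1) x := by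
  by_cases hx : x ∈ W.triple i
  · rw [indicator_of_mem hx]
    exact (ENNReal.le_tsum i).trans (hη.tsum_partitionE_le h x)
  · rw [hη.partitionE_eq_zero hx]; exact zero_le

lemma lintegral_partitionE_le (hη : IsStrictCutoff m J φ W A η) (h : IsJumpSpace k m J φ) (i : ι) :
    ∫⁻ x, partitionE D η i x ∂m ≤ k.V ^ 2 * m (ball (W.center i) (W.radius i)) := by
  calc ∫⁻ x, partitionE D η i x ∂m ≤ ∫⁻ x, (W.triple i).indicator (fun _ => 1) x ∂m :=
        lintegral_mono (hη.partitionE_le_indicator h i)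
    _ = m (W.triple i) := by rw [lintegral_indicator (W.measurableSet_triple i)]; simp
    _ ≤ _ := W.measure_triple_le h i

lemma measurable_partitionFn (hη : IsStrictCutoff m J φ W A η) (i : ι) :
    Measurable (partitionFn D η i) := by
  have := W.countable
  have h1 : Measurable fun x => ∑' j, η j x := by
    have e : (fun x => ∑' j, η j x) = fun x => (∑' j, ENNReal.ofReal (η j x)).toReal := by
      funext x
      rw [ENNReal.tsum_toReal_eq fun j => ENNReal.ofReal_ne_top]
      exact tsum_congr fun j => (ENNReal.toReal_ofReal (hη.mem_Icc j x).1).symm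
    rw [e]
    exact (Measurable.tsum fun j => (hη.measurable j).ennreal_ofReal).ennreal_toReal
  unfold partitionFn
  exact Measurable.ite isClosed_closure.measurableSet measurable_const ((hη.measurable i).div h1)

lemma measurable_partitionE (hη : IsStrictCutoff m J φ W A η) (i : ι) :
    Measurable (partitionE D η i) := (hη.measurable_partitionFn i).ennreal_ofReal

lemma ofReal_glue_sub_sq_le (hη : IsStrictCutoff m J φ W A η) (h : IsJumpSpace k m J φ)
    (a : ι → ℝ) (u : X → ℝ) {x : X} (hx : x ∉ closure D) (c : ℝ) :
    ENNReal.ofReal ((glue D a η u x - c) ^ 2) ≤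
      ∑' i, partitionE D η i x * ENNReal.ofReal ((a i - c) ^ 2) := by
  obtain ⟨i, hi⟩ := W.exists_mem_ball hx
  obtain ⟨N, hN, -⟩ := W.exists_finset_near h i
  have hi := W.ball_subset_triple i hi
  rw [hη.glue_eq hi hN]
  calc ENNReal.ofReal ((∑ j ∈ N, a j * partitionFn D η j x - c) ^ 2)
      ≤ ENNReal.ofReal (∑ j ∈ N, partitionFn D η j x * (a j - c) ^ 2) :=
        ENNReal.ofReal_le_ofReal (sq_sum_mul_sub_le N _ a c
          (fun j _ => hη.partitionFn_nonneg j x) (hη.sum_partitionFn hi hN))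
    _ = ∑ j ∈ N, partitionE D η j x * ENNReal.ofReal ((a j - c) ^ 2) := by
        rw [ENNReal.ofReal_sum_of_nonneg fun j _ =>
          mul_nonneg (hη.partitionFn_nonneg j x) (sq_nonneg _)]
        exact Finset.sum_congr rfl fun j _ => ENNReal.ofReal_mul (hη.partitionFn_nonneg j x)
    _ ≤ _ := ENNReal.sum_le_tsum N

lemma ofReal_glue_sub_glue_sq_le (hη : IsStrictCutoff m J φ W A η) (h : IsJumpSpace k m J φ)
    (a : ι → ℝ) (u : X → ℝ) {x y : X} (hx : x ∉ closure D) (hy : y ∉ closure D) :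
    ENNReal.ofReal ((glue D a η u x - glue D a η u y) ^ 2) ≤
      ∑' i, ∑' j, partitionE D η i x * partitionE D η j y * ENNReal.ofReal ((a i - a j) ^ 2) := by
  refine (hη.ofReal_glue_sub_sq_le h a u hx _).trans (ENNReal.tsum_le_tsum fun i => ?_)
  simp_rw [mul_assoc]
  rw [ENNReal.tsum_mul_left]
  gcongr
  rw [sub_sq_comm]
  refine (hη.ofReal_glue_sub_sq_le h a u hy _).trans (le_of_eq (tsum_congr fun j => ?_))
  rw [sub_sq_comm]

/-- The oscillation of the glued function inside a ball `3 B_i`. -/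
lemma ofReal_glue_sub_glue_sq_le_of_mem (hη : IsStrictCutoff m J φ W A η) (a : ι → ℝ) (u : X → ℝ)
    {x y : X} {i : ι} (hx : x ∈ W.triple i) (hy : y ∈ W.triple i) {N : Finset ι}
    (hN : ∀ j, j ∈ N ↔ W.Near i j) (S : Set ι) [DecidablePred (· ∈ S)]
    (hSx : ∀ j, x ∈ W.triple j → j ∈ S) (hSy : ∀ j, y ∈ W.triple j → j ∈ S) :
    ENNReal.ofReal ((glue D a η u x - glue D a η u y) ^ 2) ≤
      2 * (1 + N.card) * (∑ j ∈ N.filter (· ∈ S), ENNReal.ofReal ((a i - a j) ^ 2)) *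
        ∑ j ∈ N, ENNReal.ofReal ((η j x - η j y) ^ 2) := by
  have hreal : (glue D a η u x - glue D a η u y) ^ 2 ≤
      2 * (1 + N.card) * (∑ j ∈ N.filter (· ∈ S), (a i - a j) ^ 2) *
        ∑ j ∈ N, (η j x - η j y) ^ 2 := by
    set p := fun j => partitionFn D η j x - partitionFn D η j y with hp
    -- The partition functions sum to one at `x` and at `y`, so `a i` may be subtracted.
    have h1 : glue D a η u x - glue D a η u y = ∑ j ∈ N.filter (· ∈ S), (a j - a i) * p j := by
      have h2 : ∑ j ∈ N.filter (· ∈ S), (a j - a i) * p j = ∑ j ∈ N, (a j - a i) * p j := by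
        refine Finset.sum_subset (Finset.filter_subset _ _) fun j hj hjS => ?_
        have hj' : j ∉ S := fun hjS' => hjS (Finset.mem_filter.2 ⟨hj, hjS'⟩)
        rw [hp]
        dsimp only
        rw [hη.partitionFn_eq_zero fun hxj => hj' (hSx j hxj),
          hη.partitionFn_eq_zero fun hyj => hj' (hSy j hyj), sub_zero, mul_zero]
      have hx1 := hη.sum_partitionFn hx hN
      have hy1 := hη.sum_partitionFn hy hN
      rw [h2, hη.glue_eq hx hN, hη.glue_eq hy hN]
      simp only [hp, sub_mul, mul_sub, Finset.sum_sub_distrib, ← Finset.mul_sum, hx1, hy1]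
      ring
    rw [h1]
    calc (∑ j ∈ N.filter (· ∈ S), (a j - a i) * p j) ^ 2
        ≤ (∑ j ∈ N.filter (· ∈ S), (a j - a i) ^ 2) * ∑ j ∈ N.filter (· ∈ S), p j ^ 2 :=
          Finset.sum_mul_sq_le_sq_mul_sq _ _ _
      _ ≤ (∑ j ∈ N.filter (· ∈ S), (a i - a j) ^ 2) *
          (2 * (1 + N.card) * ∑ j ∈ N, (η j x - η j y) ^ 2) := by
          refine mul_le_mul (le_of_eq (Finset.sum_congr rfl fun j _ => by ring)) ?_
            (Finset.sum_nonneg fun j _ => sq_nonneg _) (Finset.sum_nonneg fun j _ => sq_nonneg _)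
          refine (Finset.sum_le_sum_of_subset_of_nonneg (Finset.filter_subset _ _)
            fun j _ _ => sq_nonneg _).trans ?_
          simp only [hp, hη.partitionFn_eq hx hN, hη.partitionFn_eq hy hN]
          exact sum_sq_div_sub_div_le N (fun j => η j x) (fun j => η j y)
            (fun j _ => (hη.mem_Icc j y).1) (hη.one_le_sum hx hN) (hη.one_le_sum hy hN)
      _ = _ := by ring
  refine (ENNReal.ofReal_le_ofReal hreal).trans (le_of_eq ?_)
  rw [ENNReal.ofReal_mul (by positivity), ENNReal.ofReal_mul (by positivity),
    ENNReal.ofReal_sum_of_nonneg fun j _ => sq_nonneg _,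
    ENNReal.ofReal_sum_of_nonneg fun j _ => sq_nonneg _, ENNReal.ofReal_mul (by norm_num),
    ENNReal.ofReal_add (by norm_num) (by positivity), ENNReal.ofReal_natCast]
  simp

end IsStrictCutoff

/-! ### Energy off the closure of the domain in terms of the coefficients -/

namespace WhitneyCover

variable {D : Set X} {ι : Type u} (W : WhitneyCover (1 / 4) (closure D)ᶜ ι)

/-- The volume of the Whitney ball `B_i`. -/
def vol (m : Measure X) (i : ι) : ℝ≥0∞ := m (ball (W.center i) (W.radius i))

lemma vol_ne_zero (i : ι) : W.vol m i ≠ 0 := (measure_ball_pos m _ (W.radius_pos i)).ne'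

lemma vol_ne_top (h : IsJumpSpace k m J φ) (i : ι) : W.vol m i ≠ ∞ := h.measure_ball_ne_top _ _

/-- The indices `i` for which `3 B_i` meets `B`. -/
def meeting (B : Set X) : Set ι := {i | (W.triple i ∩ B).Nonempty}

/-- The pairs of points of `B` off `closure D` that do not lie in a common ball `3 B_i`. -/
def farSet (B : Set X) : Set (X × X) :=
  ((B \ closure D) ×ˢ (B \ closure D)) \ ⋃ i, W.triple i ×ˢ W.triple i

lemma measurableSet_farSet {B : Set X} (hB : MeasurableSet B) : MeasurableSet (W.farSet B) := by
  have := W.countable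
  have hB' := hB.diff (isClosed_closure (s := D)).measurableSet
  exact (hB'.prod hB').diff
    (MeasurableSet.iUnion fun i => (W.measurableSet_triple i).prod (W.measurableSet_triple i))

lemma swap_mem_farSet {B : Set X} {p : X × X} : p.swap ∈ W.farSet B ↔ p ∈ W.farSet B := by
  simp only [farSet, Set.mem_sdiff, mem_prod, mem_iUnion, Prod.fst_swap, Prod.snd_swap, and_comm]

variable {W}

/-- If `p.1` lies in `(5/2) B_l`, then `p.2` is outside of `3 B_l`, hence at distance more than
`r_l / 2` from `p.1`, and `r_i < 4 r_l`. -/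
lemma radius_lt_of_mem_farSet {B : Set X} {p : X × X} (hp : p ∈ W.farSet B) {i : ι}
    (hi : p.1 ∈ W.triple i) : W.radius i < 8 * dist p.1 p.2 := by
  obtain ⟨l, hl⟩ := W.exists_mem_ball (W.notMem_closure_of_mem_triple hi)
  have hl' := W.ball_subset_triple l hl
  have hnot : p.2 ∉ W.triple l := fun h2 => hp.2 (mem_iUnion.2 ⟨l, hl', h2⟩)
  have h1 := (near_of_mem hi hl').radius_lt
  rw [triple, mem_ball, not_lt] at hnot
  rw [mem_ball] at hl
  linarith [dist_triangle_left p.2 (W.center l) p.1]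

lemma radius_lt_of_mem_farSet' {B : Set X} {p : X × X} (hp : p ∈ W.farSet B) {j : ι}
    (hj : p.2 ∈ W.triple j) : W.radius j < 8 * dist p.1 p.2 := by
  have := radius_lt_of_mem_farSet (W.swap_mem_farSet.2 hp) (i := j) hj
  rwa [Prod.fst_swap, Prod.snd_swap, dist_comm] at this

variable (W)

/-- The interaction of the indices `i` and `j` through pairs of points far apart. -/
def farInteraction (m : Measure X) (J : X → X → ℝ≥0∞) (η : ι → X → ℝ) (B : Set X) (i j : ι) :
    ℝ≥0∞ :=
  ∫⁻ p in W.farSet B, partitionE D η i p.1 * partitionE D η j p.2 * J p.1 p.2 ∂(m.prod m)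

open Classical in
/-- The interaction of near indices `i` and `j`, which is the bound for the energy of the
cut-offs. -/
def nearInteraction (m : Measure X) (φ : ℝ → ℝ) (B : Set X) (i j : ι) : ℝ≥0∞ :=
  if W.Near i j ∧ i ∈ W.meeting B ∧ j ∈ W.meeting B then W.vol m i / scaleE φ (W.radius i) else 0

/-- The total interaction of the indices `i` and `j`. -/
def interaction (m : Measure X) (J : X → X → ℝ≥0∞) (φ : ℝ → ℝ) (η : ι → X → ℝ) (B : Set X)
    (c : ℝ≥0∞) (i j : ι) : ℝ≥0∞ :=
  c * W.nearInteraction m φ B i j + W.farInteraction m J η B i j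

end WhitneyCover

/-- The constant in the estimate of the energy near the diagonal. -/
def Constants.near (k : Constants) (A : ℝ≥0∞) : ℝ≥0∞ :=
  2 * (1 + k.V ^ 8) * (k.V ^ 8 * (A * (k.V ^ 5 * k.Q 2)))

namespace IsStrictCutoff

variable {D : Set X} {ι : Type u} {W : WhitneyCover (1 / 4) (closure D)ᶜ ι} {A : ℝ≥0∞}
  {η : ι → X → ℝ} {B : Set X}

lemma inv_scaleE_le_of_near (h : IsJumpSpace k m J φ) {i j : ι} (hij : W.Near i j) :
    (scaleE φ (W.radius j))⁻¹ ≤ k.Q 2 * (scaleE φ (W.radius i))⁻¹ := by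
  have h4 : scaleE φ (W.radius i) ≤ k.Q 2 * scaleE φ (W.radius j) :=
    h.scaleE_le 2 (W.radius_pos j) (W.radius_pos i).le (by linarith [hij.radius_lt])
  rw [← div_eq_mul_inv, ENNReal.le_div_iff_mul_le (Or.inl (h.scaleE_ne_zero (W.radius_pos i)))
    (Or.inl IsJumpSpace.scaleE_ne_top), mul_comm, ← div_eq_mul_inv]
  exact ENNReal.div_le_of_le_mul h4

lemma vol_div_scaleE_le_of_near (h : IsJumpSpace k m J φ) {i j : ι} (hij : W.Near i j) :
    W.vol m j / scaleE φ (W.radius j) ≤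
      k.V ^ 5 * k.Q 2 * (W.vol m i / scaleE φ (W.radius i)) := by
  calc W.vol m j / scaleE φ (W.radius j)
      ≤ (k.V ^ 5 * W.vol m i) * (k.Q 2 * (scaleE φ (W.radius i))⁻¹) := by
        rw [div_eq_mul_inv (W.vol m j)]
        exact mul_le_mul' (W.measure_ball_le_of_near h hij.symm) (inv_scaleE_le_of_near h hij)
    _ = _ := by rw [div_eq_mul_inv (W.vol m i)]; ring

/-- The energy of the pairs in a common ball `3 B_i`: there the partition functions vary no more than
the cut-offs of the neighbours of `i`. -/
lemma energyOn_glue_triple_le (hη : IsStrictCutoff m J φ W A η) (h : IsJumpSpace k m J φ)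
    (hB : MeasurableSet B) (a : ι → ℝ) (u : X → ℝ) (i : ι) :
    energyOn m J ((B ∩ W.triple i) ×ˢ (B ∩ W.triple i)) (glue D a η u) ≤
      ∑' j, ENNReal.ofReal ((a i - a j) ^ 2) * (k.near A * W.nearInteraction m φ B i j) := by
  classical
  by_cases hi : i ∈ W.meeting B
  swap
  · have : B ∩ W.triple i = ∅ := by
      rw [inter_comm]; exact not_nonempty_iff_eq_empty.1 hi
    rw [this]; simp [energyOn]
  obtain ⟨N, hN, hcard⟩ := W.exists_finset_near h i
  set c : ℝ≥0∞ := 2 * (1 + N.card) *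
    (∑ j ∈ N.filter (· ∈ W.meeting B), ENNReal.ofReal ((a i - a j) ^ 2)) with hc
  have hmeas : ∀ l, Measurable fun p : X × X =>
      ENNReal.ofReal ((η l p.1 - η l p.2) ^ 2) * J p.1 p.2 := fun l =>
    (((((hη.measurable l).comp measurable_fst).sub
      ((hη.measurable l).comp measurable_snd)).pow_const 2).ennreal_ofReal).mul h.measurable
  have hBi : MeasurableSet (B ∩ W.triple i) := hB.inter (W.measurableSet_triple i)
  calc energyOn m J ((B ∩ W.triple i) ×ˢ (B ∩ W.triple i)) (glue D a η u)
      ≤ ∫⁻ p in (B ∩ W.triple i) ×ˢ (B ∩ W.triple i),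
          c * ∑ l ∈ N, ENNReal.ofReal ((η l p.1 - η l p.2) ^ 2) * J p.1 p.2 ∂(m.prod m) := by
        refine setLIntegral_mono' (hBi.prod hBi) fun p hp => ?_
        rw [← Finset.sum_mul, ← mul_assoc]
        gcongr
        exact hη.ofReal_glue_sub_glue_sq_le_of_mem a u hp.1.2 hp.2.2 hN (W.meeting B)
          (fun j hj => ⟨p.1, hj, hp.1.1⟩) (fun j hj => ⟨p.2, hj, hp.2.1⟩)
    _ ≤ ∫⁻ p, c * ∑ l ∈ N, ENNReal.ofReal ((η l p.1 - η l p.2) ^ 2) * J p.1 p.2 ∂(m.prod m) :=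
        setLIntegral_le_lintegral _ _
    _ = c * ∑ l ∈ N, energyOn m J univ (η l) := by
        rw [lintegral_const_mul _ (Finset.measurable_fun_sum _ fun l _ => hmeas l),
          lintegral_finsetSum _ fun l _ => hmeas l]
        simp only [energyOn, Measure.restrict_univ]
    _ ≤ c * ∑ l ∈ N, A * (k.V ^ 5 * k.Q 2 * (W.vol m i / scaleE φ (W.radius i))) := by
        gcongr with l hl
        refine (hη.energy l).trans ?_
        gcongr
        exact vol_div_scaleE_le_of_near h ((hN l).1 hl)
    _ ≤ (2 * (1 + k.V ^ 8) *
          (∑ j ∈ N.filter (· ∈ W.meeting B), ENNReal.ofReal ((a i - a j) ^ 2))) *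
          (k.V ^ 8 * (A * (k.V ^ 5 * k.Q 2 * (W.vol m i / scaleE φ (W.radius i))))) := by
        rw [Finset.sum_const, nsmul_eq_mul, hc]
        gcongr
    _ = ∑ j ∈ N.filter (· ∈ W.meeting B),
          ENNReal.ofReal ((a i - a j) ^ 2) * (k.near A * W.nearInteraction m φ B i j) := by
        calc _ = (∑ j ∈ N.filter (· ∈ W.meeting B), ENNReal.ofReal ((a i - a j) ^ 2)) *
              (k.near A * (W.vol m i / scaleE φ (W.radius i))) := by
              rw [Constants.near]; ring
          _ = _ := by
            rw [Finset.sum_mul]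
            refine Finset.sum_congr rfl fun j hj => ?_
            rw [WhitneyCover.nearInteraction,
              if_pos ⟨(hN j).1 (Finset.mem_filter.1 hj).1, hi, (Finset.mem_filter.1 hj).2⟩]
    _ ≤ _ := ENNReal.sum_le_tsum _

lemma measurable_partitionE_mul (hη : IsStrictCutoff m J φ W A η) (h : IsJumpSpace k m J φ)
    (i j : ι) :
    Measurable fun p : X × X => partitionE D η i p.1 * partitionE D η j p.2 * J p.1 p.2 :=
  (((hη.measurable_partitionE i).comp measurable_fst).mul
    ((hη.measurable_partitionE j).comp measurable_snd)).mul h.measurable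

lemma energyOn_glue_far_le (hη : IsStrictCutoff m J φ W A η) (h : IsJumpSpace k m J φ)
    (hB : MeasurableSet B) (a : ι → ℝ) (u : X → ℝ) :
    energyOn m J (W.farSet B) (glue D a η u) ≤
      ∑' i, ∑' j, ENNReal.ofReal ((a i - a j) ^ 2) * W.farInteraction m J η B i j := by
  have := W.countable
  have hm := hη.measurable_partitionE_mul h
  calc energyOn m J (W.farSet B) (glue D a η u)
      ≤ ∫⁻ p in W.farSet B, ∑' i, ∑' j, ENNReal.ofReal ((a i - a j) ^ 2) *
          (partitionE D η i p.1 * partitionE D η j p.2 * J p.1 p.2) ∂(m.prod m) := by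
        refine setLIntegral_mono' (W.measurableSet_farSet hB) fun p hp => ?_
        calc _ ≤ (∑' i, ∑' j, partitionE D η i p.1 * partitionE D η j p.2 *
              ENNReal.ofReal ((a i - a j) ^ 2)) * J p.1 p.2 := by
              gcongr
              exact hη.ofReal_glue_sub_glue_sq_le h a u hp.1.1.2 hp.1.2.2
          _ = _ := by
              simp_rw [← ENNReal.tsum_mul_right]
              exact tsum_congr fun i => tsum_congr fun j => by ring
    _ = _ := by
        rw [lintegral_tsum fun i =>
          (Measurable.tsum fun j => (hm i j).const_mul _).aemeasurable]
        refine tsum_congr fun i => ?_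
        rw [lintegral_tsum fun j => ((hm i j).const_mul _).aemeasurable]
        exact tsum_congr fun j => lintegral_const_mul _ (hm i j)

/-- The energy off the closure of `D` is controlled by the differences of the coefficients. -/
lemma energyOn_glue_diff_le (hη : IsStrictCutoff m J φ W A η) (h : IsJumpSpace k m J φ)
    (hB : MeasurableSet B) (a : ι → ℝ) (u : X → ℝ) :
    energyOn m J ((B \ closure D) ×ˢ (B \ closure D)) (glue D a η u) ≤
      ∑' i, ∑' j, ENNReal.ofReal ((a i - a j) ^ 2) *
        W.interaction m J φ η B (k.near A) i j := by
  have := W.countable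
  have hsub : (B \ closure D) ×ˢ (B \ closure D) ⊆
      (⋃ i, (B ∩ W.triple i) ×ˢ (B ∩ W.triple i)) ∪ W.farSet B := by
    intro p hp
    by_cases hU : p ∈ ⋃ i, W.triple i ×ˢ W.triple i
    · obtain ⟨i, hi⟩ := mem_iUnion.1 hU
      exact Or.inl (mem_iUnion.2 ⟨i, ⟨hp.1.1, hi.1⟩, hp.2.1, hi.2⟩)
    · exact Or.inr ⟨hp, hU⟩
  calc energyOn m J ((B \ closure D) ×ˢ (B \ closure D)) (glue D a η u)
      ≤ energyOn m J (⋃ i, (B ∩ W.triple i) ×ˢ (B ∩ W.triple i)) (glue D a η u) +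
          energyOn m J (W.farSet B) (glue D a η u) :=
        (lintegral_mono_set hsub).trans (lintegral_union_le _ _ _)
    _ ≤ ∑' i, ∑' j, ENNReal.ofReal ((a i - a j) ^ 2) *
          (k.near A * W.nearInteraction m φ B i j) +
        ∑' i, ∑' j, ENNReal.ofReal ((a i - a j) ^ 2) * W.farInteraction m J η B i j := by
        gcongr
        · exact (lintegral_iUnion_le _ _).trans
            (ENNReal.tsum_le_tsum fun i => hη.energyOn_glue_triple_le h hB a u i)
        · exact hη.energyOn_glue_far_le h hB a u
    _ = _ := by
        rw [← ENNReal.tsum_add]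
        refine tsum_congr fun i => ?_
        rw [← ENNReal.tsum_add]
        exact tsum_congr fun j => by rw [WhitneyCover.interaction, mul_add]

/-! ### Bounds for the interactions -/

lemma farInteraction_symm (h : IsJumpSpace k m J φ) (i j : ι) (hB : MeasurableSet B) :
    W.farInteraction m J η B i j = W.farInteraction m J η B j i := by
  have hm := W.measurableSet_farSet hB
  rw [WhitneyCover.farInteraction, WhitneyCover.farInteraction, ← lintegral_indicator hm,
    ← lintegral_indicator hm, ← lintegral_prod_swap]
  refine lintegral_congr fun p => ?_
  by_cases hp : p ∈ W.farSet B
  · rw [indicator_of_mem hp, indicator_of_mem (W.swap_mem_farSet.2 hp), h.symm]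
    simp only [Prod.fst_swap, Prod.snd_swap]
    ring
  · rw [indicator_of_notMem hp, indicator_of_notMem (fun hp' => hp (W.swap_mem_farSet.1 hp'))]

lemma nearInteraction_le_symm (h : IsJumpSpace k m J φ) (i j : ι) :
    W.nearInteraction m φ B i j ≤ k.V ^ 5 * k.Q 2 * W.nearInteraction m φ B j i := by
  by_cases hij : W.Near i j ∧ i ∈ W.meeting B ∧ j ∈ W.meeting B
  · rw [WhitneyCover.nearInteraction, if_pos hij, WhitneyCover.nearInteraction,
      if_pos ⟨hij.1.symm, hij.2.2, hij.2.1⟩]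
    exact vol_div_scaleE_le_of_near h hij.1.symm
  · rw [WhitneyCover.nearInteraction, if_neg hij]; exact zero_le

lemma farInteraction_eq_zero (hη : IsStrictCutoff m J φ W A η) (hB : MeasurableSet B) {i j : ι}
    (hij : ¬ (i ∈ W.meeting B ∧ j ∈ W.meeting B)) : W.farInteraction m J η B i j = 0 := by
  rw [WhitneyCover.farInteraction]
  refine (setLIntegral_congr_fun (g := fun _ => 0) (W.measurableSet_farSet hB)
    fun p hp => ?_).trans (by simp)
  by_contra hne
  refine hij ⟨⟨p.1, hη.mem_triple_of_partitionE_ne_zero fun h0 => hne ?_, hp.1.1.1⟩,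
    ⟨p.2, hη.mem_triple_of_partitionE_ne_zero fun h0 => hne ?_, hp.1.2.1⟩⟩ <;> simp [h0]

lemma interaction_eq_zero (hη : IsStrictCutoff m J φ W A η) (hB : MeasurableSet B) (c : ℝ≥0∞)
    {i j : ι} (hij : ¬ (i ∈ W.meeting B ∧ j ∈ W.meeting B)) :
    W.interaction m J φ η B c i j = 0 := by
  rw [WhitneyCover.interaction, hη.farInteraction_eq_zero hB hij, WhitneyCover.nearInteraction,
    if_neg fun h => hij h.2, mul_zero, add_zero]

/-- The far interaction is at most the jump kernel between points associated with the indices. -/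
lemma farInteraction_le (hη : IsStrictCutoff m J φ W A η) (h : IsJumpSpace k m J φ)
    (hB : MeasurableSet B) {i j : ι} {z w : X} (hz : z ∈ closedBall (W.center i) (9 * W.radius i))
    (hw : w ∈ closedBall (W.center j) (9 * W.radius j)) (hzw : z ≠ w) :
    W.farInteraction m J η B i j ≤ k.V ^ 4 * k.H 9 * (W.vol m i * W.vol m j * J z w) := by
  calc W.farInteraction m J η B i j
      ≤ ∫⁻ p in W.farSet B, (W.triple i ×ˢ W.triple j).indicator
          (fun _ => k.H 9 * J z w) p ∂(m.prod m) := by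
        refine setLIntegral_mono' (W.measurableSet_farSet hB) fun p hp => ?_
        by_cases h1 : p.1 ∈ W.triple i
        swap
        · rw [hη.partitionE_eq_zero h1, zero_mul, zero_mul]; exact zero_le
        by_cases h2 : p.2 ∈ W.triple j
        swap
        · rw [hη.partitionE_eq_zero h2, mul_zero, zero_mul]; exact zero_le
        rw [indicator_of_mem (show p ∈ W.triple i ×ˢ W.triple j from ⟨h1, h2⟩)]
        have hP : partitionE D η i p.1 * partitionE D η j p.2 ≤ 1 :=
          mul_le_one' ((ENNReal.le_tsum i).trans (hη.tsum_partitionE_le h _))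
            ((ENNReal.le_tsum j).trans (hη.tsum_partitionE_le h _))
        have hr1 := WhitneyCover.radius_lt_of_mem_farSet hp h1
        have hr2 := WhitneyCover.radius_lt_of_mem_farSet' hp h2
        have hd : 0 < dist p.1 p.2 := by linarith [W.radius_pos i]
        refine (mul_le_mul' hP (h.jump_le 9 (dist_pos.1 hd) hzw ?_)).trans (one_mul _).le
        rw [WhitneyCover.triple, mem_ball] at h1
        rw [WhitneyCover.triple, mem_ball] at h2
        rw [mem_closedBall'] at hz
        rw [mem_closedBall] at hw
        have t1 := dist_triangle p.1 (W.center i) z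
        have t2 := dist_triangle z p.1 w
        have t3 := dist_triangle p.1 p.2 w
        have t4 := dist_triangle p.2 (W.center j) w
        rw [dist_comm z p.1] at t2
        rw [dist_comm w] at hw
        linarith
    _ ≤ ∫⁻ p, (W.triple i ×ˢ W.triple j).indicator (fun _ => k.H 9 * J z w) p ∂(m.prod m) :=
        setLIntegral_le_lintegral _ _
    _ = k.H 9 * J z w * (m (W.triple i) * m (W.triple j)) := by
        rw [lintegral_indicator ((W.measurableSet_triple i).prod (W.measurableSet_triple j)),
          setLIntegral_const, Measure.prod_prod]
    _ ≤ k.H 9 * J z w * ((k.V ^ 2 * W.vol m i) * (k.V ^ 2 * W.vol m j)) := by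
        gcongr
        · exact W.measure_triple_le h i
        · exact W.measure_triple_le h j
    _ = _ := by ring

/-- The near interaction is at most the jump kernel between points associated with the indices, since
these points are at a distance of order `r_i` at most. -/
lemma nearInteraction_le (h : IsJumpSpace k m J φ) {i j : ι} {z w : X}
    (hz : z ∈ closedBall (W.center i) (9 * W.radius i))
    (hw : w ∈ closedBall (W.center j) (9 * W.radius j)) (hzw : z ≠ w) :
    W.nearInteraction m φ B i j ≤
      k.V ^ 5 * (k.G 7 / ENNReal.ofReal k.J₁) * (W.vol m i * W.vol m j * J z w) := by
  by_cases hij : W.Near i j ∧ i ∈ W.meeting B ∧ j ∈ W.meeting B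
  swap
  · rw [WhitneyCover.nearInteraction, if_neg hij]; exact zero_le
  rw [WhitneyCover.nearInteraction, if_pos hij]
  have hv0 := W.vol_ne_zero (m := m) i
  have hvt := W.vol_ne_top h i
  have hJ : (W.vol m i * scaleE φ (W.radius i))⁻¹ ≤ k.G 7 / ENNReal.ofReal k.J₁ * J z w := by
    refine h.inv_volume_mul_scaleE_le 7 (W.radius_pos i) hzw ?_
    rw [mem_closedBall'] at hz hw
    have h1 := hij.1.symm.radius_lt
    have h2 := hij.1.dist_lt
    have t1 := dist_triangle z (W.center i) w
    have t2 := dist_triangle (W.center i) (W.center j) w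
    rw [dist_comm z (W.center i)] at t1
    linarith [W.radius_pos i]
  calc W.vol m i / scaleE φ (W.radius i)
      = W.vol m i * W.vol m i * (W.vol m i * scaleE φ (W.radius i))⁻¹ := by
        rw [ENNReal.mul_inv (Or.inl hv0) (Or.inl hvt), div_eq_mul_inv]
        calc _ = W.vol m i * 1 * (scaleE φ (W.radius i))⁻¹ := by rw [mul_one]
          _ = W.vol m i * (W.vol m i * (W.vol m i)⁻¹) * (scaleE φ (W.radius i))⁻¹ := by
            rw [ENNReal.mul_inv_cancel hv0 hvt]
          _ = _ := by ring
    _ ≤ W.vol m i * (k.V ^ 5 * W.vol m j) * (k.G 7 / ENNReal.ofReal k.J₁ * J z w) := by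
        gcongr
        exact W.measure_ball_le_of_near h hij.1
    _ = _ := by ring

end IsStrictCutoff

lemma tsum_le_tsum_subtype_add {ι : Type*} (L T : Set ι) (g : ι → ℝ≥0∞)
    (hg : ∀ i, i ∉ L → i ∉ T → g i = 0) : ∑' i, g i ≤ ∑' i : L, g i + ∑' i : T, g i := by
  rw [tsum_subtype, tsum_subtype, ← ENNReal.tsum_add]
  refine ENNReal.tsum_le_tsum fun i => ?_
  by_cases hL : i ∈ L
  · rw [indicator_of_mem hL]; exact le_self_add
  · by_cases hT : i ∈ T
    · rw [indicator_of_mem hT]; exact le_add_self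
    · rw [hg i hL hT]; exact zero_le

/-- The constant in the bound for the interaction with the balls outside of the index set over
which the function is averaged. -/
def Constants.outer (k : Constants) (c : ℝ≥0∞) : ℝ≥0∞ := c * k.V ^ 8 + k.V ^ 2 * k.tail

/-- Off the index set `L`, the balls `3 B_i` that meet `B` have radius at least `τ`, and `κ` is a
bound for the inverse scale at a radius comparable to `τ`. If all these balls have indices in `L`,
then `κ = 0` is allowed. -/
def IsOuterBound {D : Set X} {ι : Type u} (φ : ℝ → ℝ) (W : WhitneyCover (1 / 4) (closure D)ᶜ ι)
    (B : Set X) (L : Set ι) (τ : ℝ) (κ : ℝ≥0∞) : Prop :=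
  ∀ i ∈ W.meeting B \ L, τ ≤ W.radius i ∧ (scaleE φ (τ / 8))⁻¹ ≤ κ

namespace IsStrictCutoff

variable {D : Set X} {ι : Type u} {W : WhitneyCover (1 / 4) (closure D)ᶜ ι} {A : ℝ≥0∞}
  {η : ι → X → ℝ} {B : Set X} {L : Set ι} {τ : ℝ} {κ : ℝ≥0∞}

lemma lintegral_jump_le_of_outer (h : IsJumpSpace k m J φ) (hτ : 0 < τ)
    (hκ : IsOuterBound φ W B L τ κ) {i : ι} (hi : i ∈ W.meeting B \ L) (x : X) :
    ∫⁻ y in {y | τ / 8 ≤ dist x y}, J x y ∂m ≤ k.tail * κ :=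
  (h.lintegral_jump_le x (by positivity)).trans (by gcongr; exact (hκ i hi).2)

lemma tsum_farInteraction_le (hη : IsStrictCutoff m J φ W A η) (h : IsJumpSpace k m J φ)
    (hB : MeasurableSet B) (hτ : 0 < τ) (hκ : IsOuterBound φ W B L τ κ) (i : ι) :
    ∑' j : ↥(W.meeting B \ L), W.farInteraction m J η B i j ≤
      k.V ^ 2 * k.tail * (κ * W.vol m i) := by
  have := W.countable
  rcases (W.meeting B \ L).eq_empty_or_nonempty with h0 | ⟨l, hl⟩
  · have : IsEmpty ↥(W.meeting B \ L) := isEmpty_coe_sort.2 h0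
    simp
  have hE : MeasurableSet {p : X × X | τ / 8 ≤ dist p.1 p.2} :=
    measurableSet_le measurable_const (measurable_fst.dist measurable_snd)
  calc ∑' j : ↥(W.meeting B \ L), W.farInteraction m J η B i j
      = ∫⁻ p in W.farSet B, ∑' j : ↥(W.meeting B \ L),
          partitionE D η i p.1 * partitionE D η j p.2 * J p.1 p.2 ∂(m.prod m) :=
        (lintegral_tsum fun j : ↥(W.meeting B \ L) =>
          (hη.measurable_partitionE_mul h i j).aemeasurable).symm
    _ ≤ ∫⁻ p in W.farSet B, partitionE D η i p.1 *
          {p : X × X | τ / 8 ≤ dist p.1 p.2}.indicator (fun p => J p.1 p.2) p ∂(m.prod m) := by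
        refine setLIntegral_mono' (W.measurableSet_farSet hB) fun p hp => ?_
        by_cases hj : ∃ j : ↥(W.meeting B \ L), p.2 ∈ W.triple j
        · obtain ⟨j, hj⟩ := hj
          have h1 := WhitneyCover.radius_lt_of_mem_farSet' hp hj
          have h2 := (hκ j j.2).1
          have hmem : p ∈ {p : X × X | τ / 8 ≤ dist p.1 p.2} := by
            change τ / 8 ≤ dist p.1 p.2
            linarith
          rw [indicator_of_mem hmem, ENNReal.tsum_mul_right, ENNReal.tsum_mul_left, mul_assoc]
          refine mul_le_mul' le_rfl ((mul_le_mul' ?_ le_rfl).trans (one_mul _).le)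
          exact (ENNReal.tsum_comp_le_tsum_of_injective Subtype.val_injective
            (fun j => partitionE D η j p.2)).trans (hη.tsum_partitionE_le h _)
        · push Not at hj
          simp [hη.partitionE_eq_zero (hj _)]
    _ ≤ ∫⁻ p, partitionE D η i p.1 *
          {p : X × X | τ / 8 ≤ dist p.1 p.2}.indicator (fun p => J p.1 p.2) p ∂(m.prod m) :=
        setLIntegral_le_lintegral _ _
    _ = ∫⁻ x, partitionE D η i x * ∫⁻ y in {y | τ / 8 ≤ dist x y}, J x y ∂m ∂m := by
        have hg : Measurable fun p : X × X => partitionE D η i p.1 *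
            {p : X × X | τ / 8 ≤ dist p.1 p.2}.indicator (fun p => J p.1 p.2) p :=
          ((hη.measurable_partitionE i).comp measurable_fst).mul (h.measurable.indicator hE)
        rw [lintegral_prod _ hg.aemeasurable]
        refine lintegral_congr fun x => ?_
        have hx : MeasurableSet {y | τ / 8 ≤ dist x y} :=
          measurableSet_le measurable_const (measurable_const.dist measurable_id)
        have hgx : Measurable fun y =>
            {p : X × X | τ / 8 ≤ dist p.1 p.2}.indicator (fun p => J p.1 p.2) (x, y) :=
          (h.measurable.indicator hE).comp measurable_prodMk_left
        dsimp only
        rw [lintegral_const_mul _ hgx, ← lintegral_indicator hx]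
        rfl
    _ ≤ ∫⁻ x, partitionE D η i x * (k.tail * κ) ∂m := by
        gcongr with x
        exact lintegral_jump_le_of_outer h hτ hκ hl x
    _ = (∫⁻ x, partitionE D η i x ∂m) * (k.tail * κ) :=
        lintegral_mul_const _ (hη.measurable_partitionE i)
    _ ≤ k.V ^ 2 * W.vol m i * (k.tail * κ) := by
        gcongr
        exact hη.lintegral_partitionE_le h i
    _ = _ := by ring

lemma tsum_nearInteraction_le (h : IsJumpSpace k m J φ) (hτ : 0 < τ)
    (hκ : IsOuterBound φ W B L τ κ) (i : ι) :
    ∑' j : ↥(W.meeting B \ L), W.nearInteraction m φ B i j ≤ k.V ^ 8 * (κ * W.vol m i) := by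
  classical
  obtain ⟨N, hN, hcard⟩ := W.exists_finset_near h i
  calc ∑' j : ↥(W.meeting B \ L), W.nearInteraction m φ B i j
      ≤ ∑' j : ↥(W.meeting B \ L), if (j : ι) ∈ N then κ * W.vol m i else 0 := by
        refine ENNReal.tsum_le_tsum fun j => ?_
        by_cases hij : W.Near i j ∧ i ∈ W.meeting B ∧ (j : ι) ∈ W.meeting B
        · rw [WhitneyCover.nearInteraction, if_pos hij, if_pos ((hN j).2 hij.1), div_eq_mul_inv,
            mul_comm]
          gcongr
          refine le_trans (ENNReal.inv_le_inv.2 (h.scaleE_mono (by positivity) ?_)) (hκ j j.2).2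
          have h1 := hij.1.symm.radius_lt
          have h2 := (hκ j j.2).1
          linarith
        · rw [WhitneyCover.nearInteraction, if_neg hij]; exact zero_le
    _ ≤ ∑' j, if j ∈ N then κ * W.vol m i else 0 :=
        ENNReal.tsum_comp_le_tsum_of_injective Subtype.val_injective
          (fun j => if j ∈ N then κ * W.vol m i else 0)
    _ = N.card * (κ * W.vol m i) := by
        rw [tsum_eq_sum (s := N) fun j hj => if_neg hj, Finset.sum_ite_mem, Finset.inter_self,
          Finset.sum_const, nsmul_eq_mul]
    _ ≤ _ := by gcongr

lemma tsum_interaction_le (hη : IsStrictCutoff m J φ W A η) (h : IsJumpSpace k m J φ)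
    (hB : MeasurableSet B) (hτ : 0 < τ) (hκ : IsOuterBound φ W B L τ κ) (c : ℝ≥0∞) (i : ι) :
    ∑' j : ↥(W.meeting B \ L), W.interaction m J φ η B c i j ≤ k.outer c * (κ * W.vol m i) := by
  simp only [WhitneyCover.interaction]
  rw [ENNReal.tsum_add, ENNReal.tsum_mul_left, Constants.outer, add_mul, mul_assoc c]
  gcongr
  · exact tsum_nearInteraction_le h hτ hκ i
  · exact hη.tsum_farInteraction_le h hB hτ hκ i

lemma interaction_le_symm (h : IsJumpSpace k m J φ) (hB : MeasurableSet B) (c : ℝ≥0∞) (i j : ι) :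
    W.interaction m J φ η B c i j ≤ W.interaction m J φ η B (c * (k.V ^ 5 * k.Q 2)) j i := by
  rw [WhitneyCover.interaction, WhitneyCover.interaction, farInteraction_symm h i j hB,
    mul_assoc c]
  gcongr
  exact nearInteraction_le_symm h i j

/-- The constant in the comparison of the interactions with the jump kernel. -/
def _root_.ReflectedJump.Constants.inner (k : Constants) (c : ℝ≥0∞) : ℝ≥0∞ :=
  c * (k.V ^ 5 * (k.G 7 / ENNReal.ofReal k.J₁)) + k.V ^ 4 * k.H 9

lemma interaction_le (hη : IsStrictCutoff m J φ W A η) (h : IsJumpSpace k m J φ)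
    (hB : MeasurableSet B) (c : ℝ≥0∞) {i j : ι} {z w : X}
    (hz : z ∈ closedBall (W.center i) (9 * W.radius i))
    (hw : w ∈ closedBall (W.center j) (9 * W.radius j)) (hzw : z ≠ w) :
    W.interaction m J φ η B c i j ≤ k.inner c * (W.vol m i * W.vol m j * J z w) := by
  rw [WhitneyCover.interaction, Constants.inner, add_mul, mul_assoc c]
  gcongr
  · exact nearInteraction_le h hz hw hzw
  · exact hη.farInteraction_le h hB hz hw hzw

end IsStrictCutoff

/-! ### Averages -/

/-- The coefficients `a_i`, `i ∈ L`, are averages of `u` with respect to densities `F_i` that are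
supported in `Ω` and near the Whitney ball `B_i`, have mass at least a fixed part of the volume of
`B_i`, and have sum at most one. -/
structure IsAveraging {D : Set X} {ι : Type u} (m : Measure X)
    (W : WhitneyCover (1 / 4) (closure D)ᶜ ι) (A : ℝ≥0∞) (L : Set ι) (Ω : Set X)
    (F : ι → X → ℝ≥0∞) (u : X → ℝ) (a : ι → ℝ) : Prop where
  measurable : ∀ i, Measurable (F i)
  mem_closedBall : ∀ i ∈ L, ∀ z, F i z ≠ 0 → z ∈ closedBall (W.center i) (9 * W.radius i)
  mem : ∀ i ∈ L, ∀ z, F i z ≠ 0 → z ∈ Ω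
  vol_le : ∀ i ∈ L, W.vol m i ≤ A * ∫⁻ z, F i z ∂m
  mass_ne_top : ∀ i ∈ L, ∫⁻ z, F i z ∂m ≠ ∞
  sum_le : ∀ z, ∑' i : L, F i z ≤ 1
  sq_sub_mul_le : ∀ i ∈ L, ∀ c : ℝ, ENNReal.ofReal ((a i - c) ^ 2) * ∫⁻ z, F i z ∂m ≤
    ∫⁻ z, F i z * ENNReal.ofReal ((u z - c) ^ 2) ∂m

namespace IsAveraging

variable {D : Set X} {ι : Type u} {W : WhitneyCover (1 / 4) (closure D)ᶜ ι} {A : ℝ≥0∞}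
  {L : Set ι} {Ω : Set X} {F : ι → X → ℝ≥0∞} {u : X → ℝ} {a : ι → ℝ}

lemma mass_ne_zero (hF : IsAveraging m W A L Ω F u a) {i : ι} (hi : i ∈ L) :
    ∫⁻ z, F i z ∂m ≠ 0 := fun h0 => by
  have := hF.vol_le i hi
  rw [h0, mul_zero, nonpos_iff_eq_zero] at this
  exact W.vol_ne_zero i this

lemma tsum_le_indicator (hF : IsAveraging m W A L Ω F u a) (z : X) :
    ∑' i : L, F i z ≤ Ω.indicator (fun _ => 1) z := by
  by_cases hz : z ∈ Ω
  · rw [indicator_of_mem hz]; exact hF.sum_le z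
  · have : ∀ i : L, F i z = 0 := fun i => by
      by_contra h; exact hz (hF.mem i i.2 z h)
    simp [this]

/-- The mean square deviation of `u` from `c` dominates `(a_i - c)²`, with a weight `T` that is bounded
by the function `j` where the density lives. Points with `u z = c` are excluded, because for `j = J`
nothing is assumed on the diagonal. -/
lemma mul_sq_sub_le (hF : IsAveraging m W A L Ω F u a) (hu : Measurable u) {i : ι} (hi : i ∈ L)
    (c : ℝ) (T C : ℝ≥0∞) {j : X → ℝ≥0∞} (hj : Measurable j)
    (hT : ∀ z ∈ closedBall (W.center i) (9 * W.radius i), u z ≠ c → T ≤ C * (W.vol m i * j z)) :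
    T * ENNReal.ofReal ((a i - c) ^ 2) ≤
      C * A * ∫⁻ z, F i z * (ENNReal.ofReal ((u z - c) ^ 2) * j z) ∂m := by
  have hM0 := hF.mass_ne_zero hi
  have hMt := hF.mass_ne_top i hi
  have hsq : Measurable fun z => ENNReal.ofReal ((u z - c) ^ 2) :=
    ((hu.sub_const c).pow_const 2).ennreal_ofReal
  refine (ENNReal.mul_le_mul_iff_left hM0 hMt).1 ?_
  calc T * ENNReal.ofReal ((a i - c) ^ 2) * ∫⁻ z, F i z ∂m
      ≤ T * ∫⁻ z, F i z * ENNReal.ofReal ((u z - c) ^ 2) ∂m := by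
        rw [mul_assoc]; gcongr; exact hF.sq_sub_mul_le i hi c
    _ = ∫⁻ z, T * (F i z * ENNReal.ofReal ((u z - c) ^ 2)) ∂m :=
        (lintegral_const_mul _ ((hF.measurable i).mul hsq)).symm
    _ ≤ ∫⁻ z, C * W.vol m i * (F i z * (ENNReal.ofReal ((u z - c) ^ 2) * j z)) ∂m := by
        refine lintegral_mono fun z => ?_
        by_cases hz : F i z = 0
        · simp [hz]
        by_cases huz : u z = c
        · simp [huz]
        calc T * (F i z * ENNReal.ofReal ((u z - c) ^ 2))
            ≤ C * (W.vol m i * j z) * (F i z * ENNReal.ofReal ((u z - c) ^ 2)) := by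
              gcongr; exact hT z (hF.mem_closedBall i hi z hz) huz
          _ = _ := by ring
    _ = C * W.vol m i * ∫⁻ z, F i z * (ENNReal.ofReal ((u z - c) ^ 2) * j z) ∂m :=
        lintegral_const_mul _ ((hF.measurable i).mul (hsq.mul hj))
    _ ≤ C * (A * ∫⁻ z, F i z ∂m) * ∫⁻ z, F i z * (ENNReal.ofReal ((u z - c) ^ 2) * j z) ∂m := by
        gcongr; exact hF.vol_le i hi
    _ = _ := by ring

lemma measurable_sq_sub_mul (h : IsJumpSpace k m J φ) (hu : Measurable u) :
    Measurable fun p : X × X => ENNReal.ofReal ((u p.1 - u p.2) ^ 2) * J p.1 p.2 :=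
  ((((hu.comp measurable_fst).sub (hu.comp measurable_snd)).pow_const 2).ennreal_ofReal).mul
    h.measurable

lemma const_mul_lintegral_prod {F G : X → ℝ≥0∞} {g : X × X → ℝ≥0∞} (hF : Measurable F)
    (hG : Measurable G) (hg : Measurable g) (c : ℝ≥0∞) :
    c * ∫⁻ p, F p.1 * G p.2 * g p ∂(m.prod m) =
      ∫⁻ w, G w * (c * ∫⁻ z, F z * g (z, w) ∂m) ∂m := by
  have hprod : Measurable fun p : X × X => F p.1 * G p.2 * g p :=
    ((hF.comp measurable_fst).mul (hG.comp measurable_snd)).mul hg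
  have hprod2 : Measurable fun w => ∫⁻ z, F z * G w * g (z, w) ∂m := hprod.lintegral_prod_left'
  rw [lintegral_prod_symm _ hprod.aemeasurable, ← lintegral_const_mul _ hprod2]
  refine lintegral_congr fun w => ?_
  have h3 : Measurable fun z => F z * g (z, w) := hF.mul (hg.comp measurable_prodMk_right)
  have h4 : ∫⁻ z, F z * G w * g (z, w) ∂m = G w * ∫⁻ z, F z * g (z, w) ∂m := by
    rw [← lintegral_const_mul _ h3]
    exact lintegral_congr fun z => by ring
  rw [h4]; ring

/-- Differences of two averages are controlled by the energy of `u`. -/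
lemma mul_sq_sub_le_energy (hF : IsAveraging m W A L Ω F u a) (h : IsJumpSpace k m J φ)
    (hu : Measurable u) {i j : ι} (hi : i ∈ L) (hj : j ∈ L) (T C : ℝ≥0∞)
    (hT : ∀ z ∈ closedBall (W.center i) (9 * W.radius i),
      ∀ w ∈ closedBall (W.center j) (9 * W.radius j), z ≠ w →
        T ≤ C * (W.vol m i * W.vol m j * J z w)) :
    T * ENNReal.ofReal ((a i - a j) ^ 2) ≤
      C * A ^ 2 * ∫⁻ p, F i p.1 * F j p.2 * (ENNReal.ofReal ((u p.1 - u p.2) ^ 2) * J p.1 p.2)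
        ∂(m.prod m) := by
  have hM0 := hF.mass_ne_zero hj
  have hMt := hF.mass_ne_top j hj
  have hg := measurable_sq_sub_mul (J := J) h hu
  have hsq : ∀ c : ℝ, Measurable fun z => ENNReal.ofReal ((u z - c) ^ 2) := fun c =>
    ((hu.sub_const c).pow_const 2).ennreal_ofReal
  have hJw : ∀ w, Measurable fun z => J z w := fun w => h.measurable.comp measurable_prodMk_right
  have hFsq : ∀ c : ℝ, Measurable fun w => F j w * ENNReal.ofReal ((u w - c) ^ 2) := fun c =>
    (hF.measurable j).mul (hsq c)
  refine (ENNReal.mul_le_mul_iff_left hM0 hMt).1 ?_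
  calc T * ENNReal.ofReal ((a i - a j) ^ 2) * ∫⁻ z, F j z ∂m
      ≤ T * ∫⁻ w, F j w * ENNReal.ofReal ((u w - a i) ^ 2) ∂m := by
        rw [mul_assoc, sub_sq_comm]; gcongr; exact hF.sq_sub_mul_le j hj _
    _ = ∫⁻ w, F j w * (T * ENNReal.ofReal ((a i - u w) ^ 2)) ∂m := by
        rw [← lintegral_const_mul _ (hFsq _)]
        refine lintegral_congr fun w => ?_
        rw [sub_sq_comm (u w)]; ring
    _ ≤ ∫⁻ w, F j w * (C * W.vol m j * A *
          ∫⁻ z, F i z * (ENNReal.ofReal ((u z - u w) ^ 2) * J z w) ∂m) ∂m := by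
        refine lintegral_mono fun w => ?_
        by_cases hw : F j w = 0
        · simp [hw]
        refine mul_le_mul' le_rfl ?_
        refine hF.mul_sq_sub_le hu hi (u w) T (C * W.vol m j)
          (hJw w) fun z hz hzw => ?_
        refine (hT z hz w (hF.mem_closedBall j hj w hw) fun hne => hzw (by rw [hne])).trans
          (le_of_eq ?_)
        ring
    _ = C * W.vol m j * A * ∫⁻ p, F i p.1 * F j p.2 *
          (ENNReal.ofReal ((u p.1 - u p.2) ^ 2) * J p.1 p.2) ∂(m.prod m) :=
        (const_mul_lintegral_prod (hF.measurable i) (hF.measurable j) hg _).symm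
    _ ≤ C * (A * ∫⁻ z, F j z ∂m) * A * ∫⁻ p, F i p.1 * F j p.2 *
          (ENNReal.ofReal ((u p.1 - u p.2) ^ 2) * J p.1 p.2) ∂(m.prod m) := by
        gcongr; exact hF.vol_le j hj
    _ = _ := by ring

lemma tsum_lintegral_prod_le (hF : IsAveraging m W A L Ω F u a) (hΩ : MeasurableSet Ω)
    {g : X × X → ℝ≥0∞} (hg : Measurable g) :
    ∑' i : L, ∑' j : L, ∫⁻ p, F i p.1 * F j p.2 * g p ∂(m.prod m) ≤
      ∫⁻ p in Ω ×ˢ Ω, g p ∂(m.prod m) := by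
  have := W.countable
  have hm : ∀ i j, Measurable fun p : X × X => F i p.1 * F j p.2 * g p := fun i j =>
    (((hF.measurable i).comp measurable_fst).mul ((hF.measurable j).comp measurable_snd)).mul hg
  calc ∑' i : L, ∑' j : L, ∫⁻ p, F i p.1 * F j p.2 * g p ∂(m.prod m)
      = ∫⁻ p, ∑' i : L, ∑' j : L, F i p.1 * F j p.2 * g p ∂(m.prod m) := by
        rw [lintegral_tsum fun i : L => (Measurable.tsum fun j : L => hm i j).aemeasurable]
        refine tsum_congr fun i => ?_
        rw [lintegral_tsum fun j : L => (hm i j).aemeasurable]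
    _ ≤ ∫⁻ p, (Ω ×ˢ Ω).indicator g p ∂(m.prod m) := by
        refine lintegral_mono fun p => ?_
        have e : ∑' i : L, ∑' j : L, F i p.1 * F j p.2 * g p =
            (∑' i : L, F i p.1) * (∑' j : L, F j p.2) * g p := by
          rw [← ENNReal.tsum_mul_right, ← ENNReal.tsum_mul_right]
          refine tsum_congr fun i => ?_
          rw [ENNReal.tsum_mul_right, ENNReal.tsum_mul_left]
        rw [e]
        refine (mul_le_mul' (mul_le_mul' (hF.tsum_le_indicator _) (hF.tsum_le_indicator _))
          le_rfl).trans ?_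
        by_cases h1 : p.1 ∈ Ω <;> by_cases h2 : p.2 ∈ Ω <;>
          simp [indicator, h1, h2]
    _ = _ := lintegral_indicator (hΩ.prod hΩ) _

lemma tsum_lintegral_le (hF : IsAveraging m W A L Ω F u a) (hΩ : MeasurableSet Ω)
    {g : X → ℝ≥0∞} (hg : Measurable g) :
    ∑' i : L, ∫⁻ z, F i z * g z ∂m ≤ ∫⁻ z in Ω, g z ∂m := by
  have := W.countable
  calc ∑' i : L, ∫⁻ z, F i z * g z ∂m = ∫⁻ z, (∑' i : L, F i z) * g z ∂m := by
        have hm : ∀ i : L, Measurable fun z => F i z * g z := fun i => (hF.measurable i).mul hg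
        simp_rw [← ENNReal.tsum_mul_right]
        rw [lintegral_tsum fun i : L => (hm i).aemeasurable]
    _ ≤ ∫⁻ z, Ω.indicator g z ∂m := by
        refine lintegral_mono fun z => ?_
        refine (mul_le_mul' (hF.tsum_le_indicator z) le_rfl).trans ?_
        by_cases h1 : z ∈ Ω <;> simp [indicator, h1]
    _ = _ := lintegral_indicator hΩ _

/-- The squares of the averages are controlled by the `L²` norm of `u`. -/
lemma tsum_sq_mul_vol_le (hF : IsAveraging m W A L Ω F u a) (hΩ : MeasurableSet Ω)
    (hu : Measurable u) :
    ∑' i : L, ENNReal.ofReal (a i ^ 2) * W.vol m i ≤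
      A * ∫⁻ z in Ω, ENNReal.ofReal (u z ^ 2) ∂m := by
  calc ∑' i : L, ENNReal.ofReal (a i ^ 2) * W.vol m i
      ≤ ∑' i : L, A * ∫⁻ z, F i z * ENNReal.ofReal (u z ^ 2) ∂m := by
        refine ENNReal.tsum_le_tsum fun i => ?_
        have h1 := hF.sq_sub_mul_le i i.2 0
        simp only [sub_zero] at h1
        calc _ ≤ ENNReal.ofReal (a i ^ 2) * (A * ∫⁻ z, F i z ∂m) := by
              gcongr; exact hF.vol_le i i.2
          _ = A * (ENNReal.ofReal (a i ^ 2) * ∫⁻ z, F i z ∂m) := by ring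
          _ ≤ _ := by gcongr
    _ ≤ _ := by
        rw [ENNReal.tsum_mul_left]
        gcongr
        exact hF.tsum_lintegral_le hΩ (hu.pow_const 2).ennreal_ofReal

end IsAveraging

/-! ### The energy of the glued function -/

lemma energyOn_prod_swap (hJ : ∀ x y, J x y = J y x) {s t : Set X} (hs : MeasurableSet s)
    (ht : MeasurableSet t) (v : X → ℝ) :
    energyOn m J (s ×ˢ t) v = energyOn m J (t ×ˢ s) v := by
  rw [energyOn, energyOn, ← lintegral_indicator (hs.prod ht), ← lintegral_indicator (ht.prod hs),
    ← lintegral_prod_swap]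
  refine lintegral_congr fun p => ?_
  by_cases hp : p ∈ t ×ˢ s
  · rw [indicator_of_mem hp, indicator_of_mem (show p.swap ∈ s ×ˢ t from ⟨hp.2, hp.1⟩), hJ,
      sub_sq_comm]
    rfl
  · rw [indicator_of_notMem hp,
      indicator_of_notMem (fun hp' : p.swap ∈ s ×ˢ t => hp ⟨hp'.2, hp'.1⟩)]

/-- The constant in the energy estimate for the extension. -/
def Constants.ext (k : Constants) (A₁ A₂ : ℝ≥0∞) : ℝ≥0∞ :=
  (k.inner (k.near A₁) * A₂ ^ 2 + 2 * (k.V ^ 2 * k.H 4 * A₂) + 1) +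
    ((k.outer (k.near A₁) + k.outer (k.near A₁ * (k.V ^ 5 * k.Q 2))) * A₂ + 2 * k.tail)

section

variable {D : Set X} {ι : Type u} {W : WhitneyCover (1 / 4) (closure D)ᶜ ι} {A₁ A₂ : ℝ≥0∞}
  {η : ι → X → ℝ} {B Ω : Set X} {L : Set ι} {τ : ℝ} {κ : ℝ≥0∞} {F : ι → X → ℝ≥0∞} {u : X → ℝ}
  {a : ι → ℝ}

/-- The part of the energy from pairs of points off the closure of `D`. -/
lemma energyOn_glue_off_le (h : IsJumpSpace k m J φ) (hη : IsStrictCutoff m J φ W A₁ η)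
    (hF : IsAveraging m W A₂ L Ω F u a) (hB : MeasurableSet B) (hΩ : MeasurableSet Ω)
    (hu : Measurable u) (hτ : 0 < τ) (hκ : IsOuterBound φ W B L τ κ)
    (ha : ∀ i ∈ W.meeting B \ L, a i = 0) :
    energyOn m J ((B \ closure D) ×ˢ (B \ closure D)) (glue D a η u) ≤
      k.inner (k.near A₁) * A₂ ^ 2 * energyOn m J (Ω ×ˢ Ω) u +
        (k.outer (k.near A₁) + k.outer (k.near A₁ * (k.V ^ 5 * k.Q 2))) * A₂ *
          (κ * ∫⁻ z in Ω, ENNReal.ofReal (u z ^ 2) ∂m) := by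
  refine (hη.energyOn_glue_diff_le h hB a u).trans ?_
  set c := k.near A₁
  set c' := k.near A₁ * (k.V ^ 5 * k.Q 2)
  -- Only indices in `L` or `T` interact, and two indices in `T` have the same coefficient `0`.
  set T := W.meeting B \ L with hT
  set Φ : ι → ι → ℝ≥0∞ := fun i j =>
    ENNReal.ofReal ((a i - a j) ^ 2) * W.interaction m J φ η B c i j with hΦ
  have hΦ0 : ∀ i j, ¬ (i ∈ W.meeting B ∧ j ∈ W.meeting B) → Φ i j = 0 := fun i j hij => by
    simp only [hΦ]; rw [hη.interaction_eq_zero hB c hij, mul_zero]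
  have hout : ∀ i, i ∉ L → i ∉ T → i ∉ W.meeting B := fun i hi hiT him => hiT ⟨him, hi⟩
  have hrow : ∀ i, ∑' j, Φ i j ≤ ∑' j : L, Φ i j + ∑' j : T, Φ i j := fun i =>
    tsum_le_tsum_subtype_add L T _ fun j hj hjT => hΦ0 i j fun hij => hout j hj hjT hij.2
  have hsum : ∑' i, ∑' j, Φ i j ≤ (∑' i : L, ∑' j : L, Φ i j + ∑' i : L, ∑' j : T, Φ i j) +
      ∑' j : L, ∑' i : T, Φ i j := by
    calc ∑' i, ∑' j, Φ i j ≤ ∑' i : L, ∑' j, Φ i j + ∑' i : T, ∑' j, Φ i j :=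
          tsum_le_tsum_subtype_add L T _ fun i hi hiT => by
            simp [hΦ0 i _ fun hij => hout i hi hiT hij.1]
      _ ≤ ∑' i : L, (∑' j : L, Φ i j + ∑' j : T, Φ i j) + ∑' i : T, ∑' j : L, Φ i j := by
          gcongr with i i
          · exact hrow i
          · refine (hrow i).trans (le_of_eq ?_)
            have : ∀ j : T, Φ i j = 0 := fun j => by
              simp only [hΦ]; rw [ha i i.2, ha j j.2]; simp
            simp [this]
      _ = _ := by rw [ENNReal.tsum_add, ENNReal.tsum_comm (α := T)]
  have h1 : ∑' i : L, ∑' j : L, Φ i j ≤ k.inner c * A₂ ^ 2 * energyOn m J (Ω ×ˢ Ω) u := by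
    have hg := IsAveraging.measurable_sq_sub_mul h hu
    calc ∑' i : L, ∑' j : L, Φ i j ≤ ∑' i : L, ∑' j : L, k.inner c * A₂ ^ 2 *
          ∫⁻ p, F i p.1 * F j p.2 * (ENNReal.ofReal ((u p.1 - u p.2) ^ 2) * J p.1 p.2)
            ∂(m.prod m) := by
          gcongr with i j
          rw [hΦ]
          dsimp only
          rw [mul_comm]
          exact hF.mul_sq_sub_le_energy h hu i.2 j.2 _ _ fun z hz w hw hzw =>
            hη.interaction_le h hB c hz hw hzw
      _ = k.inner c * A₂ ^ 2 * ∑' i : L, ∑' j : L,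
          ∫⁻ p, F i p.1 * F j p.2 * (ENNReal.ofReal ((u p.1 - u p.2) ^ 2) * J p.1 p.2)
            ∂(m.prod m) := by
          rw [← ENNReal.tsum_mul_left]
          refine tsum_congr fun i => ?_
          rw [← ENNReal.tsum_mul_left]
      _ ≤ _ := by
          gcongr
          exact hF.tsum_lintegral_prod_le hΩ hg
  have hvol := hF.tsum_sq_mul_vol_le hΩ hu
  have htail : ∀ (Ψ : ι → ι → ℝ≥0∞) (d : ℝ≥0∞),
      (∀ i, ∀ j ∈ T, Ψ i j ≤ ENNReal.ofReal (a i ^ 2) * W.interaction m J φ η B d i j) →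
      ∑' i : L, ∑' j : T, Ψ i j ≤
        k.outer d * A₂ * (κ * ∫⁻ z in Ω, ENNReal.ofReal (u z ^ 2) ∂m) := by
    intro Ψ d hΨ
    calc ∑' i : L, ∑' j : T, Ψ i j
        ≤ ∑' i : L, ENNReal.ofReal (a i ^ 2) * (k.outer d * (κ * W.vol m i)) := by
          refine ENNReal.tsum_le_tsum fun i => ?_
          refine (ENNReal.tsum_le_tsum fun j : T => hΨ i j j.2).trans ?_
          rw [ENNReal.tsum_mul_left]
          gcongr
          exact hη.tsum_interaction_le h hB hτ hκ d i
      _ = k.outer d * κ * ∑' i : L, ENNReal.ofReal (a i ^ 2) * W.vol m i := by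
          rw [← ENNReal.tsum_mul_left]
          exact tsum_congr fun i => by ring
      _ ≤ k.outer d * κ * (A₂ * ∫⁻ z in Ω, ENNReal.ofReal (u z ^ 2) ∂m) := by gcongr
      _ = _ := by ring
  have h2 : ∑' i : L, ∑' j : T, Φ i j ≤
      k.outer c * A₂ * (κ * ∫⁻ z in Ω, ENNReal.ofReal (u z ^ 2) ∂m) :=
    htail Φ c fun i j hj => by simp only [hΦ]; rw [ha j hj, sub_zero]
  have h3 : ∑' j : L, ∑' i : T, Φ i j ≤
      k.outer c' * A₂ * (κ * ∫⁻ z in Ω, ENNReal.ofReal (u z ^ 2) ∂m) :=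
    htail (fun j i => Φ i j) c' fun j i hi => by
      simp only [hΦ]
      rw [ha i hi, zero_sub, neg_sq]
      gcongr
      exact IsStrictCutoff.interaction_le_symm h hB c i j
  calc ∑' i, ∑' j, Φ i j ≤ _ := hsum
    _ ≤ _ := add_le_add (add_le_add h1 h2) h3
    _ = _ := by ring

/-- The points `x` of `3 B_i` are at distance more than `2 r_i` from `y ∈ D`, so `J x y` is comparable
to `J z y`. -/
lemma setLIntegral_partitionE_mul_jump_le (h : IsJumpSpace k m J φ)
    (hη : IsStrictCutoff m J φ W A₁ η) {i : ι} {y z : X} (hy : y ∈ D)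
    (hz : z ∈ closedBall (W.center i) (9 * W.radius i)) (hzy : z ≠ y) :
    ∫⁻ x in B \ closure D, partitionE D η i x * J x y ∂m ≤
      k.V ^ 2 * k.H 4 * (W.vol m i * J z y) := by
  calc ∫⁻ x in B \ closure D, partitionE D η i x * J x y ∂m
      ≤ ∫⁻ x, partitionE D η i x * J x y ∂m := setLIntegral_le_lintegral _ _
    _ ≤ ∫⁻ x, partitionE D η i x * (k.H 4 * J z y) ∂m := by
        refine lintegral_mono fun x => ?_
        by_cases hx : x ∈ W.triple i
        swap
        · simp [hη.partitionE_eq_zero hx]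
        refine mul_le_mul' le_rfl ?_
        have h1 := W.lt_dist_of_mem_triple hx (subset_closure hy)
        have hr := W.radius_pos i
        refine h.jump_le 4 (dist_pos.1 (by linarith)) hzy ?_
        rw [WhitneyCover.triple, mem_ball] at hx
        rw [mem_closedBall'] at hz
        have t1 := dist_triangle x (W.center i) z
        have t2 := dist_triangle_left z y x
        linarith
    _ = (∫⁻ x, partitionE D η i x ∂m) * (k.H 4 * J z y) :=
        lintegral_mul_const _ (hη.measurable_partitionE i)
    _ ≤ k.V ^ 2 * W.vol m i * (k.H 4 * J z y) := by
        gcongr; exact hη.lintegral_partitionE_le h i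
    _ = _ := by ring

/-- The balls that carry no average are at distance at least `τ` from `D`, up to a factor. -/
lemma tsum_setLIntegral_partitionE_mul_jump_le (h : IsJumpSpace k m J φ)
    (hη : IsStrictCutoff m J φ W A₁ η) (hτ : 0 < τ)
    (hκ : IsOuterBound φ W B L τ κ) {y : X} (hy : y ∈ D) :
    ∑' i : ↥(W.meeting B \ L), ∫⁻ x in B \ closure D, partitionE D η i x * J x y ∂m ≤
      k.tail * κ := by
  have := W.countable
  rcases (W.meeting B \ L).eq_empty_or_nonempty with h0 | ⟨l, hl⟩
  · have : IsEmpty ↥(W.meeting B \ L) := isEmpty_coe_sort.2 h0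
    simp
  have hJy : Measurable fun x => J x y := h.measurable.comp measurable_prodMk_right
  have hm : ∀ i, Measurable fun x => partitionE D η i x * J x y := fun i =>
    (hη.measurable_partitionE i).mul hJy
  have hE : MeasurableSet {x | τ / 8 ≤ dist y x} :=
    measurableSet_le measurable_const (measurable_const.dist measurable_id)
  calc ∑' i : ↥(W.meeting B \ L), ∫⁻ x in B \ closure D, partitionE D η i x * J x y ∂m
      ≤ ∑' i : ↥(W.meeting B \ L), ∫⁻ x, partitionE D η i x * J x y ∂m :=
        ENNReal.tsum_le_tsum fun i => setLIntegral_le_lintegral _ _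
    _ = ∫⁻ x, ∑' i : ↥(W.meeting B \ L), partitionE D η i x * J x y ∂m :=
        (lintegral_tsum fun i : ↥(W.meeting B \ L) => (hm i).aemeasurable).symm
    _ ≤ ∫⁻ x, {x | τ / 8 ≤ dist y x}.indicator (fun x => J y x) x ∂m := by
        refine lintegral_mono fun x => ?_
        by_cases hj : ∃ j : ↥(W.meeting B \ L), x ∈ W.triple j
        · obtain ⟨j, hj⟩ := hj
          have h1 := W.lt_dist_of_mem_triple hj (subset_closure hy)
          have h2 := (hκ j j.2).1
          have hmem : x ∈ {x | τ / 8 ≤ dist y x} := by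
            change τ / 8 ≤ dist y x
            rw [dist_comm]
            linarith
          dsimp only
          rw [indicator_of_mem hmem, ENNReal.tsum_mul_right, h.symm x y]
          refine (mul_le_mul' ?_ le_rfl).trans (one_mul _).le
          exact (ENNReal.tsum_comp_le_tsum_of_injective Subtype.val_injective
            (fun j => partitionE D η j x)).trans (hη.tsum_partitionE_le h _)
        · push Not at hj
          simp [hη.partitionE_eq_zero (hj _)]
    _ = ∫⁻ x in {x | τ / 8 ≤ dist y x}, J y x ∂m := lintegral_indicator hE _
    _ ≤ _ := IsStrictCutoff.lintegral_jump_le_of_outer h hτ hκ hl y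

lemma setLIntegral_cross_le (h : IsJumpSpace k m J φ) (hη : IsStrictCutoff m J φ W A₁ η)
    (hF : IsAveraging m W A₂ L Ω F u a) (hB : MeasurableSet B)
    (hΩ : MeasurableSet Ω) (hu : Measurable u) (hτ : 0 < τ)
    (hκ : IsOuterBound φ W B L τ κ) (ha : ∀ i ∈ W.meeting B \ L, a i = 0) {y : X} (hy : y ∈ D) :
    ∫⁻ x in B \ closure D, ∑' i,
      partitionE D η i x * ENNReal.ofReal ((a i - u y) ^ 2) * J x y ∂m ≤
      k.V ^ 2 * k.H 4 * A₂ * ∫⁻ z in Ω, ENNReal.ofReal ((u z - u y) ^ 2) * J z y ∂m +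
        k.tail * κ * ENNReal.ofReal (u y ^ 2) := by
  have := W.countable
  have hBU : MeasurableSet (B \ closure D) := hB.diff isClosed_closure.measurableSet
  have hJy : Measurable fun x => J x y := h.measurable.comp measurable_prodMk_right
  have hm : ∀ i, Measurable fun x => partitionE D η i x * J x y := fun i =>
    (hη.measurable_partitionE i).mul hJy
  have hm' : ∀ i, Measurable fun x =>
      partitionE D η i x * ENNReal.ofReal ((a i - u y) ^ 2) * J x y := fun i =>
    ((hη.measurable_partitionE i).mul_const _).mul hJy
  obtain ⟨I, hI⟩ : ∃ I : ι → ℝ≥0∞, ∀ i,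
      I i = ∫⁻ x in B \ closure D, partitionE D η i x * J x y ∂m := ⟨_, fun _ => rfl⟩
  have e1 : ∫⁻ x in B \ closure D, ∑' i,
      partitionE D η i x * ENNReal.ofReal ((a i - u y) ^ 2) * J x y ∂m =
      ∑' i, I i * ENNReal.ofReal ((a i - u y) ^ 2) := by
    rw [lintegral_tsum fun i => (hm' i).aemeasurable]
    refine tsum_congr fun i => ?_
    rw [hI, ← lintegral_mul_const _ (hm i)]
    exact lintegral_congr fun x => by ring
  rw [e1]
  have hI0 : ∀ i, i ∉ L → i ∉ W.meeting B \ L →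
      I i * ENNReal.ofReal ((a i - u y) ^ 2) = 0 := by
    intro i hiL hiT
    have : I i = 0 := by
      rw [hI]
      refine (setLIntegral_congr_fun (g := fun _ => 0) hBU fun x hx => ?_).trans (by simp)
      by_contra hne
      refine hiT ⟨⟨x, hη.mem_triple_of_partitionE_ne_zero fun h0 => hne ?_, hx.1⟩, hiL⟩
      simp [h0]
    rw [this, zero_mul]
  refine (tsum_le_tsum_subtype_add L (W.meeting B \ L) _ hI0).trans (add_le_add ?_ ?_)
  · have hgy : Measurable fun z => ENNReal.ofReal ((u z - u y) ^ 2) * J z y :=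
      ((hu.sub_const _).pow_const 2).ennreal_ofReal.mul hJy
    have hterm : ∀ i : L, I i * ENNReal.ofReal ((a i - u y) ^ 2) ≤ k.V ^ 2 * k.H 4 * A₂ *
        ∫⁻ z, F i z * (ENNReal.ofReal ((u z - u y) ^ 2) * J z y) ∂m := fun i => by
      refine hF.mul_sq_sub_le hu i.2 (u y) (I i) (k.V ^ 2 * k.H 4) hJy fun z hz huz => ?_
      rw [hI]
      exact setLIntegral_partitionE_mul_jump_le h hη hy hz fun hzy => huz (by rw [hzy])
    refine (ENNReal.tsum_le_tsum hterm).trans ?_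
    rw [ENNReal.tsum_mul_left]
    exact mul_le_mul' le_rfl (hF.tsum_lintegral_le hΩ hgy)
  · calc ∑' i : ↥(W.meeting B \ L), I i * ENNReal.ofReal ((a i - u y) ^ 2)
        = (∑' i : ↥(W.meeting B \ L), I i) * ENNReal.ofReal (u y ^ 2) := by
          rw [← ENNReal.tsum_mul_right]
          refine tsum_congr fun i => ?_
          rw [ha i i.2, zero_sub, neg_sq]
      _ ≤ _ := by
          simp_rw [hI]
          exact mul_le_mul' (tsum_setLIntegral_partitionE_mul_jump_le h hη hτ hκ hy) le_rfl

/-- The part of the energy from pairs of a point off the closure of `D` and a point of `D`. -/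
lemma energyOn_glue_cross_le (h : IsJumpSpace k m J φ) (hη : IsStrictCutoff m J φ W A₁ η)
    (hF : IsAveraging m W A₂ L Ω F u a) (hD : IsOpen D) (hB : MeasurableSet B)
    (hΩ : MeasurableSet Ω) (hBΩ : B ∩ D ⊆ Ω) (hu : Measurable u) (hτ : 0 < τ)
    (hκ : IsOuterBound φ W B L τ κ) (ha : ∀ i ∈ W.meeting B \ L, a i = 0) :
    energyOn m J ((B \ closure D) ×ˢ (B ∩ D)) (glue D a η u) ≤
      k.V ^ 2 * k.H 4 * A₂ * energyOn m J (Ω ×ˢ Ω) u +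
        k.tail * (κ * ∫⁻ z in Ω, ENNReal.ofReal (u z ^ 2) ∂m) := by
  have := W.countable
  have hBU : MeasurableSet (B \ closure D) := hB.diff isClosed_closure.measurableSet
  have hBD : MeasurableSet (B ∩ D) := hB.inter hD.measurableSet
  have hg := IsAveraging.measurable_sq_sub_mul h hu
  have hsq : ∀ i, Measurable fun y => ENNReal.ofReal ((a i - u y) ^ 2) := fun i =>
    ((measurable_const.sub hu).pow_const 2).ennreal_ofReal
  have hterm : ∀ i, Measurable fun p : X × X =>
      partitionE D η i p.1 * ENNReal.ofReal ((a i - u p.2) ^ 2) * J p.1 p.2 := fun i =>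
    (((hη.measurable_partitionE i).comp measurable_fst).mul
      ((hsq i).comp measurable_snd)).mul h.measurable
  have hinner : ∀ y ∈ B ∩ D, ∫⁻ x in B \ closure D, ∑' i,
      partitionE D η i x * ENNReal.ofReal ((a i - u y) ^ 2) * J x y ∂m ≤
      k.V ^ 2 * k.H 4 * A₂ * ∫⁻ z in Ω, ENNReal.ofReal ((u z - u y) ^ 2) * J z y ∂m +
        k.tail * κ * ENNReal.ofReal (u y ^ 2) := fun y hy =>
    setLIntegral_cross_le h hη hF hB hΩ hu hτ hκ ha hy.2
  have hgM : Measurable fun y => ∫⁻ z in Ω, ENNReal.ofReal ((u z - u y) ^ 2) * J z y ∂m :=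
    hg.lintegral_prod_left'
  have hu2 : Measurable fun z => ENNReal.ofReal (u z ^ 2) := (hu.pow_const 2).ennreal_ofReal
  calc energyOn m J ((B \ closure D) ×ˢ (B ∩ D)) (glue D a η u)
      ≤ ∫⁻ p in (B \ closure D) ×ˢ (B ∩ D), ∑' i,
          partitionE D η i p.1 * ENNReal.ofReal ((a i - u p.2) ^ 2) * J p.1 p.2 ∂(m.prod m) := by
        refine setLIntegral_mono' (hBU.prod hBD) fun p hp => ?_
        rw [ENNReal.tsum_mul_right]
        gcongr
        have : glue D a η u p.2 = u p.2 := if_pos (subset_closure hp.2.2)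
        rw [this]
        exact hη.ofReal_glue_sub_sq_le h a u hp.1.2 _
    _ = ∫⁻ y in B ∩ D, ∫⁻ x in B \ closure D, ∑' i,
          partitionE D η i x * ENNReal.ofReal ((a i - u y) ^ 2) * J x y ∂m ∂m := by
        rw [← Measure.prod_restrict, lintegral_prod_symm _ (Measurable.tsum hterm).aemeasurable]
    _ ≤ ∫⁻ y in B ∩ D, (k.V ^ 2 * k.H 4 * A₂ *
          ∫⁻ z in Ω, ENNReal.ofReal ((u z - u y) ^ 2) * J z y ∂m +
          k.tail * κ * ENNReal.ofReal (u y ^ 2)) ∂m := setLIntegral_mono' hBD hinner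
    _ ≤ ∫⁻ y in Ω, (k.V ^ 2 * k.H 4 * A₂ *
          ∫⁻ z in Ω, ENNReal.ofReal ((u z - u y) ^ 2) * J z y ∂m +
          k.tail * κ * ENNReal.ofReal (u y ^ 2)) ∂m := lintegral_mono_set hBΩ
    _ = k.V ^ 2 * k.H 4 * A₂ * ∫⁻ y in Ω, ∫⁻ z in Ω,
          ENNReal.ofReal ((u z - u y) ^ 2) * J z y ∂m ∂m +
          k.tail * κ * ∫⁻ y in Ω, ENNReal.ofReal (u y ^ 2) ∂m := by
        rw [lintegral_add_left (hgM.const_mul _), lintegral_const_mul _ hgM,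
          lintegral_const_mul _ hu2]
    _ = _ := by
        rw [energyOn, ← Measure.prod_restrict, lintegral_prod_symm _ hg.aemeasurable,
          mul_assoc k.tail]

/-- The energy of the glued function on `B` is controlled by the energy of `u` on `Ω`, and by its
`L²` norm if some Whitney balls that meet `B` carry no average. -/
theorem energyOn_glue_le (h : IsJumpSpace k m J φ) (hη : IsStrictCutoff m J φ W A₁ η)
    (hF : IsAveraging m W A₂ L Ω F u a) (hD : IsOpen D) (hD0 : m (closure D \ D) = 0)
    (hB : MeasurableSet B) (hΩ : MeasurableSet Ω) (hBΩ : B ∩ D ⊆ Ω) (hu : Measurable u)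
    (hτ : 0 < τ) (hκ : IsOuterBound φ W B L τ κ) (ha : ∀ i ∈ W.meeting B \ L, a i = 0) :
    energyOn m J (B ×ˢ B) (glue D a η u) ≤ k.ext A₁ A₂ *
      (energyOn m J (Ω ×ˢ Ω) u + κ * ∫⁻ z in Ω, ENNReal.ofReal (u z ^ 2) ∂m) := by
  set w := glue D a η u with hw
  set E := energyOn m J (Ω ×ˢ Ω) u
  set M := κ * ∫⁻ z in Ω, ENNReal.ofReal (u z ^ 2) ∂m
  have hBU : MeasurableSet (B \ closure D) := hB.diff isClosed_closure.measurableSet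
  have hBD : MeasurableSet (B ∩ D) := hB.inter hD.measurableSet
  have hsub : B ×ˢ B ⊆ (((B \ closure D) ×ˢ (B \ closure D) ∪ (B \ closure D) ×ˢ (B ∩ D)) ∪
      ((B ∩ D) ×ˢ (B \ closure D) ∪ (B ∩ D) ×ˢ (B ∩ D))) ∪
      ((closure D \ D) ×ˢ univ ∪ univ ×ˢ (closure D \ D)) := by
    have hcase : ∀ z ∈ B, z ∈ B \ closure D ∨ z ∈ B ∩ D ∨ z ∈ closure D \ D := fun z hz => by
      by_cases h1 : z ∈ closure D
      · by_cases h2 : z ∈ D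
        · exact Or.inr (Or.inl ⟨hz, h2⟩)
        · exact Or.inr (Or.inr ⟨h1, h2⟩)
      · exact Or.inl ⟨hz, h1⟩
    rintro ⟨x, y⟩ ⟨hx, hy⟩
    rcases hcase x hx with h1 | h1 | h1
    · rcases hcase y hy with h2 | h2 | h2
      · exact Or.inl (Or.inl (Or.inl ⟨h1, h2⟩))
      · exact Or.inl (Or.inl (Or.inr ⟨h1, h2⟩))
      · exact Or.inr (Or.inr ⟨mem_univ _, h2⟩)
    · rcases hcase y hy with h2 | h2 | h2
      · exact Or.inl (Or.inr (Or.inl ⟨h1, h2⟩))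
      · exact Or.inl (Or.inr (Or.inr ⟨h1, h2⟩))
      · exact Or.inr (Or.inr ⟨mem_univ _, h2⟩)
    · exact Or.inr (Or.inl ⟨h1, mem_univ _⟩)
  have hnull : energyOn m J ((closure D \ D) ×ˢ univ ∪ univ ×ˢ (closure D \ D)) w = 0 := by
    refine setLIntegral_measure_zero _ _ (measure_union_null ?_ ?_)
    · rw [Measure.prod_prod, hD0, zero_mul]
    · rw [Measure.prod_prod, hD0, mul_zero]
  have hUU := energyOn_glue_off_le h hη hF hB hΩ hu hτ hκ ha
  have hUD := energyOn_glue_cross_le h hη hF hD hB hΩ hBΩ hu hτ hκ ha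
  have hDU : energyOn m J ((B ∩ D) ×ˢ (B \ closure D)) w ≤ _ :=
    (energyOn_prod_swap h.symm hBD hBU w).le.trans hUD
  have hDD : energyOn m J ((B ∩ D) ×ˢ (B ∩ D)) w ≤ E := by
    calc energyOn m J ((B ∩ D) ×ˢ (B ∩ D)) w = energyOn m J ((B ∩ D) ×ˢ (B ∩ D)) u := by
          refine setLIntegral_congr_fun (hBD.prod hBD) fun p hp => ?_
          have h1 : w p.1 = u p.1 := if_pos (subset_closure hp.1.2)
          have h2 : w p.2 = u p.2 := if_pos (subset_closure hp.2.2)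
          simp only [h1, h2]
      _ ≤ E := lintegral_mono_set (prod_mono hBΩ hBΩ)
  have hunion : ∀ s t : Set (X × X), energyOn m J (s ∪ t) w ≤ energyOn m J s w + energyOn m J t w :=
    fun s t => lintegral_union_le _ _ _
  calc energyOn m J (B ×ˢ B) w ≤ _ := lintegral_mono_set hsub
    _ ≤ _ := hunion _ _
    _ ≤ _ := add_le_add ((hunion _ _).trans (add_le_add ((hunion _ _).trans
        (add_le_add hUU hUD)) ((hunion _ _).trans (add_le_add hDU hDD)))) hnull.le
    _ = (k.inner (k.near A₁) * A₂ ^ 2 + 2 * (k.V ^ 2 * k.H 4 * A₂) + 1) * E +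
        ((k.outer (k.near A₁) + k.outer (k.near A₁ * (k.V ^ 5 * k.Q 2))) * A₂ + 2 * k.tail) * M := by
        ring
    _ ≤ k.ext A₁ A₂ * E + k.ext A₁ A₂ * M := by
        rw [Constants.ext]
        exact add_le_add (mul_le_mul' le_self_add le_rfl) (mul_le_mul' le_add_self le_rfl)
    _ = _ := (mul_add _ _ _).symm

/-- The `L²` norm of the glued function. -/
theorem lintegral_glue_sq_le (h : IsJumpSpace k m J φ) (hη : IsStrictCutoff m J φ W A₁ η)
    (hF : IsAveraging m W A₂ L D F u a) (hD : IsOpen D) (hD0 : m (closure D \ D) = 0)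
    (hu : Measurable u) (ha : ∀ i ∉ L, a i = 0) :
    ∫⁻ x, ENNReal.ofReal (glue D a η u x ^ 2) ∂m ≤
      (1 + k.V ^ 2 * A₂) * ∫⁻ z in D, ENNReal.ofReal (u z ^ 2) ∂m := by
  have := W.countable
  set w := glue D a η u with hw
  set M := ∫⁻ z in D, ENNReal.ofReal (u z ^ 2) ∂m
  have hsub : (univ : Set X) ⊆ (D ∪ (closure D)ᶜ) ∪ (closure D \ D) := fun x _ => by
    simp only [mem_union, Set.mem_sdiff, mem_compl_iff]; tauto
  have h1 : ∫⁻ x in D, ENNReal.ofReal (w x ^ 2) ∂m = M := by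
    refine setLIntegral_congr_fun hD.measurableSet fun x hx => ?_
    have h1 : w x = u x := if_pos (subset_closure hx)
    simp only [h1]
  have h2 : ∫⁻ x in (closure D)ᶜ, ENNReal.ofReal (w x ^ 2) ∂m ≤ k.V ^ 2 * (A₂ * M) := by
    calc ∫⁻ x in (closure D)ᶜ, ENNReal.ofReal (w x ^ 2) ∂m
        ≤ ∫⁻ x in (closure D)ᶜ, ∑' i, partitionE D η i x * ENNReal.ofReal (a i ^ 2) ∂m := by
          refine setLIntegral_mono' isClosed_closure.measurableSet.compl fun x hx => ?_
          have := hη.ofReal_glue_sub_sq_le h a u hx 0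
          simpa only [sub_zero] using this
      _ ≤ ∫⁻ x, ∑' i, partitionE D η i x * ENNReal.ofReal (a i ^ 2) ∂m :=
          setLIntegral_le_lintegral _ _
      _ = ∑' i, (∫⁻ x, partitionE D η i x ∂m) * ENNReal.ofReal (a i ^ 2) := by
          rw [lintegral_tsum fun i => ((hη.measurable_partitionE i).mul_const _).aemeasurable]
          exact tsum_congr fun i => lintegral_mul_const _ (hη.measurable_partitionE i)
      _ ≤ ∑' i : L, (∫⁻ x, partitionE D η i x ∂m) * ENNReal.ofReal (a i ^ 2) +
          ∑' i : (∅ : Set ι), (∫⁻ x, partitionE D η i x ∂m) * ENNReal.ofReal (a i ^ 2) :=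
          tsum_le_tsum_subtype_add L ∅ _ fun i hi _ => by simp [ha i hi]
      _ ≤ ∑' i : L, k.V ^ 2 * (ENNReal.ofReal (a i ^ 2) * W.vol m i) := by
          rw [tsum_empty (β := (∅ : Set ι)), add_zero]
          refine ENNReal.tsum_le_tsum fun i => ?_
          calc _ ≤ (k.V ^ 2 * W.vol m i) * ENNReal.ofReal (a i ^ 2) := by
                gcongr; exact hη.lintegral_partitionE_le h i
            _ = _ := by ring
      _ ≤ _ := by
          rw [ENNReal.tsum_mul_left]
          gcongr
          exact hF.tsum_sq_mul_vol_le hD.measurableSet hu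
  calc ∫⁻ x, ENNReal.ofReal (w x ^ 2) ∂m = ∫⁻ x in univ, ENNReal.ofReal (w x ^ 2) ∂m := by
        rw [Measure.restrict_univ]
    _ ≤ ∫⁻ x in (D ∪ (closure D)ᶜ) ∪ (closure D \ D), ENNReal.ofReal (w x ^ 2) ∂m :=
        lintegral_mono_set hsub
    _ ≤ (∫⁻ x in D, ENNReal.ofReal (w x ^ 2) ∂m +
        ∫⁻ x in (closure D)ᶜ, ENNReal.ofReal (w x ^ 2) ∂m) +
          ∫⁻ x in closure D \ D, ENNReal.ofReal (w x ^ 2) ∂m :=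
        (lintegral_union_le _ _ _).trans (add_le_add (lintegral_union_le _ _ _) le_rfl)
    _ ≤ (M + k.V ^ 2 * (A₂ * M)) + 0 := by
        refine add_le_add (add_le_add h1.le h2) ?_
        rw [setLIntegral_measure_zero _ _ hD0]
    _ = _ := by ring

lemma measurable_glue (hη : IsStrictCutoff m J φ W A₁ η)
    (hu : Measurable u) (a : ι → ℝ) : Measurable (glue D a η u) := by
  have := W.countable
  unfold glue
  refine Measurable.ite isClosed_closure.measurableSet hu ?_
  exact Measurable.tsum fun i => (hη.measurable_partitionFn i).const_mul (a i)

end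

/-! ### The boundary is a null set -/

lemma IsJumpSpace.isUnifLocDoublingMeasure (h : IsJumpSpace k m J φ) :
    IsUnifLocDoublingMeasure m := by
  refine ⟨⟨(k.V ^ 2).toNNReal, ?_⟩⟩
  filter_upwards [self_mem_nhdsWithin] with ε hε x
  rw [ENNReal.coe_toNNReal (ENNReal.pow_ne_top k.V_ne_top)]
  have hε : 0 < ε := hε
  calc m (closedBall x (2 * ε)) ≤ m (ball x (4 * ε)) :=
        measure_mono (closedBall_subset_ball (by linarith))
    _ ≤ k.V ^ 2 * m (ball x ε) := h.measure_ball_le 2 hε (by rw [dist_self]; linarith)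
    _ ≤ _ := by gcongr; exact ball_subset_closedBall

/-- By Ahlfors regularity no boundary point is a point of density of the boundary. -/
theorem measure_closure_diff_eq_zero (h : IsJumpSpace k m J φ) {D : Set X} {cD : ℝ} (hDo : IsOpen D)
    (hcD : 0 < cD) (hreg : AhlforsRegular m D cD) : m (closure D \ D) = 0 := by
  by_cases hdiam : ediam D = 0
  · have : D.Subsingleton := ediam_eq_zero_iff.1 hdiam
    rw [this.isClosed.closure_eq, Set.sdiff_self, measure_empty]
  have := h.isUnifLocDoublingMeasure
  obtain ⟨c, hc0, hc⟩ : ∃ c : ℝ≥0∞, 0 < c ∧ c * k.V ^ 2 = ENNReal.ofReal cD := by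
    have hV0 : k.V ^ 2 ≠ 0 := pow_ne_zero 2 (zero_lt_one.trans_le k.one_le_V).ne'
    have hVt : k.V ^ 2 ≠ ∞ := ENNReal.pow_ne_top k.V_ne_top
    exact ⟨ENNReal.ofReal cD / k.V ^ 2,
      ENNReal.div_pos (ENNReal.ofReal_pos.2 hcD).ne' hVt, ENNReal.div_mul_cancel hV0 hVt⟩
  have hsmall : ∀ᶠ δ : ℝ in 𝓝[>] 0, ENNReal.ofReal (δ / 2) < ediam D / 2 := by
    have h1 : Tendsto (fun δ : ℝ => ENNReal.ofReal (δ / 2)) (𝓝[>] 0) (𝓝 (ENNReal.ofReal (0 / 2))) :=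
      (ENNReal.continuous_ofReal.comp (continuous_id.div_const 2)).continuousAt.tendsto.mono_left
        nhdsWithin_le_nhds
    rw [zero_div, ENNReal.ofReal_zero] at h1
    exact h1.eventually_lt_const (ENNReal.div_pos hdiam (by simp))
  have hae : ∀ᵐ x ∂m.restrict (closure D \ D), False := by
    have hmem : ∀ᵐ x ∂m.restrict (closure D \ D), x ∈ closure D \ D :=
      ae_restrict_mem (isClosed_closure.measurableSet.diff hDo.measurableSet)
    filter_upwards [hmem, IsUnifLocDoublingMeasure.ae_tendsto_measure_inter_div m (closure D \ D) 1]
      with x hx hdens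
    have hlim := hdens (l := 𝓝[>] (0 : ℝ)) (fun _ => x) id tendsto_id (by
      filter_upwards [self_mem_nhdsWithin] with δ hδ
      simpa using le_of_lt hδ)
    have hlim2 := hlim.add_const c
    have hle : (1 : ℝ≥0∞) + c ≤ 1 := by
      refine le_of_tendsto hlim2 ?_
      filter_upwards [self_mem_nhdsWithin, hsmall] with δ hδ hδs
      have hδ : 0 < δ := hδ
      obtain ⟨y, hyD, hxy⟩ := Metric.mem_closure_iff.1 hx.1 (δ / 2) (by positivity)
      have hb0 : m (closedBall x δ) ≠ 0 :=
        ((measure_ball_pos m x hδ).trans_le (measure_mono ball_subset_closedBall)).ne'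
      have hbt : m (closedBall x δ) ≠ ∞ := ne_top_of_le_ne_top (h.measure_ball_ne_top x (2 * δ))
        (measure_mono (closedBall_subset_ball (by linarith)))
      have h1 : c * m (closedBall x δ) ≤ m (ball y (δ / 2) ∩ D) := by
        calc c * m (closedBall x δ) ≤ c * m (ball x (3 / 2 * δ)) := by
              gcongr; exact closedBall_subset_ball (by linarith)
          _ ≤ c * (k.V ^ 2 * m (ball y (δ / 2))) := by
              gcongr
              exact h.measure_ball_le 2 (by positivity) (by rw [dist_comm]; linarith)
          _ = ENNReal.ofReal cD * m (ball y (δ / 2)) := by rw [← mul_assoc, hc]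
          _ ≤ _ := hreg y hyD _ (by positivity) hδs
      have h2 : m ((closure D \ D) ∩ closedBall x δ) + m (ball y (δ / 2) ∩ D) ≤
          m (closedBall x δ) := by
        rw [← measure_union _ (measurableSet_ball.inter hDo.measurableSet)]
        · refine measure_mono (union_subset inter_subset_right fun z hz => ?_)
          have := mem_ball'.1 hz.1
          rw [mem_closedBall']
          linarith [dist_triangle x y z]
        · exact disjoint_left.2 fun z hz hz' => hz.1.2 hz'.2
      calc m ((closure D \ D) ∩ closedBall x δ) / m (closedBall x δ) + c
          = (m ((closure D \ D) ∩ closedBall x δ) + c * m (closedBall x δ)) /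
              m (closedBall x δ) := by
            rw [ENNReal.add_div, mul_div_assoc, ENNReal.div_self hb0 hbt, mul_one]
        _ ≤ m (closedBall x δ) / m (closedBall x δ) := by
            gcongr; exact (add_le_add le_rfl h1).trans h2
        _ = 1 := ENNReal.div_self hb0 hbt
    exact absurd hle (ENNReal.lt_add_right ENNReal.one_ne_top hc0.ne').not_ge
  have h0 : m.restrict (closure D \ D) = 0 := by
    rw [← Measure.measure_univ_eq_zero]
    simpa [ae_iff] using hae
  exact Measure.restrict_eq_zero.1 h0

/-! ### Passage to strict representatives -/

lemma energyOn_congr_ae {s : Set X} {v w : X → ℝ} (hvw : v =ᵐ[m.restrict s] w) :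
    energyOn m J (s ×ˢ s) v = energyOn m J (s ×ˢ s) w := by
  rw [energyOn, energyOn, ← Measure.prod_restrict]
  refine lintegral_congr_ae ?_
  filter_upwards [Measure.quasiMeasurePreserving_fst.ae_eq_comp hvw,
    Measure.quasiMeasurePreserving_snd.ae_eq_comp hvw] with p h1 h2
  simp only [Function.comp_apply] at h1 h2
  rw [h1, h2]

lemma energyOn_univ_congr_ae {v w : X → ℝ} (hvw : v =ᵐ[m] w) :
    energyOn m J univ v = energyOn m J univ w := by
  rw [← univ_prod_univ]
  exact energyOn_congr_ae (by rwa [Measure.restrict_univ])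

/-- The mean square deviation from `c` is at least the squared deviation of the mean. -/
lemma ofReal_sq_mean_sub_mul_le {μ : Measure X} {f v : X → ℝ} (hf : Integrable f μ)
    (hfv : Integrable (fun x => f x * v x) μ) (hf0 : 0 ≤ᵐ[μ] f) (hM : ∫ x, f x ∂μ ≠ 0) (c : ℝ) :
    ENNReal.ofReal (((∫ x, f x * v x ∂μ) / (∫ x, f x ∂μ) - c) ^ 2) *
        ∫⁻ x, ENNReal.ofReal (f x) ∂μ ≤
      ∫⁻ x, ENNReal.ofReal (f x) * ENNReal.ofReal ((v x - c) ^ 2) ∂μ := by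
  set M := ∫ x, f x ∂μ
  set a := (∫ x, f x * v x ∂μ) / M with ha
  -- `(v - c)²` lies above its tangent at the mean `a`, and the tangent is integrable.
  set g : X → ℝ := fun x => ((a - c) ^ 2 - 2 * (a - c) * a) * f x + 2 * (a - c) * (f x * v x)
    with hg
  have hgi : Integrable g μ := (hf.const_mul _).add (hfv.const_mul _)
  have hgint : ∫ x, g x ∂μ = (a - c) ^ 2 * M := by
    have h1 : ∫ x, f x * v x ∂μ = a * M := (div_mul_cancel₀ _ hM).symm
    rw [hg, integral_add (hf.const_mul _) (hfv.const_mul _), integral_const_mul,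
      integral_const_mul, h1]
    ring
  calc ENNReal.ofReal ((a - c) ^ 2) * ∫⁻ x, ENNReal.ofReal (f x) ∂μ
      = ENNReal.ofReal (∫ x, g x ∂μ) := by
        rw [hgint, ENNReal.ofReal_mul (sq_nonneg _), ofReal_integral_eq_lintegral_ofReal hf hf0]
    _ ≤ ENNReal.ofReal (∫ x, max (g x) 0 ∂μ) :=
        ENNReal.ofReal_le_ofReal (integral_mono hgi hgi.pos_part fun x => le_max_left _ _)
    _ = ∫⁻ x, ENNReal.ofReal (max (g x) 0) ∂μ :=
        ofReal_integral_eq_lintegral_ofReal hgi.pos_part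
          (Eventually.of_forall fun x => le_max_right _ _)
    _ ≤ _ := by
        refine lintegral_mono_ae ?_
        filter_upwards [hf0] with x hx
        rw [← ENNReal.ofReal_mul hx]
        refine ENNReal.ofReal_le_ofReal (max_le ?_ (mul_nonneg hx (sq_nonneg _)))
        have : f x * (v x - c) ^ 2 - g x = f x * (v x - a) ^ 2 := by simp only [hg]; ring
        have h2 : 0 ≤ f x * (v x - a) ^ 2 := mul_nonneg hx (sq_nonneg _)
        linarith

section

variable {D : Set X} {ι : Type u} {W : WhitneyCover (1 / 4) (closure D)ᶜ ι} {A : ℝ}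

/-- Every family of cut-offs agrees almost everywhere with a strict one. -/
lemma exists_isStrictCutoff {η : ι → X → ℝ} (hη : IsCutoffFamily m J φ W A η) :
    ∃ η' : ι → X → ℝ, IsStrictCutoff m J φ W (2 * ENNReal.ofReal A) η' ∧
      ∀ i, η i =ᵐ[m] η' i := by
  classical
  choose g hgm hg using fun i => (hη.memF i).1.1.aemeasurable
  set η' : ι → X → ℝ := fun i x =>
    if x ∈ ball (W.center i) (5 / 2 * W.radius i) then 1
    else if x ∈ W.triple i then min (max (g i x) 0) 1 else 0 with hη'
  have hae : ∀ i, η i =ᵐ[m] η' i := fun i => by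
    filter_upwards [hg i, hη.mem_Icc i, hη.eq_one i, hη.eq_zero i] with x h1 h2 h3 h4
    simp only [hη']
    split_ifs with hx hx'
    · exact h3 hx
    · rw [← h1, max_eq_left h2.1, min_eq_left h2.2]
    · exact h4 hx'
  refine ⟨η', ⟨fun i => ?_, fun i x => ?_, fun i x hx => if_pos hx, fun i x hx => ?_, fun i => ?_⟩,
    hae⟩
  · exact Measurable.ite measurableSet_ball measurable_const
      (Measurable.ite (W.measurableSet_triple i)
        (((hgm i).max measurable_const).min measurable_const) measurable_const)
  · simp only [hη']
    split_ifs
    · simp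
    · exact ⟨le_min (le_max_right _ _) zero_le_one, min_le_right _ _⟩
    · simp
  · simp only [hη']
    rw [if_neg fun h => hx (W.ball_subset_triple i h), if_neg hx]
  · rw [← energyOn_univ_congr_ae (hae i)]
    have h1 := hη.energy i
    rw [form, mul_div_assoc] at h1
    calc energyOn m J univ (η i) = 2 * (2⁻¹ * energyOn m J univ (η i)) := by
          rw [← mul_assoc, ENNReal.mul_inv_cancel two_ne_zero ENNReal.ofNat_ne_top, one_mul]
      _ ≤ 2 * (ENNReal.ofReal A * (m (ball (W.center i) (W.radius i)) /
            ENNReal.ofReal (φ (W.radius i)))) := by gcongr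
      _ = _ := by rw [scaleE]; ring

lemma ae_mem_closedBall (f : ι → X → ℝ) (hf : IsWeightFamily m D W A f) {i : ι}
    (hi : i ∈ W.small D) :
    ∀ᵐ x ∂m, x ∉ closedBall (W.center i) (9 * W.radius i) → f i x = 0 := by
  filter_upwards [ae_eq_zero_of_notMem_essSupp (m := m) (f i)] with x hx hxb
  refine hx fun hxs => hxb ?_
  have hr := W.radius_pos i
  have h1 := (edist_le_infEDist_add_ediam (x := W.center i) hxs).trans
    (add_le_add (hf.dist_supp i hi) (hf.diam_supp i hi))
  rw [← ENNReal.ofReal_add (by positivity) (by positivity), edist_dist,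
    ENNReal.ofReal_le_ofReal_iff (by positivity)] at h1
  rw [mem_closedBall']
  linarith

/-- Densities that agree almost everywhere with the weights and have the properties of the
weights everywhere. -/
lemma exists_strict_weights (hD : IsOpen D) {f : ι → X → ℝ} (hf : IsWeightFamily m D W A f) :
    ∃ F : ι → X → ℝ≥0∞, (∀ i, Measurable (F i)) ∧
      (∀ i z, F i z ≠ 0 → z ∈ D ∧ z ∈ closedBall (W.center i) (9 * W.radius i)) ∧
      (∀ z, ∑' i : W.small D, F i z ≤ 1) ∧
      ∀ i ∈ W.small D, (fun x => ENNReal.ofReal (f i x)) =ᵐ[m] F i := by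
  classical
  have := W.countable
  choose g hgm hg using fun i : W.small D => (hf.memLp i i.2).1.aemeasurable
  have hgood : ∀ᵐ x ∂m, (∀ i : W.small D, f i x = g i x) ∧
      ∑' i : W.small D, ENNReal.ofReal (f i x) ≤ D.indicator (fun _ => 1) x :=
    (ae_all_iff.2 hg).and hf.sum_le
  obtain ⟨N, hNsub, hNm, hN0⟩ := exists_measurable_superset_of_null (ae_iff.1 hgood)
  set G : Set X := Nᶜ with hG
  have hGm : MeasurableSet G := hNm.compl
  have hGgood : ∀ x ∈ G, (∀ i : W.small D, f i x = g i x) ∧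
      ∑' i : W.small D, ENNReal.ofReal (f i x) ≤ D.indicator (fun _ => 1) x := fun x hx => by
    by_contra hcon; exact hx (hNsub hcon)
  have hGae : ∀ᵐ x ∂m, x ∈ G := by
    rw [ae_iff]; simpa [hG] using hN0
  set E : ι → Set X := fun i => (D ∩ closedBall (W.center i) (9 * W.radius i)) ∩ G with hE
  have hEm : ∀ i, MeasurableSet (E i) := fun i =>
    (hD.measurableSet.inter measurableSet_closedBall).inter hGm
  set F : ι → X → ℝ≥0∞ := fun i =>
    if hi : i ∈ W.small D then (E i).indicator fun x => ENNReal.ofReal (g ⟨i, hi⟩ x) else 0 with hF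
  have hFi : ∀ i : W.small D, F i = (E i).indicator fun x => ENNReal.ofReal (g i x) := fun i => by
    simp only [hF]; rw [dif_pos i.2]
  refine ⟨F, fun i => ?_, fun i z hz => ?_, fun z => ?_, fun i hi => ?_⟩
  · by_cases hi : i ∈ W.small D
    · rw [hFi ⟨i, hi⟩]
      exact ((hgm ⟨i, hi⟩).ennreal_ofReal).indicator (hEm i)
    · simp only [hF]; rw [dif_neg hi]; exact measurable_const
  · by_cases hi : i ∈ W.small D
    · rw [hFi ⟨i, hi⟩] at hz
      exact (mem_of_indicator_ne_zero hz).1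
    · simp only [hF] at hz; rw [dif_neg hi] at hz; exact absurd rfl hz
  · by_cases hz : z ∈ G
    · calc ∑' i : W.small D, F i z ≤ ∑' i : W.small D, ENNReal.ofReal (f i z) := by
            refine ENNReal.tsum_le_tsum fun i => ?_
            rw [hFi i, (hGgood z hz).1 i]
            exact indicator_le_self _ _ _
        _ ≤ D.indicator (fun _ => 1) z := (hGgood z hz).2
        _ ≤ 1 := indicator_le_self _ _ _
    · have : ∀ i : W.small D, F i z = 0 := fun i => by
        rw [hFi i]; exact indicator_of_notMem (fun h => hz h.2) _
      simp [this]
  · filter_upwards [hGae, ae_mem_closedBall f hf hi] with x hx hxb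
    rw [hFi ⟨i, hi⟩]
    by_cases hxE : x ∈ E i
    · rw [indicator_of_mem hxE, (hGgood x hx).1 ⟨i, hi⟩]
    · rw [indicator_of_notMem hxE]
      by_cases hxD : x ∈ D
      · have : x ∉ closedBall (W.center i) (9 * W.radius i) := fun h => hxE ⟨⟨hxD, h⟩, hx⟩
        rw [hxb this, ENNReal.ofReal_zero]
      · have h1 := (hGgood x hx).2
        rw [indicator_of_notMem hxD, nonpos_iff_eq_zero, ENNReal.tsum_eq_zero] at h1
        exact h1 ⟨i, hi⟩

open Classical in
/-- The coefficients of the extension: the averages, and zero for the large balls. -/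
def coefficient (m : Measure X) (D : Set X) (W : WhitneyCover (1 / 4) (closure D)ᶜ ι)
    (f : ι → X → ℝ) (v : X → ℝ) (i : ι) : ℝ :=
  if i ∈ W.small D then average m D f v i else 0

lemma isAveraging (h : IsJumpSpace k m J φ) (hA : 0 < A) (hD : IsOpen D) {f : ι → X → ℝ}
    (hf : IsWeightFamily m D W A f) {F : ι → X → ℝ≥0∞} (hFm : ∀ i, Measurable (F i))
    (hFs : ∀ i z, F i z ≠ 0 → z ∈ D ∧ z ∈ closedBall (W.center i) (9 * W.radius i))
    (hFsum : ∀ z, ∑' i : W.small D, F i z ≤ 1)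
    (hFf : ∀ i ∈ W.small D, (fun x => ENNReal.ofReal (f i x)) =ᵐ[m] F i) {v u : X → ℝ}
    (hv : MemLp v 2 (m.restrict D)) (hvu : v =ᵐ[m.restrict D] u) {L : Set ι}
    (hL : L ⊆ W.small D) {Ω : Set X}
    (hΩ : ∀ i ∈ L, D ∩ closedBall (W.center i) (9 * W.radius i) ⊆ Ω) :
    IsAveraging m W (ENNReal.ofReal A) L Ω F u (coefficient m D W f v) := by
  have hDF : ∀ (i : ι) (g : X → ℝ≥0∞), ∫⁻ z, F i z * g z ∂m = ∫⁻ z in D, F i z * g z ∂m := by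
    intro i g
    rw [← lintegral_indicator hD.measurableSet]
    refine lintegral_congr fun z => ?_
    by_cases hz : z ∈ D
    · rw [indicator_of_mem hz]
    · rw [indicator_of_notMem hz]
      have : F i z = 0 := by
        by_contra h0; exact hz (hFs i z h0).1
      rw [this, zero_mul]
  have hmass : ∀ i ∈ W.small D, ∫⁻ z, F i z ∂m = ∫⁻ z in D, ENNReal.ofReal (f i z) ∂m := by
    intro i hi
    have h1 := hDF i 1
    simp only [Pi.one_apply, mul_one] at h1
    rw [h1]
    have h2 : (fun x => ENNReal.ofReal (f i x)) =ᵐ[m.restrict D] F i := ae_restrict_of_ae (hFf i hi)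
    exact lintegral_congr_ae h2.symm
  refine ⟨hFm, fun i _ z hz => (hFs i z hz).2, fun i hi z hz => hΩ i hi (hFs i z hz),
    fun i hi => ?_, fun i hi => ?_, fun z => ?_, fun i hi c => ?_⟩
  · rw [hmass i (hL hi)]
    calc W.vol m i = ENNReal.ofReal A * (ENNReal.ofReal A⁻¹ * W.vol m i) := by
          rw [← mul_assoc, ← ENNReal.ofReal_mul hA.le, mul_inv_cancel₀ hA.ne',
            ENNReal.ofReal_one, one_mul]
      _ ≤ _ := by gcongr; exact hf.mass_lower i (hL hi)
  · rw [hmass i (hL hi)]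
    exact ne_top_of_le_ne_top (ENNReal.mul_ne_top ENNReal.ofReal_ne_top (W.vol_ne_top h i))
      (hf.mass_upper i (hL hi))
  · refine le_trans ?_ (hFsum z)
    exact ENNReal.tsum_mono_subtype (fun i => F i z) hL
  · have hiΛ := hL hi
    have hlp : MemLp (f i) 2 (m.restrict D) := (hf.memLp i hiΛ).restrict D
    have hf0 : 0 ≤ᵐ[m.restrict D] f i := by
      filter_upwards [ae_restrict_of_ae (hf.mem_Icc i hiΛ)] with x hx using hx.1
    have hMt : ∫⁻ z in D, ENNReal.ofReal (f i z) ∂m ≠ ∞ :=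
      ne_top_of_le_ne_top (ENNReal.mul_ne_top ENNReal.ofReal_ne_top (W.vol_ne_top h i))
        (hf.mass_upper i hiΛ)
    have hM0 : ∫⁻ z in D, ENNReal.ofReal (f i z) ∂m ≠ 0 := fun h0 => by
      have h1 := hf.mass_lower i hiΛ
      rw [h0, nonpos_iff_eq_zero, mul_eq_zero] at h1
      exact h1.elim (ENNReal.ofReal_pos.2 (inv_pos.2 hA)).ne' (W.vol_ne_zero i)
    have hfi : Integrable (f i) (m.restrict D) :=
      ⟨hlp.1, (hasFiniteIntegral_iff_ofReal hf0).2 hMt.lt_top⟩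
    have hM : ∫ z in D, f i z ∂m ≠ 0 := by
      rw [integral_eq_lintegral_of_nonneg_ae hf0 hlp.1]
      exact (ENNReal.toReal_pos hM0 hMt).ne'
    have key := ofReal_sq_mean_sub_mul_le hfi (hlp.integrable_mul hv) hf0 hM c
    rw [hmass i hiΛ, coefficient, if_pos hiΛ, average, hDF]
    refine key.trans (le_of_eq (lintegral_congr_ae ?_))
    filter_upwards [ae_restrict_of_ae (hFf i hiΛ), hvu] with x h1 h2
    rw [← h1, h2]

/-- The extension in terms of strict data. -/
lemma extension_ae_eq_glue (hD : IsOpen D) (hD0 : m (closure D \ D) = 0) {f η η' : ι → X → ℝ}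
    (hη : ∀ i, η i =ᵐ[m] η' i) {v u : X → ℝ} (hvu : v =ᵐ[m.restrict D] u) :
    extension m D W f η v =ᵐ[m] glue D (coefficient m D W f v) η' u := by
  have := W.countable
  have h0 : ∀ᵐ x ∂m, x ∉ closure D \ D := measure_eq_zero_iff_ae_notMem.1 hD0
  filter_upwards [ae_all_iff.2 hη, h0, (ae_restrict_iff' hD.measurableSet).1 hvu] with x h1 h2 h3
  unfold extension glue
  by_cases hx : x ∈ closure D
  · rw [if_pos hx, if_pos hx]
    refine h3 ?_
    by_contra hxD
    exact h2 ⟨hx, hxD⟩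
  · rw [if_neg hx, if_neg hx, tsum_subtype (W.small D)
      fun i => average m D f v i * partitionFn D η i x]
    refine tsum_congr fun i => ?_
    have hp : partitionFn D η i x = partitionFn D η' i x := by
      simp only [partitionFn, h1]
    by_cases hi : i ∈ W.small D
    · rw [indicator_of_mem hi, coefficient, if_pos hi, hp]
    · rw [indicator_of_notMem hi, coefficient, if_neg hi, zero_mul]

/-- The large Whitney balls have a radius that is bounded from below independently of the cover. -/
lemma exists_le_radius (hDo : IsOpen D) (hD : D.Nonempty) {δ : ℝ} (hδ : 0 < δ) :
    ∃ τ : ℝ, 0 < τ ∧ (ENNReal.ofReal δ ≤ ediam D → τ = δ / 2) ∧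
      ∀ (ι : Type u) (W : WhitneyCover (1 / 4) (closure D)ᶜ ι), ∀ i ∉ W.small D, τ ≤ W.radius i := by
  by_cases h1 : ENNReal.ofReal δ ≤ ediam D
  · refine ⟨δ / 2, by positivity, fun _ => rfl, fun ι W i hi => ?_⟩
    have h2 : ediam D / 2 ≤ ENNReal.ofReal (W.radius i) := not_lt.1 hi
    have h3 : ENNReal.ofReal (δ / 2) ≤ ENNReal.ofReal (W.radius i) := by
      rw [ENNReal.ofReal_div_of_pos two_pos, ENNReal.ofReal_ofNat]
      exact (ENNReal.div_le_div_right h1 2).trans h2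
    exact (ENNReal.ofReal_le_ofReal_iff (W.radius_pos i).le).1 h3
  · by_cases h2 : ediam D = 0
    · obtain ⟨p, hp⟩ := hD
      obtain ⟨ρ, hρ, hball⟩ := Metric.isOpen_iff.1 hDo p hp
      refine ⟨ρ / 6, by positivity, fun h => absurd h h1, fun ι W i _ => ?_⟩
      obtain ⟨z, hz, hlt⟩ := W.exists_mem_dist_lt ⟨p, hp⟩ i
      have hzp : z = p := ediam_eq_zero_iff.1 h2 hz hp
      have : ρ ≤ dist (W.center i) p := by
        by_contra hcon
        exact W.center_mem i (subset_closure (hball (mem_ball.2 (not_le.1 hcon))))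
      rw [hzp] at hlt
      linarith
    · have ht : ediam D ≠ ∞ := ne_top_of_lt (not_le.1 h1)
      refine ⟨(ediam D / 2).toReal, ENNReal.toReal_pos (ENNReal.div_pos h2 (by simp)).ne'
        (ENNReal.div_ne_top ht (by simp)), fun h => absurd h h1, fun ι W i hi => ?_⟩
      exact ENNReal.toReal_le_of_le_ofReal (W.radius_pos i).le (not_lt.1 hi)

/-- Whitney balls whose triple meets a ball centred in the closure of `D` are small. -/
lemma radius_lt_of_mem_meeting {x₀ : X} (hx₀ : x₀ ∈ closure D) {r : ℝ} {i : ι}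
    (hi : i ∈ W.meeting (ball x₀ r)) :
    W.radius i < r / 2 ∧ dist (W.center i) x₀ < 3 * W.radius i + r := by
  obtain ⟨x, hx, hxr⟩ := hi
  rw [WhitneyCover.triple, mem_ball'] at hx
  rw [mem_ball] at hxr
  have h1 := W.le_dist_center i hx₀
  have h2 := dist_triangle (W.center i) x x₀
  constructor <;> linarith

end

/-! ### Estimates for the extension operator -/

lemma Constants.ext_ne_top {A₁ A₂ : ℝ≥0∞} (h₁ : A₁ ≠ ∞) (h₂ : A₂ ≠ ∞) : k.ext A₁ A₂ ≠ ∞ := by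
  have hV := k.V_ne_top
  have hQ := k.Q_ne_top 2
  have h4 := k.H_ne_top 4
  have h9 := k.H_ne_top 9
  have ht := k.tail_ne_top
  have hJ : k.G 7 / ENNReal.ofReal k.J₁ ≠ ∞ :=
    ENNReal.div_ne_top (k.G_ne_top 7) (ENNReal.ofReal_pos.2 k.J₁_pos).ne'
  have hn : k.near A₁ ≠ ∞ := by unfold Constants.near; finiteness
  have hi : k.inner (k.near A₁) ≠ ∞ := by unfold Constants.inner; finiteness
  have ho : ∀ c : ℝ≥0∞, c ≠ ∞ → k.outer c ≠ ∞ := fun c hc => by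
    unfold Constants.outer; finiteness
  have h1 := ho _ hn
  have h2 := ho (k.near A₁ * (k.V ^ 5 * k.Q 2)) (by finiteness)
  unfold Constants.ext
  clear ho
  generalize k.outer _ = o₁ at h1 ⊢
  generalize k.outer _ = o₂ at h2 ⊢
  finiteness

/-- The constant in the estimate of the `E₁`-norm, where `κ` is a bound for the inverse of the scale
function at the size of the large Whitney balls. -/
def Constants.extOne (k : Constants) (A : ℝ) (κ : ℝ≥0∞) : ℝ≥0∞ :=
  k.ext (2 * ENNReal.ofReal A) (ENNReal.ofReal A) * (1 + κ) + (1 + k.V ^ 2 * ENNReal.ofReal A)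

lemma Constants.extOne_ne_top (A : ℝ) {κ : ℝ≥0∞} (hκ : κ ≠ ∞) : k.extOne A κ ≠ ∞ := by
  have hV := k.V_ne_top
  have h1 : k.ext (2 * ENNReal.ofReal A) (ENNReal.ofReal A) ≠ ∞ :=
    k.ext_ne_top (by finiteness) (by finiteness)
  unfold Constants.extOne
  finiteness

lemma Constants.one_le_ext (A₁ A₂ : ℝ≥0∞) : 1 ≤ k.ext A₁ A₂ :=
  (le_add_left le_rfl).trans le_self_add

lemma Constants.one_le_extOne (A : ℝ) (κ : ℝ≥0∞) : 1 ≤ k.extOne A κ :=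
  le_self_add.trans le_add_self

lemma memLp_two_iff_lintegral_lt_top {μ : Measure X} {v : X → ℝ} (hv : AEStronglyMeasurable v μ) :
    MemLp v 2 μ ↔ ∫⁻ x, ENNReal.ofReal (v x ^ 2) ∂μ < ∞ := by
  rw [memLp_two_iff_integrable_sq hv, Integrable,
    hasFiniteIntegral_iff_ofReal (Eventually.of_forall fun x => sq_nonneg _)]
  exact and_iff_right (hv.pow 2)

section

variable {D : Set X} {ι : Type u} {W : WhitneyCover (1 / 4) (closure D)ᶜ ι} {A : ℝ}
  {f η : ι → X → ℝ} {v : X → ℝ} {τ : ℝ}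

/-- The extension is in `F`, and its `E₁`-norm is bounded, if the large Whitney balls have radius at
least `τ`. -/
theorem memF_extension_and_formOne_le (h : IsJumpSpace k m J φ) (hA : 0 < A) (hD : IsOpen D)
    (hD0 : m (closure D \ D) = 0) (hf : IsWeightFamily m D W A f)
    (hη : IsCutoffFamily m J φ W A η) (hv : MemReflected m J D v) (hτ : 0 < τ)
    (hW : ∀ i ∉ W.small D, τ ≤ W.radius i) :
    MemF m J (extension m D W f η v) ∧ formOne m J (extension m D W f η v) ≤
      k.extOne A (scaleE φ (τ / 8))⁻¹ * reflectedFormOne m J D v := by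
  obtain ⟨η', hη', hηη⟩ := exists_isStrictCutoff hη
  obtain ⟨F, hFm, hFs, hFsum, hFf⟩ := exists_strict_weights hD hf
  obtain ⟨u, hum, hvu⟩ := hv.1.1.aemeasurable
  set a := coefficient m D W f v with ha
  set κ := (scaleE φ (τ / 8))⁻¹ with hκdef
  have hκt : κ ≠ ∞ := ENNReal.inv_ne_top.2 (h.scaleE_ne_zero (by positivity))
  have hav : IsAveraging m W (ENNReal.ofReal A) (W.small D) D F u a :=
    isAveraging h hA hD hf hFm hFs hFsum hFf hv.1 hvu le_rfl fun i _ => inter_subset_left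
  have ha0 : ∀ i ∉ W.small D, a i = 0 := fun i hi => if_neg hi
  have hw := extension_ae_eq_glue hD hD0 hηη hvu (W := W) (f := f)
  set w := glue D a η' u
  have hE := energyOn_glue_le h hη' hav hD hD0 MeasurableSet.univ hD.measurableSet
    inter_subset_right hum hτ (κ := κ) (fun i hi => ⟨hW i hi.2, le_rfl⟩) fun i hi => ha0 i hi.2
  have hN := lintegral_glue_sq_le h hη' hav hD hD0 hum ha0
  rw [univ_prod_univ, ← energyOn_univ_congr_ae hw, ← energyOn_congr_ae hvu] at hE
  have hM : ∫⁻ z in D, ENNReal.ofReal (u z ^ 2) ∂m = ∫⁻ z in D, ENNReal.ofReal (v z ^ 2) ∂m :=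
    lintegral_congr_ae (by filter_upwards [hvu] with x hx; rw [hx])
  have hN' : ∫⁻ x, ENNReal.ofReal (extension m D W f η v x ^ 2) ∂m =
      ∫⁻ x, ENNReal.ofReal (w x ^ 2) ∂m :=
    lintegral_congr_ae (by filter_upwards [hw] with x hx; rw [hx])
  rw [hM] at hE hN
  rw [← hN'] at hN
  have hMt : ∫⁻ z in D, ENNReal.ofReal (v z ^ 2) ∂m ≠ ∞ :=
    ((memLp_two_iff_lintegral_lt_top hv.1.1).1 hv.1).ne
  have hEt := hv.2.ne
  have hext : k.ext (2 * ENNReal.ofReal A) (ENNReal.ofReal A) ≠ ∞ :=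
    k.ext_ne_top (by finiteness) (by finiteness)
  have hV := k.V_ne_top
  refine ⟨⟨?_, hE.trans_lt ?_⟩, ?_⟩
  · rw [memLp_two_iff_lintegral_lt_top
      ((measurable_glue hη' hum a).aestronglyMeasurable.congr hw.symm)]
    refine hN.trans_lt ?_
    finiteness
  · finiteness
  · rw [formOne, form, reflectedFormOne, Constants.extOne]
    refine (add_le_add (mul_le_mul' le_rfl hE) hN).trans ?_
    set c := k.ext (2 * ENNReal.ofReal A) (ENNReal.ofReal A)
    set b := 1 + k.V ^ 2 * ENNReal.ofReal A
    set E := energyOn m J (D ×ˢ D) v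
    set M := ∫⁻ z in D, ENNReal.ofReal (v z ^ 2) ∂m
    have h2 : (2⁻¹ : ℝ≥0∞) ≤ 1 := by simp
    calc 2⁻¹ * (c * (E + κ * M)) + b * M = c * (2⁻¹ * E) + (2⁻¹ * (c * κ) * M + b * M) := by ring
      _ ≤ c * (2⁻¹ * E) + (1 * (c * κ) * M + b * M) := by gcongr
      _ ≤ c * (2⁻¹ * E) + (1 * (c * κ) * M + b * M) +
          (c * κ * (2⁻¹ * E) + b * (2⁻¹ * E) + c * M) := le_self_add
      _ = _ := by ring

theorem energyOn_ball_extension_le (h : IsJumpSpace k m J φ) (hA : 0 < A) (hD : IsOpen D)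
    (hD0 : m (closure D \ D) = 0) (hf : IsWeightFamily m D W A f)
    (hη : IsCutoffFamily m J φ W A η) (hv : MemReflected m J D v) {x₀ : X} (hx₀ : x₀ ∈ closure D)
    {r : ℝ} (hr : 0 < r) (hrD : ENNReal.ofReal r < ediam D) :
    energyOn m J (ball x₀ r ×ˢ ball x₀ r) (extension m D W f η v) ≤
      k.ext (2 * ENNReal.ofReal A) (ENNReal.ofReal A) *
        energyOn m J ((D ∩ ball x₀ (7 * r)) ×ˢ (D ∩ ball x₀ (14 * r))) v := by
  obtain ⟨η', hη', hηη⟩ := exists_isStrictCutoff hη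
  obtain ⟨F, hFm, hFs, hFsum, hFf⟩ := exists_strict_weights hD hf
  obtain ⟨u, hum, hvu⟩ := hv.1.1.aemeasurable
  set B := ball x₀ r with hB
  set Ω := D ∩ ball x₀ (7 * r) with hΩ
  set a := coefficient m D W f v with ha
  -- The Whitney balls that meet `B` are small, so all of them carry an average.
  have hL : W.meeting B ⊆ W.small D := fun i hi => by
    have h1 := (radius_lt_of_mem_meeting hx₀ hi).1
    have h2 : ENNReal.ofReal (W.radius i) ≤ ENNReal.ofReal r / 2 := by
      rw [← ENNReal.ofReal_ofNat, ← ENNReal.ofReal_div_of_pos two_pos]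
      exact ENNReal.ofReal_le_ofReal h1.le
    exact h2.trans_lt (ENNReal.div_lt_div_right two_ne_zero ENNReal.ofNat_ne_top hrD)
  have hLΩ : ∀ i ∈ W.meeting B, D ∩ closedBall (W.center i) (9 * W.radius i) ⊆ Ω :=
    fun i hi z hz => by
      obtain ⟨h1, h2⟩ := radius_lt_of_mem_meeting hx₀ hi
      refine ⟨hz.1, mem_ball.2 ?_⟩
      have h3 := mem_closedBall.1 hz.2
      have h4 := dist_triangle z (W.center i) x₀
      linarith
  have hav : IsAveraging m W (ENNReal.ofReal A) (W.meeting B) Ω F u a :=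
    isAveraging h hA hD hf hFm hFs hFsum hFf hv.1 hvu hL hLΩ
  have hw := extension_ae_eq_glue hD hD0 hηη hvu (W := W) (f := f)
  have hE := energyOn_glue_le h hη' hav hD hD0 measurableSet_ball
    (hD.measurableSet.inter measurableSet_ball)
    (fun z hz => ⟨hz.2, ball_subset_ball (by linarith) hz.1⟩) hum one_pos (κ := 0)
    (fun i hi => absurd hi.1 hi.2) fun i hi => absurd hi.1 hi.2
  rw [zero_mul, add_zero, ← energyOn_congr_ae (ae_restrict_of_ae hw),
    ← energyOn_congr_ae (ae_restrict_of_ae_restrict_of_subset inter_subset_left hvu)] at hE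
  refine hE.trans (mul_le_mul' le_rfl (lintegral_mono_set (prod_mono le_rfl ?_)))
  exact inter_subset_inter_right _ (ball_subset_ball (by linarith))

end

end

end ReflectedJump

open ReflectedJump in
theorem proposition4p1
    (Cv c₁ c₂ β₁ β₂ J₁ J₂ Cc cD : ℝ) (hCv : 1 < Cv) (hc₁ : 0 < c₁) (hc₂ : 0 < c₂)
    (hβ₁ : 0 < β₁) (hβ : β₁ ≤ β₂) (hJ₁ : 0 < J₁) (hJ₂ : 0 < J₂) (hCc : 0 < Cc)
    (hcD : 0 < cD) (hcD' : cD ≤ 1) :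
    ∃ A₀ : ℝ, 1 < A₀ ∧ ∀ A : ℝ, A₀ ≤ A →
    ∃ C : ℝ, 0 < C ∧ ∀ δ₀ : ℝ, 0 < δ₀ →
    ∃ K : ℝ, 0 < K ∧
    ∀ (X : Type u) [MetricSpace X] [LocallyCompactSpace X] [SecondCountableTopology X]
      [MeasurableSpace X] [BorelSpace X]
      (m : Measure X) [IsLocallyFiniteMeasure m] [m.IsOpenPosMeasure]
      (φ : ℝ → ℝ) (J : X → X → ℝ≥0∞) (D : Set X),
      IsScaleFunction φ c₁ c₂ β₁ β₂ →
      IsRegularJumpForm m J →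
      VolumeDoubling m Cv →
      CapUpper m J φ Cc →
      JumpBounds m J φ J₁ J₂ →
      IsOpen D → D.Nonempty → closure D ≠ univ →
      AhlforsRegular m D cD →
      (∃ ι : Type u, Nonempty (WhitneyCover (1 / 4) (closure D)ᶜ ι)) ∧
      ∃ C₁ : ℝ, 0 < C₁ ∧ (ENNReal.ofReal δ₀ ≤ ediam D → C₁ ≤ K) ∧
      ∀ (ι : Type u) (W : WhitneyCover (1 / 4) (closure D)ᶜ ι),
        (∃ f η : ι → X → ℝ, IsWeightFamily m D W A f ∧ IsCutoffFamily m J φ W A η) ∧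
        ∀ f η : ι → X → ℝ, IsWeightFamily m D W A f → IsCutoffFamily m J φ W A η →
        ∀ v : X → ℝ, MemReflected m J D v →
          MemF m J (extension m D W f η v) ∧
          formOne m J (extension m D W f η v) ≤ ENNReal.ofReal C₁ * reflectedFormOne m J D v ∧
          ∀ x₀ ∈ closure D, ∀ r : ℝ, 0 < r → ENNReal.ofReal r < ediam D →
            energyOn m J (ball x₀ r ×ˢ ball x₀ r) (extension m D W f η v) ≤
              ENNReal.ofReal C *
                energyOn m J ((D ∩ ball x₀ (7 * r)) ×ˢ (D ∩ ball x₀ (14 * r))) v := by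
  let k : Constants := ⟨Cv, c₁, c₂, β₁, β₂, J₁, J₂, hCv, hc₁, hc₂, hβ₁, hJ₁⟩
  set cap : ℝ≥0∞ := k.V ^ 6 * (2 * ENNReal.ofReal Cc * (k.V ^ 2 * k.Q 2)) with hcap
  have hcapt : cap ≠ ∞ := by
    have hV := k.V_ne_top
    have hQ := k.Q_ne_top 2
    rw [hcap]; finiteness
  refine ⟨max 2 (max (k.weight cD) cap.toReal), lt_max_of_lt_left one_lt_two, fun A hA => ?_⟩
  have hA2 : 0 < A := two_pos.trans_le ((le_max_left _ _).trans hA)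
  have hAw : k.weight cD ≤ A := (le_max_left _ _).trans ((le_max_right _ _).trans hA)
  have hAc : cap ≤ ENNReal.ofReal A := by
    rw [← ENNReal.ofReal_toReal hcapt]
    exact ENNReal.ofReal_le_ofReal ((le_max_right _ _).trans ((le_max_right _ _).trans hA))
  set c := k.ext (2 * ENNReal.ofReal A) (ENNReal.ofReal A)
  have hct : c ≠ ∞ := k.ext_ne_top (by finiteness) (by finiteness)
  have toReal_pos : ∀ {b : ℝ≥0∞}, 1 ≤ b → b ≠ ∞ → 0 < b.toReal := fun h1 h2 =>
    ENNReal.toReal_pos (zero_lt_one.trans_le h1).ne' h2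
  refine ⟨c.toReal, toReal_pos (k.one_le_ext _ _) hct, fun δ₀ hδ₀ => ?_⟩
  obtain ⟨n, hn⟩ := pow_unbounded_of_one_lt (16 / δ₀) one_lt_two
  refine ⟨(k.extOne A (k.Q n)).toReal,
    toReal_pos (k.one_le_extOne _ _) (k.extOne_ne_top _ (k.Q_ne_top n)), ?_⟩
  intro X _ _ _ _ _ m _ _ φ J D hφ hform hVD hCap hJ hDo hD _ hreg
  have h : IsJumpSpace k m J φ := ⟨hφ, hform.measurable, hform.symm, hVD, hJ⟩
  have hD0 := measure_closure_diff_eq_zero h hDo hcD hreg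
  obtain ⟨τ, hτ, hτδ, hWτ⟩ := exists_le_radius hDo hD hδ₀
  set κ := (scaleE φ (τ / 8))⁻¹ with hκ
  have hκt : κ ≠ ∞ := ENNReal.inv_ne_top.2 (h.scaleE_ne_zero (by positivity))
  have hCt := k.extOne_ne_top A hκt
  refine ⟨exists_whitneyCover hD, (k.extOne A κ).toReal, toReal_pos (k.one_le_extOne _ _) hCt,
    fun hdiam => ?_, fun ι W => ⟨?_, fun f η hf hη v hv => ?_⟩⟩
  · -- In this case `τ / 8 = δ₀ / 16`, and `φ 1 = 1` bounds `φ (δ₀ / 16)` from below.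
    refine ENNReal.toReal_mono (k.extOne_ne_top _ (k.Q_ne_top n)) ?_
    have h1 : scaleE φ 1 ≤ k.Q n * scaleE φ (τ / 8) := by
      refine h.scaleE_le n (by positivity) zero_le_one ?_
      rw [div_lt_iff₀ hδ₀] at hn
      rw [hτδ hdiam]
      linarith
    have h2 : κ ≤ k.Q n := by
      rw [scaleE, hφ.map_one, ENNReal.ofReal_one] at h1
      rw [hκ, ← one_div]
      exact ENNReal.div_le_of_le_mul h1
    unfold Constants.extOne
    gcongr
  · obtain ⟨f, hf⟩ := exists_isWeightFamily h hDo hD hcD hcD' hreg W hAw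
    obtain ⟨η, hη⟩ := exists_isCutoffFamily h hCc hCap hD W hAc
    exact ⟨f, η, hf, hη⟩
  · obtain ⟨h1, h2⟩ := memF_extension_and_formOne_le h hA2 hDo hD0 hf hη hv hτ (hWτ ι W)
    rw [ENNReal.ofReal_toReal hCt, ENNReal.ofReal_toReal hct]
    exact ⟨h1, h2, fun x₀ hx₀ r hr hrD => energyOn_ball_extension_le h hA2 hDo hD0 hf hη hv hx₀ hr hrD⟩
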